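/- Let $d\ge 2$, $\mathbb T^d=[0,2\pi]^d$ with periodic boundary conditions, and for $f:\mathbb T^d\to\mathbb R$ let $\hat f(k)=(2\pi)^{-d}\int_{\mathbb T^d}f(x)e^{-ik\cdot x}\,dx$. Fix $r>3$. For $s\ge1$, $\tau>0$ put $$\|f\|_{G^s_\tau}=\|(-\Delta)^{r/2}e^{\tau(-\Delta)^{1/(2s)}}f\|_{L^2}=\Big(\sum_{k\in\mathbb Z^d\setminus\{0\}}|k|^{2r}e^{2\tau|k|^{1/s}}|\hat f(k)|^2\Big)^{1/2},$$ and let $G^s$ be the set of smooth, real-valued, mean-free $f$ on $\mathbb T^d$ with $\|f\|_{G^s_\tau}<\infty$ for some $\tau>0$. Consider $$\partial_t\theta+u\cdot\nabla\theta=0,\qquad u=\mathbf T\theta,\qquad \nabla\cdot u=0,\qquad \theta(\cdot,0)=\theta_0,\tag{1}$$ on $\mathbb T^d$, where $\mathbf T$ is the Fourier multiplier operator $\widehat{\mathbf T\theta}(k)=\widehat{\mathbf T}(k)\hat\theta(k)$ with symbol $\widehat{\mathbf T}:\mathbb Z^d\to\mathbb C^d$. The symbol is assumed to map real scalars to real divergence-free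 vector fields, i.e. $\widehat{\mathbf T}(-k)=\overline{\widehat{\mathbf T}(k)}$ and $k\cdot\widehat{\mathbf T}(k)=0$ for all $k$, and to satisfy $|\widehat{\mathbf T}(k)|\le C|k|^{r_0}$ for all $k\in\mathbb Z^d$, with constants $C>0$ and $r_0\in[0,1]$. A solution of (1) in $G^s$ on $[0,T_*)$ is a real function $\theta$ on $\mathbb T^d\times[0,T_*)$ with $\theta(\cdot,t)\in G^s$ for all $t\in[0,T_*)$, such that for every $T'<T_*$ there is $\tau>0$ with $\sup_{0\le t\le T'}\|\theta(\cdot,t)\|_{G^s_\tau}<\infty$, and which satisfies (1) pointwise (with the one-sided time derivative at $t=0$). Let $r_0\in(0,1]$ and $s\in[1,1/r_0]$, or let $r_0=0$ and $s\ge1$. Then for all $\tau_0>0$ and $K_0>0$ there is a time $T_*=T_*(\tau_0,K_0)>0$ (depending otherwise only on $d,C,r_0,s,r$) such that for every such $\mathbf T$ and every $\theta_0\in G^s$ with $\|\theta_0\|_{G^s_{\tau_0}}\le K_0$, the initial value problem (1) has a unique solution in $G^s$ on $[0,T_*)$. -/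

import Mathlib

open scoped ContDiff ENNReal

noncomputable section

namespace ActiveScalar

variable {d : ℕ}

/-- Euclidean length `|k|` of a frequency `k ∈ ℤ^d`. -/
def freqNorm (k : Fin d → ℤ) : ℝ := Real.sqrt (∑ j, (k j : ℝ) ^ 2)

/-- A smooth function on the torus `[0,2π]^d`: a smooth function on `ℝ^d`, `2π`-periodic in every
coordinate. -/
structure IsSmoothPeriodic (f : (Fin d → ℝ) → ℝ) : Prop where
  smooth : ContDiff ℝ ∞ f
  periodic : ∀ (x : Fin d → ℝ) (j : Fin d), f (x + Pi.single j (2 * Real.pi)) = f x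

/-- Fourier coefficient `(2π)^{-d} ∫_{[0,2π]^d} f(x) e^{-i k·x} dx`. -/
def torusCoeff (f : (Fin d → ℝ) → ℝ) (k : Fin d → ℤ) : ℂ :=
  ((2 * Real.pi : ℝ) : ℂ)⁻¹ ^ d *
    ∫ x in Set.Icc (0 : Fin d → ℝ) (fun _ => 2 * Real.pi),
      (f x : ℂ) * Complex.exp (-Complex.I * ((∑ j, (k j : ℝ) * x j : ℝ) : ℂ))

/-- The norm `(∑_{k ≠ 0} |k|^{2r} e^{2τ|k|^{1/s}} |f̂(k)|²)^{1/2}` of `G^s_τ`, with values in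
`[0,∞]`. -/
def gevreyNorm (s r τ : ℝ) (f : (Fin d → ℝ) → ℝ) : ℝ≥0∞ :=
  (∑' k : {k : Fin d → ℤ // k ≠ 0},
    ENNReal.ofReal (freqNorm k.1 ^ (2 * r) * Real.exp (2 * τ * freqNorm k.1 ^ (1 / s)) *
      ‖torusCoeff f k.1‖ ^ 2)) ^ (1 / 2 : ℝ)

/-- The Gevrey class `G^s` of mean-free functions on the torus. -/
structure MemGevrey (s r : ℝ) (f : (Fin d → ℝ) → ℝ) : Prop where
  smoothPeriodic : IsSmoothPeriodic f
  meanZero : ∫ x in Set.Icc (0 : Fin d → ℝ) (fun _ => 2 * Real.pi), f x = 0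
  finite_norm : ∃ τ : ℝ, 0 < τ ∧ gevreyNorm s r τ f < ⊤

/-- Partial derivative `∂f/∂x_j`. -/
def partialDeriv (j : Fin d) (f : (Fin d → ℝ) → ℝ) (x : Fin d → ℝ) : ℝ :=
  fderiv ℝ f x (Pi.single j 1)

/-- `u = 𝐓 f` for the Fourier multiplier `𝐓` with symbol `T`: `u` is the smooth periodic real vector
field with `û_j(k) = T_j(k) f̂(k)` for all `k`. -/
structure IsMultiplierImage (T : (Fin d → ℤ) → EuclideanSpace ℂ (Fin d))
    (f : (Fin d → ℝ) → ℝ) (u : (Fin d → ℝ) → Fin d → ℝ) : Prop where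
  smoothPeriodic : ∀ j, IsSmoothPeriodic (fun x => u x j)
  coeff : ∀ (j : Fin d) (k : Fin d → ℤ),
    torusCoeff (fun x => u x j) k = T k j * torusCoeff f k

/-- The symbol `T` is that of an operator sending real scalars to real, divergence-free vector
fields, with `|T(k)| ≤ C |k|^{r₀}` for all `k`. -/
structure IsAdmissibleSymbol (C r₀ : ℝ) (T : (Fin d → ℤ) → EuclideanSpace ℂ (Fin d)) : Prop where
  bound : ∀ k, ‖T k‖ ≤ C * freqNorm k ^ r₀
  divFree : ∀ k, ∑ j, (k j : ℂ) * T k j = 0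
  real : ∀ k j, T (-k) j = starRingEnd ℂ (T k j)

/-- `θ` is a solution in `G^s` on `[0,Tmax)` of `∂ₜθ + u·∇θ = 0`, `u = 𝐓θ`, `∇·u = 0`, `θ(0) = θ₀`:
it lies in `G^s` at each time, with radius and norm locally uniform in time, and it satisfies the
equations pointwise (with the one-sided time derivative at `t = 0`). -/
structure IsGevreySolution (T : (Fin d → ℤ) → EuclideanSpace ℂ (Fin d)) (s r Tmax : ℝ)
    (θ₀ : (Fin d → ℝ) → ℝ) (θ : ℝ → (Fin d → ℝ) → ℝ) : Prop where
  initial : θ 0 = θ₀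
  memGevrey : ∀ t ∈ Set.Ico 0 Tmax, MemGevrey s r (θ t)
  locallyBounded : ∀ T' ∈ Set.Ico 0 Tmax, ∃ τ : ℝ, 0 < τ ∧ ∃ M : ℝ,
    ∀ t ∈ Set.Icc 0 T', gevreyNorm s r τ (θ t) ≤ ENNReal.ofReal M
  equation : ∃ u : ℝ → (Fin d → ℝ) → Fin d → ℝ, ∀ t ∈ Set.Ico 0 Tmax,
    IsMultiplierImage T (θ t) (u t) ∧
    (∀ x, ∑ j, partialDeriv j (fun y => u t y j) x = 0) ∧
    ∀ x, HasDerivWithinAt (fun t' => θ t' x)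
      (-∑ j, u t x j * partialDeriv j (θ t) x) (Set.Ico 0 Tmax) t

end ActiveScalar

end

open scoped ContDiff ENNReal

noncomputable section

namespace ActiveScalar

variable {d : ℕ}

/-! ### Frequencies -/

/-! Write `a = 1/s`, so that `r₀ ≤ a ≤ 1`. Off the zero frequency the symbol is bounded by `C|k|^a`,
and the equation for the Fourier coefficients is `c' = transport T c c`, a convolution with kernel
`T(k-l)·l`. The nonlinearity loses one derivative through the gradient and `a` more through `T`.
Gevrey weights `e^{2τ|k|^a}` with a radius decreasing in time, `τ(t) = τ₁ - λt`, make up for this: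
differentiating the weight yields a dissipation `-2λD`, where `D` carries an extra `|k|^a`.

The full derivative is reduced to `|l|^a` by a cancellation. Since `T` is divergence free and real,
exchanging `k` and `l` conjugates the trilinear form (`trilinear_swap`), so only the differences of
weights `W(k) - W(l)` remain (`tsum_mul_re_transport_le`). The inequality `y (x^a - y^a) ≤ y^a (x -
y)` then shows that `|l| (W(k) - W(l))` costs `|l|^a |k-l|` (`weight_commutator_le`). The factor
`|k-l|^a` from `T` is put on the drift if `k-l` is the lower frequency, and is absorbed by `D`
otherwise. The outcome is `|nonlinear term| ≤ const · B · D`, with `B` a weighted `ℓ¹` norm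
controlled by the energy. Taking `λ` large compared with the initial energy keeps the energy bounded
until the radius has been halved, and that time depends only on the data bounds.

Existence: the estimate holds for Galerkin truncations, uniformly in the truncation
(`exists_galerkin`). It gives pointwise compactness of the coefficients. A second order Taylor bound
in time (`norm_taylor_remainder_le`), also uniform, is a closed condition and survives the limit. It
contains the equation, and summing it over `k` gives the time derivative pointwise in `x`.

Uniqueness: the difference `δ` of two solutions satisfies `δ' = transport T c₁ δ + transport T δ
c₂`. The first term has the commutator cancellation. In the second the derivative falls on the
regular `c₂`, and the loss `a` on `δ` is absorbed by `D` (`energy_difference_le`). Hence the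
weighted energy of `δ` decreases on short intervals whose length is uniform
(`IsFourierSolution.eq_of_initial_eq`).

Polynomial factors never matter: they are absorbed by an arbitrarily small loss of radius. Norms are
therefore traded for pointwise bounds `GevreyDecay` and back. -/

lemma freqNorm_eq_norm (k : Fin d → ℤ) :
    freqNorm k = ‖(WithLp.toLp 2 (fun j => (k j : ℝ)) : EuclideanSpace ℝ (Fin d))‖ := by
  simp [freqNorm, EuclideanSpace.norm_eq]

lemma freqNorm_nonneg (k : Fin d → ℤ) : 0 ≤ freqNorm k := Real.sqrt_nonneg _

@[simp] lemma freqNorm_neg (k : Fin d → ℤ) : freqNorm (-k) = freqNorm k := by simp [freqNorm]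

lemma freqNorm_add_le (k l : Fin d → ℤ) : freqNorm (k + l) ≤ freqNorm k + freqNorm l := by
  simp only [freqNorm_eq_norm]
  refine le_trans (le_of_eq ?_) (norm_add_le _ _)
  congr 1
  ext j
  simp

lemma freqNorm_sub_comm (k l : Fin d → ℤ) : freqNorm (k - l) = freqNorm (l - k) := by
  rw [← freqNorm_neg, neg_sub]

lemma freqNorm_le_sub_add (k l : Fin d → ℤ) : freqNorm k ≤ freqNorm (k - l) + freqNorm l := by
  simpa using freqNorm_add_le (k - l) l

lemma abs_coord_le_freqNorm (k : Fin d → ℤ) (j : Fin d) : |(k j : ℝ)| ≤ freqNorm k := by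
  rw [freqNorm_eq_norm]
  simpa using PiLp.norm_apply_le (WithLp.toLp 2 (fun j => (k j : ℝ)) : EuclideanSpace ℝ (Fin d)) j

lemma one_le_freqNorm {k : Fin d → ℤ} (hk : k ≠ 0) : 1 ≤ freqNorm k := by
  obtain ⟨j, hj⟩ := Function.ne_iff.1 hk
  refine le_trans ?_ (abs_coord_le_freqNorm k j)
  exact_mod_cast Int.one_le_abs hj

lemma freqNorm_sub_rpow_le {a : ℝ} (ha : 0 ≤ a) (ha1 : a ≤ 1) (k l : Fin d → ℤ) :
    freqNorm k ^ a ≤ freqNorm (k - l) ^ a + freqNorm l ^ a :=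
  (Real.rpow_le_rpow (freqNorm_nonneg _) (freqNorm_le_sub_add k l) ha).trans
    (Real.rpow_add_le_add_rpow (freqNorm_nonneg _) (freqNorm_nonneg _) ha ha1)

/-! ### Elementary inequalities for powers and exponentials -/

/-- For `x ≥ 1` and `N ≥ n/a` one has `x^n ≤ (x^a)^N`, which is dominated by a single term of the
exponential series. For `x ≤ 1` the factor `2^n` suffices. -/
lemma exists_pow_le_mul_exp_rpow {a ε : ℝ} (ha : 0 < a) (hε : 0 < ε) (n : ℕ) :
    ∃ M : ℝ, 0 < M ∧ ∀ x : ℝ, 0 ≤ x → (1 + x) ^ n ≤ M * Real.exp (ε * x ^ a) := by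
  obtain ⟨N, hN⟩ := exists_nat_ge ((n : ℝ) / a)
  refine ⟨2 ^ n * (1 + N.factorial / ε ^ N), by positivity, fun x hx => ?_⟩
  have hy : 0 ≤ ε * x ^ a := by positivity
  have h1 : 1 ≤ Real.exp (ε * x ^ a) := Real.one_le_exp hy
  have hf : 0 ≤ (N.factorial : ℝ) / ε ^ N := by positivity
  rcases le_total x 1 with h | h
  · calc (1 + x) ^ n ≤ 2 ^ n := by gcongr; linarith
      _ ≤ 2 ^ n * ((1 + N.factorial / ε ^ N) * Real.exp (ε * x ^ a)) := by
        refine le_mul_of_one_le_right (by positivity) ?_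
        nlinarith
      _ = _ := by ring
  · have h2 : x ^ n ≤ (x ^ a) ^ N := by
      rw [← Real.rpow_natCast x n, ← Real.rpow_mul_natCast hx]
      refine Real.rpow_le_rpow_of_exponent_le h ?_
      rw [div_le_iff₀ ha] at hN
      linarith
    have h3 : (x ^ a) ^ N ≤ N.factorial / ε ^ N * Real.exp (ε * x ^ a) := by
      have := Real.pow_div_factorial_le_exp _ hy N
      rw [mul_pow, div_le_iff₀ (by positivity)] at this
      rw [div_mul_eq_mul_div, le_div_iff₀ (by positivity)]
      linarith
    calc (1 + x) ^ n ≤ (2 * x) ^ n := by gcongr; linarith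
      _ = 2 ^ n * x ^ n := mul_pow _ _ _
      _ ≤ 2 ^ n * ((1 + N.factorial / ε ^ N) * Real.exp (ε * x ^ a)) := by
        gcongr
        nlinarith
      _ = _ := by ring

/-- After division by `y` this is `t^a ≤ t` for `t = x/y ≥ 1`. It is the source of the gain in the
commutator: a full factor `y` becomes `y^a`. -/
lemma mul_rpow_sub_rpow_le {a x y : ℝ} (ha1 : a ≤ 1) (hy : 0 < y) (hyx : y ≤ x) :
    y * (x ^ a - y ^ a) ≤ y ^ a * (x - y) := by
  have h1 : 1 ≤ x / y := (one_le_div hy).2 hyx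
  have h2 : (x / y) ^ a ≤ x / y := by
    simpa using Real.rpow_le_rpow_of_exponent_le h1 ha1
  rw [Real.div_rpow (hy.le.trans hyx) hy.le, div_le_div_iff₀ (by positivity) hy] at h2
  nlinarith

/-- Each of the `n` terms in the factorization of `x^n - y^n` by `x - y` is at most `x^(n-1)`. This
is the polynomial counterpart of the commutator gain. -/
lemma pow_sub_pow_le_mul {x y : ℝ} (hy : 0 ≤ y) (hyx : y ≤ x) (n : ℕ) :
    y * (x ^ n - y ^ n) ≤ n * x ^ n * (x - y) := by
  have h : x ^ n - y ^ n ≤ n * x ^ (n - 1) * (x - y) := by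
    have := (Commute.all x y).geom_sum₂_mul n
    rw [← this]
    refine mul_le_mul_of_nonneg_right ?_ (by linarith)
    calc ∑ i ∈ Finset.range n, x ^ i * y ^ (n - 1 - i)
        ≤ ∑ i ∈ Finset.range n, x ^ (n - 1) := by
          refine Finset.sum_le_sum fun i hi => ?_
          have hi' := Finset.mem_range.1 hi
          calc x ^ i * y ^ (n - 1 - i) ≤ x ^ i * x ^ (n - 1 - i) := by
                have := pow_nonneg (hy.trans hyx) i
                gcongr
            _ = x ^ (n - 1) := by rw [← pow_add]; congr 1; omega
      _ = _ := by simp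
  rcases Nat.eq_zero_or_pos n with rfl | hn
  · simp
  have hx : 0 ≤ x := hy.trans hyx
  calc y * (x ^ n - y ^ n) ≤ x * (n * x ^ (n - 1) * (x - y)) := by
        refine mul_le_mul hyx h (sub_nonneg.2 (pow_le_pow_left₀ hy hyx n)) hx
    _ = n * (x ^ (n - 1) * x) * (x - y) := by ring
    _ = _ := by rw [pow_sub_one_mul hn.ne']

/-! ### Summability over the frequency lattice -/

/-- A finite set of frequencies lies in a box, over which the sum factors into one-dimensional sums.
-/
lemma summable_prod_one_add_sq_inv :
    Summable fun k : Fin d → ℤ => ∏ j, (1 + (k j : ℝ) ^ 2)⁻¹ := by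
  have hs : Summable fun n : ℤ => (1 + (n : ℝ) ^ 2)⁻¹ := by
    have h := Real.summable_one_div_int_pow (p := 2) |>.2 (by norm_num)
    refine Summable.of_norm_bounded_eventually h ?_
    rw [Filter.eventually_cofinite]
    refine (Set.finite_singleton (0 : ℤ)).subset fun n hn => ?_
    by_contra h0
    apply hn
    have : (0 : ℝ) < (n : ℝ) ^ 2 := by
      have : (n : ℝ) ≠ 0 := by exact_mod_cast h0
      positivity
    rw [Real.norm_of_nonneg (by positivity), one_div]
    exact inv_anti₀ this (by linarith)
  refine summable_of_sum_le (c := (∑' n : ℤ, (1 + (n : ℝ) ^ 2)⁻¹) ^ d)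
    (fun k => Finset.prod_nonneg fun j _ => by positivity) fun S => ?_
  have hsub : S ⊆ Fintype.piFinset fun j : Fin d => S.image fun k => k j := by
    intro k hk
    rw [Fintype.mem_piFinset]
    exact fun j => Finset.mem_image_of_mem _ hk
  calc ∑ k ∈ S, ∏ j, (1 + (k j : ℝ) ^ 2)⁻¹
      ≤ ∑ k ∈ Fintype.piFinset fun j : Fin d => S.image fun k : Fin d → ℤ => k j,
          ∏ j, (1 + (k j : ℝ) ^ 2)⁻¹ :=
        Finset.sum_le_sum_of_subset_of_nonneg hsub
          fun k _ _ => Finset.prod_nonneg fun j _ => by positivity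
    _ = ∏ j : Fin d, ∑ n ∈ S.image fun k : Fin d → ℤ => k j, (1 + (n : ℝ) ^ 2)⁻¹ := by
        rw [Finset.prod_univ_sum]
    _ ≤ ∏ j : Fin d, ∑' n : ℤ, (1 + (n : ℝ) ^ 2)⁻¹ := by
        refine Finset.prod_le_prod (fun j _ => Finset.sum_nonneg fun n _ => by positivity)
          fun j _ => hs.sum_le_tsum _ fun n _ => by positivity
    _ = _ := by simp

lemma summable_one_add_freqNorm_inv_pow :
    Summable fun k : Fin d → ℤ => ((1 + freqNorm k) ^ (2 * d))⁻¹ := by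
  refine Summable.of_nonneg_of_le (fun k => ?_) (fun k => ?_) summable_prod_one_add_sq_inv
  · have := freqNorm_nonneg k
    positivity
  · rw [Finset.prod_inv_distrib]
    refine inv_anti₀ (Finset.prod_pos fun j _ => by positivity) ?_
    rw [pow_mul]
    calc ∏ j, (1 + (k j : ℝ) ^ 2) ≤ ∏ _j : Fin d, (1 + freqNorm k) ^ 2 := by
          refine Finset.prod_le_prod (fun j _ => by positivity) fun j _ => ?_
          have := abs_coord_le_freqNorm k j
          have h2 := sq_le_sq' (by linarith [abs_nonneg (k j : ℝ), neg_abs_le (k j : ℝ)])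
            ((le_abs_self _).trans this)
          nlinarith [freqNorm_nonneg k]
      _ = _ := by simp

lemma summable_pow_mul_exp_neg_rpow {a σ : ℝ} (ha : 0 < a) (hσ : 0 < σ) (n : ℕ) :
    Summable fun k : Fin d → ℤ => (1 + freqNorm k) ^ n * Real.exp (-σ * freqNorm k ^ a) := by
  obtain ⟨M, hM, h⟩ := exists_pow_le_mul_exp_rpow ha hσ (n + 2 * d)
  refine Summable.of_nonneg_of_le (fun k => ?_) (fun k => ?_)
    (summable_one_add_freqNorm_inv_pow.mul_left M)
  · have := freqNorm_nonneg k
    positivity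
  · have h0 := freqNorm_nonneg k
    have := h _ h0
    rw [neg_mul, Real.exp_neg, ← div_eq_mul_inv, ← div_eq_mul_inv,
      div_le_div_iff₀ (Real.exp_pos _) (by positivity), ← pow_add]
    exact this

/-! ### Characters and Fourier series -/

/-- The character `x ↦ e^{i k·x}`. -/
def torusChar (k : Fin d → ℤ) (x : Fin d → ℝ) : ℂ :=
  Complex.exp (Complex.I * ((∑ j, (k j : ℝ) * x j : ℝ) : ℂ))

/-- The sum of the Fourier series with coefficients `c`. -/
def fourierSum (c : (Fin d → ℤ) → ℂ) (x : Fin d → ℝ) : ℂ := ∑' k, c k * torusChar k x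

/-- Families of coefficients decaying faster than any power. -/
def RapidDecay (c : (Fin d → ℤ) → ℂ) : Prop :=
  ∀ n : ℕ, Summable fun k => (1 + freqNorm k) ^ n * ‖c k‖

/-- The symmetry of the Fourier coefficients of a real function. -/
def HermitianSymm (c : (Fin d → ℤ) → ℂ) : Prop := ∀ k, c (-k) = starRingEnd ℂ (c k)

@[simp] lemma norm_torusChar (k : Fin d → ℤ) (x : Fin d → ℝ) : ‖torusChar k x‖ = 1 := by
  rw [torusChar, mul_comm, Complex.norm_exp_ofReal_mul_I]

lemma torusChar_add (k l : Fin d → ℤ) (x : Fin d → ℝ) :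
    torusChar (k + l) x = torusChar k x * torusChar l x := by
  simp only [torusChar, ← Complex.exp_add, ← mul_add, ← Complex.ofReal_add,
    ← Finset.sum_add_distrib, ← add_mul, Pi.add_apply, Int.cast_add]

lemma torusChar_neg (k : Fin d → ℤ) (x : Fin d → ℝ) :
    torusChar (-k) x = starRingEnd ℂ (torusChar k x) := by
  simp [torusChar, ← Complex.exp_conj]

@[simp] lemma torusChar_zero (x : Fin d → ℝ) : torusChar 0 x = 1 := by simp [torusChar]

lemma torusChar_add_single (k : Fin d → ℤ) (x : Fin d → ℝ) (j : Fin d) :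
    torusChar k (x + Pi.single j (2 * Real.pi)) = torusChar k x := by
  have : ∑ i, (k i : ℝ) * (x + Pi.single j (2 * Real.pi) : Fin d → ℝ) i
      = ∑ i, (k i : ℝ) * x i + k j * (2 * Real.pi) := by
    simp [mul_add, Finset.sum_add_distrib, Pi.single_apply]
  rw [torusChar, torusChar, this, Complex.exp_eq_exp_iff_exists_int]
  exact ⟨k j, by push_cast; ring⟩

/-- The differential of the phase `i k·x`. -/
def phaseCLM (k : Fin d → ℤ) : (Fin d → ℝ) →L[ℝ] ℂ :=
  ∑ j, (ContinuousLinearMap.proj (R := ℝ) (φ := fun _ : Fin d => ℝ) j).smulRight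
    (Complex.I * (k j : ℂ))

lemma phaseCLM_apply (k : Fin d → ℤ) (v : Fin d → ℝ) :
    phaseCLM k v = Complex.I * ((∑ j, (k j : ℝ) * v j : ℝ) : ℂ) := by
  simp only [phaseCLM, _root_.sum_apply, ContinuousLinearMap.smulRight_apply,
    ContinuousLinearMap.proj_apply, Complex.real_smul, Complex.ofReal_sum, Finset.mul_sum]
  refine Finset.sum_congr rfl fun j _ => ?_
  push_cast
  ring

lemma norm_phaseCLM_le (k : Fin d → ℤ) : ‖phaseCLM k‖ ≤ d * freqNorm k := by
  refine ContinuousLinearMap.opNorm_le_bound _ (by have := freqNorm_nonneg k; positivity)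
    fun v => ?_
  rw [phaseCLM_apply, norm_mul, Complex.norm_I, one_mul, Complex.norm_real]
  calc ‖∑ j, (k j : ℝ) * v j‖ ≤ ∑ j, ‖(k j : ℝ) * v j‖ := norm_sum_le _ _
    _ ≤ ∑ _j : Fin d, freqNorm k * ‖v‖ := by
      refine Finset.sum_le_sum fun j _ => ?_
      rw [norm_mul]
      exact mul_le_mul (abs_coord_le_freqNorm k j) (norm_le_pi_norm v j) (norm_nonneg _)
        (freqNorm_nonneg k)
    _ = _ := by simp [mul_assoc]

lemma hasFDerivAt_torusChar (k : Fin d → ℤ) (x : Fin d → ℝ) :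
    HasFDerivAt (torusChar k) (torusChar k x • phaseCLM k) x := by
  have h : torusChar k = fun x => Complex.exp (phaseCLM k x) := by
    funext y
    rw [phaseCLM_apply, torusChar]
  rw [h]
  exact (phaseCLM k).hasFDerivAt.cexp

lemma continuous_torusChar (k : Fin d → ℤ) : Continuous (torusChar k) :=
  continuous_iff_continuousAt.2 fun x => (hasFDerivAt_torusChar k x).continuousAt

namespace RapidDecay

variable {a c : (Fin d → ℤ) → ℂ}

lemma summable_norm (hc : RapidDecay c) : Summable fun k => ‖c k‖ := by simpa using hc 0

lemma of_norm_le {p : ℕ} {A : ℝ} (hc : RapidDecay c)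
    (h : ∀ k, ‖a k‖ ≤ A * (1 + freqNorm k) ^ p * ‖c k‖) : RapidDecay a := fun n => by
  refine Summable.of_nonneg_of_le (fun k => ?_) (fun k => ?_) ((hc (n + p)).mul_left A)
  · have := freqNorm_nonneg k
    positivity
  · have := freqNorm_nonneg k
    calc (1 + freqNorm k) ^ n * ‖a k‖
        ≤ (1 + freqNorm k) ^ n * (A * (1 + freqNorm k) ^ p * ‖c k‖) := by
          gcongr
          exact h k
      _ = _ := by rw [pow_add]; ring

lemma deriv (hc : RapidDecay c) (j : Fin d) :
    RapidDecay fun k => Complex.I * (k j : ℂ) * c k := by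
  refine hc.of_norm_le (p := 1) (A := 1) fun k => ?_
  have := abs_coord_le_freqNorm k j
  rw [norm_mul, norm_mul, Complex.norm_I, one_mul, one_mul, pow_one, Complex.norm_intCast]
  gcongr
  linarith

lemma summable_fourierSum (hc : RapidDecay c) (x : Fin d → ℝ) :
    Summable fun k => c k * torusChar k x :=
  Summable.of_norm (by simpa using hc.summable_norm)

lemma neg (hc : RapidDecay c) : RapidDecay fun k => - c k :=
  hc.of_norm_le (p := 0) (A := 1) fun k => by simp

lemma add (ha : RapidDecay a) (hc : RapidDecay c) : RapidDecay fun k => a k + c k := fun n => by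
  refine Summable.of_nonneg_of_le (fun k => ?_) (fun k => ?_) ((ha n).add (hc n))
  · have := freqNorm_nonneg k
    positivity
  · rw [← mul_add]
    have := freqNorm_nonneg k
    gcongr
    exact norm_add_le _ _

lemma sum {ι : Type*} (s : Finset ι) {a : ι → (Fin d → ℤ) → ℂ} (h : ∀ i, RapidDecay (a i)) :
    RapidDecay fun k => ∑ i ∈ s, a i k := by
  classical
  induction s using Finset.induction_on with
  | empty => intro n; simp
  | insert i s hi ih =>
    simp only [Finset.sum_insert hi]
    exact (h i).add ih

end RapidDecay

lemma hasFDerivAt_fourierSum {c : (Fin d → ℤ) → ℂ} (hc : RapidDecay c) (x : Fin d → ℝ) :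
    HasFDerivAt (fourierSum c) (∑ j, (ContinuousLinearMap.proj (R := ℝ)
      (φ := fun _ : Fin d => ℝ) j).smulRight
        (fourierSum (fun k => Complex.I * (k j : ℂ) * c k) x)) x := by
  have hu : Summable fun k => d * ((1 + freqNorm k) ^ 1 * ‖c k‖) := (hc 1).mul_left _
  have hb : ∀ k y, ‖(c k * torusChar k y) • phaseCLM k‖ ≤ d * ((1 + freqNorm k) ^ 1 * ‖c k‖) := by
    intro k y
    rw [norm_smul, norm_mul, norm_torusChar, mul_one, pow_one]
    calc ‖c k‖ * ‖phaseCLM k‖ ≤ ‖c k‖ * (d * (1 + freqNorm k)) := by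
          gcongr
          refine (norm_phaseCLM_le k).trans ?_
          gcongr
          linarith
      _ = _ := by ring
  have h := hasFDerivAt_tsum (𝕜 := ℝ) (f := fun k y => c k * torusChar k y)
    (f' := fun k y => (c k * torusChar k y) • phaseCLM k) (x₀ := x) hu
    (fun k y => by
      have := (hasFDerivAt_torusChar k y).const_mul (c k)
      rwa [smul_smul] at this) hb (hc.summable_fourierSum x) x
  have hsum : Summable fun k => (c k * torusChar k x) • phaseCLM k :=
    Summable.of_norm_bounded hu fun k => hb k x
  suffices heq : (∑' k, (c k * torusChar k x) • phaseCLM k) = ∑ j, (ContinuousLinearMap.proj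
      (R := ℝ) (φ := fun _ : Fin d => ℝ) j).smulRight
        (fourierSum (fun k => Complex.I * (k j : ℂ) * c k) x) by
    rw [← heq]
    exact h
  refine ContinuousLinearMap.ext fun v => ?_
  rw [show (∑' k, (c k * torusChar k x) • phaseCLM k) v
      = ∑' k, ((c k * torusChar k x) • phaseCLM k) v from
    (ContinuousLinearMap.apply ℝ ℂ v).map_tsum hsum]
  simp only [_root_.sum_apply, ContinuousLinearMap.smulRight_apply,
    ContinuousLinearMap.proj_apply, _root_.smul_apply, phaseCLM_apply, fourierSum,
    smul_eq_mul]
  simp_rw [Complex.real_smul, ← tsum_mul_left]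
  rw [← Summable.tsum_finsetSum]
  · refine tsum_congr fun k => ?_
    push_cast
    simp only [Finset.mul_sum]
    refine Finset.sum_congr rfl fun j _ => ?_
    ring
  · intro j _
    exact ((hc.deriv j).summable_fourierSum x).mul_left _

/-- The partial derivatives are again Fourier sums with rapidly decaying coefficients, so the
induction runs over all such `c` at once. -/
lemma contDiff_fourierSum {c : (Fin d → ℤ) → ℂ} (hc : RapidDecay c) :
    ContDiff ℝ ∞ (fourierSum c) := by
  rw [contDiff_infty]
  intro n
  induction n generalizing c with
  | zero =>
    exact contDiff_zero.2 (continuous_iff_continuousAt.2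
      fun x => (hasFDerivAt_fourierSum hc x).continuousAt)
  | succ n ih =>
    push_cast
    refine contDiff_succ_iff_hasFDerivAt.2 ⟨_, ?_, hasFDerivAt_fourierSum hc⟩
    refine ContDiff.sum fun j _ => ?_
    exact contDiff_const.smulRight (ih (hc.deriv j))

lemma fourierSum_add_single (c : (Fin d → ℤ) → ℂ) (x : Fin d → ℝ) (j : Fin d) :
    fourierSum c (x + Pi.single j (2 * Real.pi)) = fourierSum c x := by
  simp only [fourierSum, torusChar_add_single]

lemma isSmoothPeriodic_re_fourierSum {c : (Fin d → ℤ) → ℂ} (hc : RapidDecay c) :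
    IsSmoothPeriodic fun x => (fourierSum c x).re where
  smooth := Complex.reCLM.contDiff.comp (contDiff_fourierSum hc)
  periodic x j := by rw [fourierSum_add_single]

lemma partialDeriv_re_fourierSum {c : (Fin d → ℤ) → ℂ} (hc : RapidDecay c) (j : Fin d)
    (x : Fin d → ℝ) : partialDeriv j (fun x => (fourierSum c x).re) x
      = (fourierSum (fun k => Complex.I * (k j : ℂ) * c k) x).re := by
  have h := Complex.reCLM.hasFDerivAt.comp x (hasFDerivAt_fourierSum hc x)
  have h' : HasFDerivAt (fun x => (fourierSum c x).re) _ x := h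
  rw [partialDeriv, h'.fderiv]
  simp [Pi.single_apply]

lemma ofReal_re_fourierSum {c : (Fin d → ℤ) → ℂ} (hc : HermitianSymm c) (x : Fin d → ℝ) :
    ((fourierSum c x).re : ℂ) = fourierSum c x := by
  rw [← Complex.conj_eq_iff_re, fourierSum, Complex.conj_tsum, ← (Equiv.neg _).tsum_eq]
  refine tsum_congr fun k => ?_
  rw [Equiv.neg_apply, hc, torusChar_neg, map_mul, Complex.conj_conj, Complex.conj_conj]

/-! ### Fourier coefficients of Fourier series -/

lemma torusCoeff_eq (f : (Fin d → ℝ) → ℝ) (k : Fin d → ℤ) :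
    torusCoeff f k = ((2 * Real.pi : ℝ) : ℂ)⁻¹ ^ d *
      ∫ x in Set.Icc (0 : Fin d → ℝ) (fun _ => 2 * Real.pi), (f x : ℂ) * torusChar (-k) x := by
  simp [torusCoeff, torusChar, Finset.sum_neg_distrib]

lemma hermitianSymm_torusCoeff (f : (Fin d → ℝ) → ℝ) : HermitianSymm (torusCoeff f) := by
  intro k
  simp only [torusCoeff_eq, map_mul, map_pow, map_inv₀, Complex.conj_ofReal, ← integral_conj,
    torusChar_neg, Complex.conj_conj]

lemma integral_torusChar (k : Fin d → ℤ) :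
    ∫ x in Set.Icc (0 : Fin d → ℝ) (fun _ => 2 * Real.pi), torusChar k x
      = if k = 0 then ((2 * Real.pi : ℝ) : ℂ) ^ d else 0 := by
  have hone : ∀ n : ℤ, ∫ y in Set.Icc (0 : ℝ) (2 * Real.pi), Complex.exp (Complex.I * n * y)
      = if n = 0 then ((2 * Real.pi : ℝ) : ℂ) else 0 := by
    intro n
    rw [MeasureTheory.integral_Icc_eq_integral_Ioc,
      ← intervalIntegral.integral_of_le (by positivity)]
    split_ifs with h
    · simp [h]
    · rw [integral_exp_mul_complex (by simp [h])]
      have : Complex.exp (Complex.I * n * ((2 * Real.pi : ℝ) : ℂ)) = 1 := by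
        rw [Complex.exp_eq_one_iff]
        exact ⟨n, by push_cast; ring⟩
      rw [this]
      simp
  have hprod : ∀ x : Fin d → ℝ, torusChar k x = ∏ j, Complex.exp (Complex.I * k j * x j) := by
    intro x
    rw [torusChar, ← Complex.exp_sum]
    congr 1
    push_cast
    rw [Finset.mul_sum]
    exact Finset.sum_congr rfl fun j _ => by ring
  simp_rw [hprod]
  rw [← Set.pi_univ_Icc, MeasureTheory.volume_pi, MeasureTheory.Measure.restrict_pi_pi,
    MeasureTheory.integral_fintype_prod_eq_prod
      (f := fun j (y : ℝ) => Complex.exp (Complex.I * k j * y))]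
  simp only [Pi.zero_apply, hone]
  split_ifs with h
  · simp [h]
  · obtain ⟨j, hj⟩ := Function.ne_iff.1 h
    exact Finset.prod_eq_zero (Finset.mem_univ j) (if_neg hj)

lemma torusCoeff_re_fourierSum {c : (Fin d → ℤ) → ℂ} (hc : HermitianSymm c)
    (hs : Summable fun k => ‖c k‖) (k : Fin d → ℤ) :
    torusCoeff (fun x => (fourierSum c x).re) k = c k := by
  simp only [torusCoeff_eq, ofReal_re_fourierSum hc]
  have h1 : ∀ x, fourierSum c x * torusChar (-k) x = ∑' l, c l * torusChar (l - k) x := by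
    intro x
    rw [fourierSum, ← tsum_mul_right]
    refine tsum_congr fun l => ?_
    rw [sub_eq_add_neg, torusChar_add]
    ring
  have hfin : MeasureTheory.volume (Set.Icc (0 : Fin d → ℝ) (fun _ => 2 * Real.pi)) ≠ ⊤ :=
    isCompact_Icc.measure_lt_top.ne
  have h2 := MeasureTheory.hasSum_integral_of_summable_integral_norm
    (μ := MeasureTheory.volume.restrict (Set.Icc (0 : Fin d → ℝ) (fun _ => 2 * Real.pi)))
    (F := fun l x => c l * torusChar (l - k) x)
    (fun l => ((continuous_torusChar _).const_mul _).continuousOn.integrableOn_compact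
      isCompact_Icc)
    (by simpa [MeasureTheory.integral_const] using hs.mul_left _)
  simp_rw [h1]
  rw [← h2.tsum_eq]
  simp_rw [MeasureTheory.integral_const_mul, integral_torusChar]
  rw [tsum_eq_single k]
  · simp only [sub_self, if_true]
    rw [mul_comm (c k), ← mul_assoc, ← mul_pow, inv_mul_cancel₀, one_pow, one_mul]
    simp [Real.pi_ne_zero]
  · intro l hl
    rw [if_neg (sub_ne_zero.2 hl), mul_zero]

/-! ### Products of Fourier series -/

/-- Convolution of two families of coefficients. -/
def freqConv (a b : (Fin d → ℤ) → ℂ) (k : Fin d → ℤ) : ℂ := ∑' l, a (k - l) * b l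

/-- The change of variables `(k, l) ↦ (k - l, l)`. -/
def freqShear : ((Fin d → ℤ) × (Fin d → ℤ)) ≃ ((Fin d → ℤ) × (Fin d → ℤ)) where
  toFun p := (p.1 - p.2, p.2)
  invFun p := (p.1 + p.2, p.2)
  left_inv p := by simp
  right_inv p := by simp

lemma summable_shear {a b : (Fin d → ℤ) → ℝ} (ha : Summable a) (hb : Summable b)
    (ha0 : ∀ k, 0 ≤ a k) (hb0 : ∀ k, 0 ≤ b k) :
    Summable fun p : (Fin d → ℤ) × (Fin d → ℤ) => a (p.1 - p.2) * b p.2 :=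
  freqShear.summable_iff.2 (ha.mul_of_nonneg hb ha0 hb0)

lemma fourierSum_mul {a b : (Fin d → ℤ) → ℂ} (ha : Summable fun k => ‖a k‖)
    (hb : Summable fun k => ‖b k‖) (x : Fin d → ℝ) :
    fourierSum a x * fourierSum b x = fourierSum (freqConv a b) x := by
  have hs := summable_shear ha hb (fun _ => norm_nonneg _) fun _ => norm_nonneg _
  simp only [fourierSum, freqConv]
  rw [tsum_mul_tsum_of_summable_norm (by simpa using ha) (by simpa using hb),
    ← freqShear.tsum_eq]
  have h : ∀ p : (Fin d → ℤ) × (Fin d → ℤ),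
      a (freqShear p).1 * torusChar (freqShear p).1 x
        * (b (freqShear p).2 * torusChar (freqShear p).2 x)
      = a (p.1 - p.2) * b p.2 * torusChar p.1 x := by
    intro p
    have : torusChar p.1 x = torusChar (p.1 - p.2) x * torusChar p.2 x := by
      rw [← torusChar_add, sub_add_cancel]
    simp only [freqShear, Equiv.coe_fn_mk, this]
    ring
  simp_rw [h]
  have hs' : Summable fun p : (Fin d → ℤ) × (Fin d → ℤ) =>
      a (p.1 - p.2) * b p.2 * torusChar p.1 x := Summable.of_norm (by simpa using hs)
  rw [hs'.tsum_prod]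
  exact tsum_congr fun k => by rw [← tsum_mul_right]

/-- The weight is submultiplicative, `1 + |k| ≤ (1 + |k-l|)(1 + |l|)`, so it distributes over the
two factors. -/
lemma RapidDecay.freqConv {a b : (Fin d → ℤ) → ℂ} (ha : RapidDecay a) (hb : RapidDecay b) :
    RapidDecay (freqConv a b) := fun n => by
  have h0 : ∀ k : Fin d → ℤ, 0 ≤ freqNorm k := freqNorm_nonneg
  have hs := summable_shear (ha n) (hb n)
    (fun k => by have := h0 k; positivity) fun k => by have := h0 k; positivity
  refine Summable.of_nonneg_of_le (fun k => by have := h0 k; positivity) (fun k => ?_) hs.prod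
  have hk : Summable fun l => (1 + freqNorm (k - l)) ^ n * ‖a (k - l)‖ *
    ((1 + freqNorm l) ^ n * ‖b l‖) := hs.prod_factor k
  have hle : ∀ l, ‖(1 + freqNorm k : ℂ) ^ n * (a (k - l) * b l)‖ ≤
      (1 + freqNorm (k - l)) ^ n * ‖a (k - l)‖ * ((1 + freqNorm l) ^ n * ‖b l‖) := by
    intro l
    have h1 : (1 + freqNorm k) ≤ (1 + freqNorm (k - l)) * (1 + freqNorm l) := by
      nlinarith [freqNorm_le_sub_add k l, h0 (k - l), h0 l]
    have h2 : ‖(1 + freqNorm k : ℂ)‖ = 1 + freqNorm k := by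
      rw [← Complex.ofReal_one, ← Complex.ofReal_add, Complex.norm_real, Real.norm_of_nonneg]
      linarith [h0 k]
    rw [norm_mul, norm_mul, norm_pow, h2]
    calc (1 + freqNorm k) ^ n * (‖a (k - l)‖ * ‖b l‖)
        ≤ ((1 + freqNorm (k - l)) * (1 + freqNorm l)) ^ n * (‖a (k - l)‖ * ‖b l‖) := by
          have := h0 k
          gcongr
      _ = _ := by rw [mul_pow]; ring
  have h3 := tsum_of_norm_bounded hk.hasSum hle
  rw [tsum_mul_left, norm_mul, norm_pow] at h3
  have h2 : ‖(1 + freqNorm k : ℂ)‖ = 1 + freqNorm k := by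
    rw [← Complex.ofReal_one, ← Complex.ofReal_add, Complex.norm_real, Real.norm_of_nonneg]
    linarith [h0 k]
  rwa [h2] at h3

/-! ### Fourier inversion -/

lemma IsSmoothPeriodic.add_two_pi_mul_int {f : (Fin d → ℝ) → ℝ} (hf : IsSmoothPeriodic f)
    (x : Fin d → ℝ) (n : Fin d → ℤ) : f (x + fun j => 2 * Real.pi * n j) = f x := by
  have h : ∀ s : Finset (Fin d),
      Function.Periodic f (∑ j ∈ s, n j • (Pi.single j (2 * Real.pi) : Fin d → ℝ)) := by
    intro s
    induction s using Finset.induction_on with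
    | empty => intro x; simp
    | insert i s hi ih =>
      rw [Finset.sum_insert hi]
      exact Function.Periodic.add_period (Function.Periodic.zsmul (fun x => hf.periodic x i) _) ih
  have h2 : (fun j => 2 * Real.pi * n j)
      = ∑ j, n j • (Pi.single j (2 * Real.pi) : Fin d → ℝ) := by
    ext i
    simp [Finset.sum_apply, Pi.single_apply, mul_comm]
  rw [h2]
  exact h Finset.univ x

/-- The function on the unit torus induced by a function of period `2π`. -/
def torusLift (f : (Fin d → ℝ) → ℝ) (z : UnitAddTorus (Fin d)) : ℂ :=
  (f fun j => 2 * Real.pi * (AddCircle.equivIco 1 0 (z j) : ℝ) : ℝ)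

lemma torusLift_coe {f : (Fin d → ℝ) → ℝ} (hf : IsSmoothPeriodic f) (y : Fin d → ℝ) :
    torusLift f (fun j => (y j : UnitAddCircle)) = f ((2 * Real.pi) • y) := by
  have h : ∀ j, ∃ n : ℤ, (AddCircle.equivIco (1 : ℝ) 0 (y j : UnitAddCircle) : ℝ) = y j + n := by
    intro j
    refine ⟨-toIcoDiv zero_lt_one 0 (y j), ?_⟩
    rw [AddCircle.coe_equivIco_mk_apply]
    have h1 := Int.self_sub_floor (y j)
    have h2 := toIcoDiv_zero_one (y j)
    rw [h2]
    push_cast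
    rw [div_one, mul_one, ← h1]
    ring
  choose n hn using h
  rw [torusLift]
  congr 1
  rw [← hf.add_two_pi_mul_int ((2 * Real.pi) • y) n]
  congr 1
  funext j
  simp [hn, mul_add]

/-- The representative chosen in `[0,1)` is discontinuous; continuity is checked after pulling back
along the quotient map, where periodicity removes the choice. -/
lemma continuous_torusLift {f : (Fin d → ℝ) → ℝ} (hf : IsSmoothPeriodic f) :
    Continuous (torusLift f) := by
  have hq : IsOpenQuotientMap (Pi.map fun (_ : Fin d) (y : ℝ) => (y : UnitAddCircle)) :=
    IsOpenQuotientMap.piMap fun _ => QuotientAddGroup.isOpenQuotientMap_mk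
  rw [hq.isQuotientMap.continuous_iff]
  have : torusLift f ∘ (Pi.map fun (_ : Fin d) (y : ℝ) => (y : UnitAddCircle))
      = fun y => ((f ((2 * Real.pi) • y) : ℝ) : ℂ) := funext fun y => torusLift_coe hf y
  rw [this]
  exact Complex.continuous_ofReal.comp (hf.smooth.continuous.comp (continuous_const_smul _))

lemma mFourier_coe (k : Fin d → ℤ) (y : Fin d → ℝ) :
    UnitAddTorus.mFourier k (fun j => (y j : UnitAddCircle)) = torusChar k ((2 * Real.pi) • y) := by
  simp only [UnitAddTorus.mFourier, ContinuousMap.coe_mk, fourier_coe_apply, torusChar,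
    ← Complex.exp_sum]
  congr 1
  push_cast
  rw [Finset.mul_sum]
  refine Finset.sum_congr rfl fun j _ => ?_
  simp
  ring

-- This passes from the normalized period `1` to the period `2π`; the dilation of the cube produces
-- the prefactor `(2π)^{-d}`.
open scoped Pointwise in
lemma mFourierCoeff_torusLift {f : (Fin d → ℝ) → ℝ} (hf : IsSmoothPeriodic f) (k : Fin d → ℤ) :
    UnitAddTorus.mFourierCoeff (torusLift f) k = torusCoeff f k := by
  rw [UnitAddTorus.mFourierCoeff_eq_integral _ _ 0, torusCoeff_eq]
  simp only [torusLift_coe hf, mFourier_coe]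
  have hset : {x : Fin d → ℝ | ∀ i, x i ∈ Set.Ioc ((0 : Fin d → ℝ) i) ((0 : Fin d → ℝ) i + 1)}
      = Set.pi Set.univ fun i => Set.Ioc ((0 : Fin d → ℝ) i) ((1 : Fin d → ℝ) i) := by
    ext x
    simp [Set.mem_pi]
  have hsm : (2 * Real.pi) • Set.Icc (0 : Fin d → ℝ) 1
      = Set.Icc (0 : Fin d → ℝ) (fun _ => 2 * Real.pi) := by
    rw [← Set.image_smul]
    have h0 : (0 : ℝ) < 2 * Real.pi := by positivity
    ext x
    simp only [Set.mem_image, Set.mem_Icc, Pi.le_def]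
    constructor
    · rintro ⟨y, ⟨hy0, hy1⟩, rfl⟩
      refine ⟨fun i => ?_, fun i => ?_⟩
      · have := hy0 i
        simp only [Pi.zero_apply, Pi.smul_apply, smul_eq_mul] at this ⊢
        positivity
      · have := hy1 i
        simp only [Pi.one_apply, Pi.smul_apply, smul_eq_mul] at this ⊢
        nlinarith
    · rintro ⟨hx0, hx1⟩
      refine ⟨(2 * Real.pi)⁻¹ • x, ⟨fun i => ?_, fun i => ?_⟩, ?_⟩
      · have := hx0 i
        simp only [Pi.zero_apply, Pi.smul_apply, smul_eq_mul] at this ⊢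
        positivity
      · have := hx1 i
        simp only [Pi.one_apply, Pi.smul_apply, smul_eq_mul] at this ⊢
        rw [inv_mul_le_iff₀ h0]
        linarith
      · rw [smul_smul, mul_inv_cancel₀ h0.ne', one_smul]
  rw [hset, MeasureTheory.volume_pi,
    MeasureTheory.setIntegral_congr_set MeasureTheory.Measure.univ_pi_Ioc_ae_eq_Icc,
    ← MeasureTheory.volume_pi]
  rw [MeasureTheory.Measure.setIntegral_comp_smul MeasureTheory.volume
    (fun x : Fin d → ℝ => torusChar (-k) x • (f x : ℂ)) _ (by positivity), hsm]
  simp only [Module.finrank_fin_fun, smul_eq_mul]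
  rw [abs_of_nonneg (by positivity), Complex.real_smul]
  push_cast
  rw [inv_pow]
  congr 1
  exact MeasureTheory.integral_congr_ae (Filter.Eventually.of_forall fun x => mul_comm _ _)

lemma fourierSum_torusCoeff {f : (Fin d → ℝ) → ℝ} (hf : IsSmoothPeriodic f)
    (hs : Summable fun k => ‖torusCoeff f k‖) (x : Fin d → ℝ) :
    fourierSum (torusCoeff f) x = f x := by
  let g : C(UnitAddTorus (Fin d), ℂ) := ⟨torusLift f, continuous_torusLift hf⟩
  have hg : ∀ k, UnitAddTorus.mFourierCoeff g k = torusCoeff f k := mFourierCoeff_torusLift hf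
  have h := UnitAddTorus.hasSum_mFourier_series_apply_of_summable (f := g)
    (Summable.of_norm (by simpa only [hg] using hs))
    (fun j => (((2 * Real.pi)⁻¹ • x) j : UnitAddCircle))
  simp only [hg, mFourier_coe] at h
  have h2 : g (fun j => (((2 * Real.pi)⁻¹ • x) j : UnitAddCircle)) = f x := by
    have := torusLift_coe hf ((2 * Real.pi)⁻¹ • x)
    rw [smul_smul, mul_inv_cancel₀ (by positivity), one_smul] at this
    exact this
  rw [smul_smul, mul_inv_cancel₀ (by positivity), one_smul, h2] at h
  exact h.tsum_eq

/-! ### Gevrey decay of Fourier coefficients -/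

/-- The bound `|c(k)| ≤ A e^{-σ|k|^a}`. -/
def GevreyDecay (a σ A : ℝ) (c : (Fin d → ℤ) → ℂ) : Prop :=
  ∀ k, ‖c k‖ ≤ A * Real.exp (-σ * freqNorm k ^ a)

lemma GevreyDecay.rapidDecay {a σ A : ℝ} {c : (Fin d → ℤ) → ℂ} (ha : 0 < a) (hσ : 0 < σ)
    (hc : GevreyDecay a σ A c) : RapidDecay c := fun n => by
  have h0 : ∀ k : Fin d → ℤ, 0 ≤ freqNorm k := freqNorm_nonneg
  refine Summable.of_nonneg_of_le (fun k => by have := h0 k; positivity) (fun k => ?_)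
    ((summable_pow_mul_exp_neg_rpow ha hσ n).mul_left A)
  have := h0 k
  calc (1 + freqNorm k) ^ n * ‖c k‖
      ≤ (1 + freqNorm k) ^ n * (A * Real.exp (-σ * freqNorm k ^ a)) := by
        gcongr
        exact hc k
    _ = _ := by ring

lemma GevreyDecay.mono {a σ σ' A A' : ℝ} {c : (Fin d → ℤ) → ℂ} (hc : GevreyDecay a σ A c)
    (hσ : σ' ≤ σ) (hA : A ≤ A') (hA0 : 0 ≤ A) : GevreyDecay a σ' A' c := fun k => by
  refine (hc k).trans ?_
  have := Real.rpow_nonneg (freqNorm_nonneg k) a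
  have h2 : Real.exp (-σ * freqNorm k ^ a) ≤ Real.exp (-σ' * freqNorm k ^ a) := by
    rw [Real.exp_le_exp]
    nlinarith
  exact mul_le_mul hA h2 (Real.exp_pos _).le (hA0.trans hA)

lemma GevreyDecay.sub {a σ A B : ℝ} {b c : (Fin d → ℤ) → ℂ} (hb : GevreyDecay a σ A b)
    (hc : GevreyDecay a σ B c) : GevreyDecay a σ (A + B) fun k => b k - c k := fun k => by
  rw [add_mul]
  exact (norm_sub_le _ _).trans (add_le_add (hb k) (hc k))

/-- A single term is bounded by the whole sum, and `|k|^{2r} ≥ 1` at nonzero integer frequencies. -/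
lemma norm_torusCoeff_le_of_gevreyNorm_le {s r τ K : ℝ} {f : (Fin d → ℝ) → ℝ} (hr : 0 ≤ r)
    (hK : 0 ≤ K) (h : gevreyNorm s r τ f ≤ ENNReal.ofReal K) {k : Fin d → ℤ} (hk : k ≠ 0) :
    ‖torusCoeff f k‖ ≤ K * Real.exp (-τ * freqNorm k ^ (1 / s)) := by
  have h1 : ENNReal.ofReal (freqNorm k ^ (2 * r) * Real.exp (2 * τ * freqNorm k ^ (1 / s)) *
      ‖torusCoeff f k‖ ^ 2) ≤ ENNReal.ofReal (K ^ 2) := by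
    have h2 := ENNReal.rpow_le_rpow h (zero_le_two (α := ℝ))
    rw [gevreyNorm, ← ENNReal.rpow_mul] at h2
    norm_num at h2
    rw [← ENNReal.ofReal_pow hK] at h2
    refine le_trans ?_ h2
    simpa using ENNReal.le_tsum (f := fun k : {k : Fin d → ℤ // k ≠ 0} =>
      ENNReal.ofReal (freqNorm k.1 ^ (2 * r) * Real.exp (2 * τ * freqNorm k.1 ^ (1 / s)) *
      ‖torusCoeff f k.1‖ ^ 2)) ⟨k, hk⟩
  rw [ENNReal.ofReal_le_ofReal_iff (by positivity)] at h1
  have h3 : 1 ≤ freqNorm k ^ (2 * r) := Real.one_le_rpow (one_le_freqNorm hk) (by positivity)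
  have h4 : (Real.exp (τ * freqNorm k ^ (1 / s)) * ‖torusCoeff f k‖) ^ 2 ≤ K ^ 2 := by
    refine le_trans ?_ h1
    have : Real.exp (2 * τ * freqNorm k ^ (1 / s)) = Real.exp (τ * freqNorm k ^ (1 / s)) ^ 2 := by
      rw [← Real.exp_nat_mul]
      congr 1
      push_cast
      ring
    rw [mul_pow, this, mul_assoc]
    exact le_mul_of_one_le_left (by positivity) h3
  have h5 := abs_le_of_sq_le_sq h4 hK
  rw [abs_of_nonneg (by positivity)] at h5
  rw [neg_mul, Real.exp_neg, ← div_eq_mul_inv, le_div_iff₀ (Real.exp_pos _)]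
  linarith

lemma torusCoeff_zero_eq_zero {f : (Fin d → ℝ) → ℝ}
    (h : ∫ x in Set.Icc (0 : Fin d → ℝ) (fun _ => 2 * Real.pi), f x = 0) : torusCoeff f 0 = 0 := by
  simp only [torusCoeff_eq, neg_zero, torusChar_zero, mul_one, integral_complex_ofReal, h]
  simp

lemma gevreyDecay_torusCoeff {s r τ K : ℝ} {f : (Fin d → ℝ) → ℝ} (hr : 0 ≤ r) (hK : 0 ≤ K)
    (hf : MemGevrey s r f) (h : gevreyNorm s r τ f ≤ ENNReal.ofReal K) :
    GevreyDecay (1 / s) τ K (torusCoeff f) := fun k => by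
  by_cases hk : k = 0
  · rw [hk, torusCoeff_zero_eq_zero hf.meanZero, norm_zero]
    positivity
  · exact norm_torusCoeff_le_of_gevreyNorm_le hr hK h hk

/-- The converse passage from pointwise decay to the norm: the gap `σ - τ` pays for `|k|^{2r}` and
for summation over the lattice. The bound `M` is uniform in `f`, as local boundedness in time
requires. -/
lemma exists_gevreyNorm_le {s σ τ : ℝ} (hs : 0 < s) (r A : ℝ) (hτ : τ < σ) :
    ∃ M : ℝ, ∀ f : (Fin d → ℝ) → ℝ, GevreyDecay (1 / s) σ A (torusCoeff f) →
      gevreyNorm s r τ f ≤ ENNReal.ofReal M := by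
  obtain ⟨n, hn⟩ := exists_nat_ge (2 * r)
  have hsum := (summable_pow_mul_exp_neg_rpow (d := d) (a := 1 / s) (σ := 2 * (σ - τ))
    (by positivity) (by linarith) n).mul_left (A ^ 2)
  refine ⟨(∑' k : Fin d → ℤ, A ^ 2 * ((1 + freqNorm k) ^ n *
    Real.exp (-(2 * (σ - τ)) * freqNorm k ^ (1 / s)))) ^ (1 / 2 : ℝ), fun f hf => ?_⟩
  have h0 : ∀ k : Fin d → ℤ, 0 ≤ freqNorm k := freqNorm_nonneg
  have hnn : ∀ k : Fin d → ℤ, 0 ≤ A ^ 2 * ((1 + freqNorm k) ^ n *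
    Real.exp (-(2 * (σ - τ)) * freqNorm k ^ (1 / s))) := fun k => by have := h0 k; positivity
  rw [← ENNReal.ofReal_rpow_of_nonneg (tsum_nonneg hnn) (by norm_num), gevreyNorm]
  refine ENNReal.rpow_le_rpow ?_ (by norm_num)
  rw [ENNReal.ofReal_tsum_of_nonneg hnn hsum]
  refine le_trans (ENNReal.tsum_le_tsum fun k => ENNReal.ofReal_le_ofReal ?_)
    (ENNReal.tsum_comp_le_tsum_of_injective Subtype.val_injective
      fun k : Fin d → ℤ => ENNReal.ofReal (A ^ 2 * ((1 + freqNorm k) ^ n *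
        Real.exp (-(2 * (σ - τ)) * freqNorm k ^ (1 / s)))))
  have h1 : freqNorm k.1 ^ (2 * r) ≤ (1 + freqNorm k.1) ^ n := by
    have hk := one_le_freqNorm k.2
    calc freqNorm k.1 ^ (2 * r) ≤ freqNorm k.1 ^ (n : ℝ) :=
          Real.rpow_le_rpow_of_exponent_le hk hn
      _ = freqNorm k.1 ^ n := Real.rpow_natCast _ _
      _ ≤ _ := by gcongr; linarith
  have h2 : ‖torusCoeff f k.1‖ ^ 2 ≤ A ^ 2 * Real.exp (-(2 * σ) * freqNorm k.1 ^ (1 / s)) := by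
    calc ‖torusCoeff f k.1‖ ^ 2 ≤ (A * Real.exp (-σ * freqNorm k.1 ^ (1 / s))) ^ 2 := by
          gcongr
          exact hf k.1
      _ = _ := by
          rw [mul_pow, ← Real.exp_nat_mul]
          congr 2
          push_cast
          ring
  calc freqNorm k.1 ^ (2 * r) * Real.exp (2 * τ * freqNorm k.1 ^ (1 / s)) * ‖torusCoeff f k.1‖ ^ 2
      ≤ (1 + freqNorm k.1) ^ n * Real.exp (2 * τ * freqNorm k.1 ^ (1 / s)) *
        (A ^ 2 * Real.exp (-(2 * σ) * freqNorm k.1 ^ (1 / s))) := by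
        have := h0 k.1
        gcongr
    _ = A ^ 2 * ((1 + freqNorm k.1) ^ n * (Real.exp (2 * τ * freqNorm k.1 ^ (1 / s)) *
        Real.exp (-(2 * σ) * freqNorm k.1 ^ (1 / s)))) := by ring
    _ = _ := by
        rw [← Real.exp_add]
        congr 4
        ring

/-! ### The bilinear transport term in Fourier variables -/

/-- Symbols of divergence-free real operators with `|T(k)| ≤ C|k|^a` off the zero frequency. -/
structure IsTransportSymbol (C a : ℝ) (T : (Fin d → ℤ) → EuclideanSpace ℂ (Fin d)) : Prop where
  bound : ∀ k, k ≠ 0 → ‖T k‖ ≤ C * freqNorm k ^ a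
  divFree : ∀ k, ∑ j, (k j : ℂ) * T k j = 0
  real : ∀ k j, T (-k) j = starRingEnd ℂ (T k j)

/-- The pairing `T(k - l)·l`. -/
def symbolPairing (T : (Fin d → ℤ) → EuclideanSpace ℂ (Fin d)) (k l : Fin d → ℤ) : ℂ :=
  ∑ j, T (k - l) j * (l j : ℂ)

/-- The Fourier coefficients of `-(𝐓f)·∇g`. -/
def transport (T : (Fin d → ℤ) → EuclideanSpace ℂ (Fin d)) (f g : (Fin d → ℤ) → ℂ)
    (k : Fin d → ℤ) : ℂ :=
  -Complex.I * ∑' l, symbolPairing T k l * f (k - l) * g l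

section Transport

variable {C a : ℝ} {T : (Fin d → ℤ) → EuclideanSpace ℂ (Fin d)}

lemma norm_sum_mul_intCast_le (z : EuclideanSpace ℂ (Fin d)) (l : Fin d → ℤ) :
    ‖∑ j, z j * (l j : ℂ)‖ ≤ ‖z‖ * freqNorm l := by
  have h := norm_inner_le_norm (𝕜 := ℂ)
    (WithLp.toLp 2 (fun j => (l j : ℂ)) : EuclideanSpace ℂ (Fin d)) z
  have h2 : ‖(WithLp.toLp 2 (fun j => (l j : ℂ)) : EuclideanSpace ℂ (Fin d))‖ = freqNorm l := by
    simp [EuclideanSpace.norm_eq, freqNorm]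
  rw [h2, mul_comm] at h
  simpa [PiLp.inner_apply] using h

/-- Because `T(k-l)·(k-l) = 0`, the derivative may be counted on either of the frequencies `k` and
`l`. -/
lemma symbolPairing_eq (hT : IsTransportSymbol C a T) (k l : Fin d → ℤ) :
    symbolPairing T k l = ∑ j, T (k - l) j * (k j : ℂ) := by
  have h := hT.divFree (k - l)
  rw [symbolPairing, eq_comm, ← sub_eq_zero, ← h, ← Finset.sum_sub_distrib]
  refine Finset.sum_congr rfl fun j _ => ?_
  push_cast [Pi.sub_apply]
  ring

lemma symbolPairing_swap (hT : IsTransportSymbol C a T) (k l : Fin d → ℤ) :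
    symbolPairing T l k = starRingEnd ℂ (symbolPairing T k l) := by
  rw [symbolPairing_eq hT k l, symbolPairing, map_sum]
  refine Finset.sum_congr rfl fun j _ => ?_
  rw [← neg_sub k l, hT.real]
  simp

lemma symbolPairing_neg (hT : IsTransportSymbol C a T) (k l : Fin d → ℤ) :
    symbolPairing T (-k) (-l) = - starRingEnd ℂ (symbolPairing T k l) := by
  rw [symbolPairing, symbolPairing, map_sum, ← Finset.sum_neg_distrib]
  refine Finset.sum_congr rfl fun j _ => ?_
  rw [show -k - -l = -(k - l) by abel, hT.real]
  simp

lemma symbolPairing_zero (hT : IsTransportSymbol C a T) (l : Fin d → ℤ) :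
    symbolPairing T 0 l = 0 := by simp [symbolPairing_eq hT]

lemma norm_symbolPairing_le (hT : IsTransportSymbol C a T) {k l : Fin d → ℤ} (h : k ≠ l) :
    ‖symbolPairing T k l‖ ≤ C * freqNorm (k - l) ^ a * freqNorm l :=
  (norm_sum_mul_intCast_le _ _).trans
    (mul_le_mul_of_nonneg_right (hT.bound _ (sub_ne_zero.2 h)) (freqNorm_nonneg _))

lemma norm_symbolPairing_le' (hT : IsTransportSymbol C a T) {k l : Fin d → ℤ} (h : k ≠ l) :
    ‖symbolPairing T k l‖ ≤ C * freqNorm (k - l) ^ a * freqNorm k := by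
  rw [symbolPairing_eq hT]
  exact (norm_sum_mul_intCast_le _ _).trans
    (mul_le_mul_of_nonneg_right (hT.bound _ (sub_ne_zero.2 h)) (freqNorm_nonneg _))

lemma transport_zero (hT : IsTransportSymbol C a T) (f g : (Fin d → ℤ) → ℂ) :
    transport T f g 0 = 0 := by simp [transport, symbolPairing_zero hT]

lemma hermitianSymm_transport (hT : IsTransportSymbol C a T) {f g : (Fin d → ℤ) → ℂ}
    (hf : HermitianSymm f) (hg : HermitianSymm g) : HermitianSymm (transport T f g) := by
  intro k
  rw [transport, transport, map_mul, Complex.conj_tsum, ← (Equiv.neg _).tsum_eq]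
  rw [map_neg, Complex.conj_I, neg_neg, ← tsum_mul_left, ← tsum_mul_left]
  refine tsum_congr fun l => ?_
  rw [Equiv.neg_apply, symbolPairing_neg hT, show -k - -l = -(k - l) by abel, hf, hg]
  simp only [map_mul]
  ring

/-- Set `x = |k-l|^a` and `y = |l|^a`, so `|k|^a ≤ x + y`. Of the decay `e^{-σx-σy}`, a part
`e^{-σx/2}` absorbs the factor `x` from the symbol, `e^{-σ(x+y)/2}` gives decay in `k`, and
`e^{-σy/2}` makes the series in `l` converge. At `k = l`, where the symbol is not bounded, the term
vanishes because `f 0 = 0`. -/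
lemma norm_transport_term_le (hC : 0 ≤ C) (ha : 0 < a) (ha1 : a ≤ 1) {σ A B : ℝ} (hσ : 0 < σ)
    (hT : IsTransportSymbol C a T) (hA : 0 ≤ A) (hB : 0 ≤ B) {f g : (Fin d → ℤ) → ℂ}
    (hf0 : f 0 = 0) (hf : GevreyDecay a σ A f) (hg : GevreyDecay a σ B g) (k l : Fin d → ℤ) :
    ‖symbolPairing T k l * f (k - l) * g l‖ ≤ C * (2 / σ) * A * B *
      Real.exp (-(σ / 2) * freqNorm k ^ a) *
        ((1 + freqNorm l) ^ 1 * Real.exp (-(σ / 2) * freqNorm l ^ a)) := by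
  have hl := freqNorm_nonneg l
  by_cases hkl : k = l
  · rw [hkl, sub_self, hf0]
    simp only [mul_zero, zero_mul, norm_zero]
    positivity
  have hj0 := freqNorm_nonneg (k - l)
  set x := freqNorm (k - l) ^ a with hx
  set y := freqNorm l ^ a with hy
  have hx0 : 0 ≤ x := by positivity
  have hxy : freqNorm k ^ a ≤ x + y := freqNorm_sub_rpow_le ha.le ha1 k l
  have h1 : x ≤ 2 / σ * Real.exp (σ / 2 * x) := by
    have := Real.add_one_le_exp (σ / 2 * x)
    calc x = 2 / σ * (σ / 2 * x) := by field_simp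
      _ ≤ _ := by gcongr; linarith
  rw [norm_mul, norm_mul]
  calc ‖symbolPairing T k l‖ * ‖f (k - l)‖ * ‖g l‖
      ≤ (C * x * freqNorm l) * (A * Real.exp (-σ * x)) * (B * Real.exp (-σ * y)) := by
        gcongr
        · exact norm_symbolPairing_le hT hkl
        · exact hf _
        · exact hg _
    _ ≤ (C * (2 / σ * Real.exp (σ / 2 * x)) * (1 + freqNorm l)) * (A * Real.exp (-σ * x)) *
        (B * Real.exp (-σ * y)) := by
        gcongr
        linarith
    _ = C * (2 / σ) * A * B * (1 + freqNorm l) *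
        (Real.exp (σ / 2 * x) * Real.exp (-σ * x) * Real.exp (-σ * y)) := by ring
    _ ≤ C * (2 / σ) * A * B * (1 + freqNorm l) *
        (Real.exp (-(σ / 2) * freqNorm k ^ a) * Real.exp (-(σ / 2) * y)) := by
        refine mul_le_mul_of_nonneg_left ?_ (by positivity)
        rw [← Real.exp_add, ← Real.exp_add, ← Real.exp_add, Real.exp_le_exp]
        nlinarith
    _ = _ := by ring

lemma summable_transport (hC : 0 ≤ C) (ha : 0 < a) (ha1 : a ≤ 1) {σ A B : ℝ} (hσ : 0 < σ)
    (hT : IsTransportSymbol C a T) (hA : 0 ≤ A) (hB : 0 ≤ B) {f g : (Fin d → ℤ) → ℂ}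
    (hf0 : f 0 = 0) (hf : GevreyDecay a σ A f) (hg : GevreyDecay a σ B g) (k : Fin d → ℤ) :
    Summable fun l => symbolPairing T k l * f (k - l) * g l :=
  Summable.of_norm_bounded ((summable_pow_mul_exp_neg_rpow ha (half_pos hσ) 1).mul_left _)
    (norm_transport_term_le hC ha ha1 hσ hT hA hB hf0 hf hg k)

/-- The constant in the Gevrey bound for the transport term. -/
def transportConst (d : ℕ) (C a σ : ℝ) : ℝ :=
  C * (2 / σ) * ∑' l : Fin d → ℤ, (1 + freqNorm l) ^ 1 * Real.exp (-(σ / 2) * freqNorm l ^ a)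

lemma transportConst_nonneg (hC : 0 ≤ C) {σ : ℝ} (hσ : 0 < σ) : 0 ≤ transportConst d C a σ := by
  refine mul_nonneg (by positivity) (tsum_nonneg fun l => ?_)
  have := freqNorm_nonneg l
  positivity

lemma gevreyDecay_transport (hC : 0 ≤ C) (ha : 0 < a) (ha1 : a ≤ 1) {σ A B : ℝ} (hσ : 0 < σ)
    (hT : IsTransportSymbol C a T) (hA : 0 ≤ A) (hB : 0 ≤ B) {f g : (Fin d → ℤ) → ℂ}
    (hf0 : f 0 = 0) (hf : GevreyDecay a σ A f) (hg : GevreyDecay a σ B g) :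
    GevreyDecay a (σ / 2) (transportConst d C a σ * A * B) (transport T f g) := by
  intro k
  have h := tsum_of_norm_bounded
    ((summable_pow_mul_exp_neg_rpow ha (half_pos hσ) 1).mul_left _).hasSum
    (norm_transport_term_le hC ha ha1 hσ hT hA hB hf0 hf hg k)
  rw [transport, norm_mul, norm_neg, Complex.norm_I, one_mul]
  refine h.trans (le_of_eq ?_)
  rw [tsum_mul_left, transportConst]
  ring

lemma transport_self_sub (hC : 0 ≤ C) (ha : 0 < a) (ha1 : a ≤ 1) {σ A B : ℝ} (hσ : 0 < σ)
    (hT : IsTransportSymbol C a T) (hA : 0 ≤ A) (hB : 0 ≤ B) {f g : (Fin d → ℤ) → ℂ}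
    (hf0 : f 0 = 0) (hg0 : g 0 = 0) (hf : GevreyDecay a σ A f) (hg : GevreyDecay a σ B g)
    (k : Fin d → ℤ) : transport T f f k - transport T g g k =
      transport T f (fun k => f k - g k) k + transport T (fun k => f k - g k) g k := by
  have h1 := summable_transport hC ha ha1 hσ hT hA hA hf0 hf hf k
  have h2 := summable_transport hC ha ha1 hσ hT hB hB hg0 hg hg k
  have h3 := summable_transport hC ha ha1 hσ hT hA (add_nonneg hA hB) hf0 hf (hf.sub hg) k
  have h4 := summable_transport hC ha ha1 hσ hT (add_nonneg hA hB) hB (by simp [hf0, hg0])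
    (hf.sub hg) hg k
  simp only [transport]
  rw [← mul_sub, ← mul_add, ← h1.tsum_sub h2, ← h3.tsum_add h4]
  congr 1
  refine tsum_congr fun l => ?_
  ring

lemma rapidDecay_symbol_mul (hC : 0 ≤ C) (ha1 : a ≤ 1) (hT : IsTransportSymbol C a T)
    {f : (Fin d → ℤ) → ℂ} (hf0 : f 0 = 0) (hf : RapidDecay f) (j : Fin d) :
    RapidDecay fun k => T k j * f k := by
  refine hf.of_norm_le (p := 1) (A := C) fun k => ?_
  have h0 := freqNorm_nonneg k
  by_cases hk : k = 0
  · simp [hk, hf0]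
  rw [norm_mul, pow_one]
  gcongr
  calc ‖T k j‖ ≤ ‖T k‖ := PiLp.norm_apply_le _ _
    _ ≤ C * freqNorm k ^ a := hT.bound k hk
    _ ≤ C * (1 + freqNorm k) := by
      gcongr
      have := Real.rpow_le_rpow_of_exponent_le (one_le_freqNorm hk) ha1
      rw [Real.rpow_one] at this
      linarith

lemma hermitianSymm_symbol_mul (hT : IsTransportSymbol C a T) {f : (Fin d → ℤ) → ℂ}
    (hf : HermitianSymm f) (j : Fin d) : HermitianSymm fun k => T k j * f k := fun k => by
  simp only [hT.real, hf k, map_mul]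

lemma HermitianSymm.deriv {f : (Fin d → ℤ) → ℂ} (hf : HermitianSymm f) (j : Fin d) :
    HermitianSymm fun k => Complex.I * (k j : ℂ) * f k := fun k => by
  simp [hf k]

/-- The link to physical space: convolutions are the coefficients of products, so `transport` really
represents `-(𝐓f)·∇g`. -/
lemma transport_eq_sum_freqConv (hC : 0 ≤ C) (ha1 : a ≤ 1) (hT : IsTransportSymbol C a T)
    {f g : (Fin d → ℤ) → ℂ} (hf0 : f 0 = 0) (hf : RapidDecay f) (hg : RapidDecay g)
    (k : Fin d → ℤ) : transport T f g k =
      ∑ j, -freqConv (fun k => T k j * f k) (fun k => Complex.I * (k j : ℂ) * g k) k := by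
  have hs : ∀ j, Summable fun l => T (k - l) j * f (k - l) * (Complex.I * (l j : ℂ) * g l) := by
    intro j
    refine Summable.of_norm ?_
    have := (summable_shear (rapidDecay_symbol_mul hC ha1 hT hf0 hf j).summable_norm
      (hg.deriv j).summable_norm (fun _ => norm_nonneg _) fun _ => norm_nonneg _).prod_factor k
    simpa only [norm_mul] using this
  rw [Finset.sum_neg_distrib]
  simp only [freqConv]
  rw [← Summable.tsum_finsetSum fun j _ => hs j, transport, neg_mul, ← tsum_mul_left]
  congr 1
  refine tsum_congr fun l => ?_
  rw [symbolPairing, Finset.sum_mul, Finset.sum_mul, Finset.mul_sum]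
  refine Finset.sum_congr rfl fun j _ => ?_
  ring

lemma rapidDecay_transport (hC : 0 ≤ C) (ha1 : a ≤ 1) (hT : IsTransportSymbol C a T)
    {f g : (Fin d → ℤ) → ℂ} (hf0 : f 0 = 0) (hf : RapidDecay f) (hg : RapidDecay g) :
    RapidDecay (transport T f g) := by
  rw [funext (transport_eq_sum_freqConv hC ha1 hT hf0 hf hg)]
  exact RapidDecay.sum _ fun j =>
    ((rapidDecay_symbol_mul hC ha1 hT hf0 hf j).freqConv (hg.deriv j)).neg

lemma fourierSum_transport (hC : 0 ≤ C) (ha1 : a ≤ 1) (hT : IsTransportSymbol C a T)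
    {f g : (Fin d → ℤ) → ℂ} (hf0 : f 0 = 0) (hf : RapidDecay f) (hg : RapidDecay g)
    (x : Fin d → ℝ) : fourierSum (transport T f g) x =
      -∑ j, fourierSum (fun k => T k j * f k) x *
        fourierSum (fun k => Complex.I * (k j : ℂ) * g k) x := by
  have hr := fun j => rapidDecay_symbol_mul hC ha1 hT hf0 hf j
  rw [funext (transport_eq_sum_freqConv hC ha1 hT hf0 hf hg), ← Finset.sum_neg_distrib]
  simp only [fourierSum_mul (hr _).summable_norm (hg.deriv _).summable_norm]
  simp only [fourierSum, Finset.sum_mul, ← tsum_neg, ← neg_mul]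
  exact Summable.tsum_finsetSum
    fun j _ => ((hr j).freqConv (hg.deriv j)).neg.summable_fourierSum x

end Transport

/-! ### Weights -/

/-- The energy weight `x^{2m} e^{2τ x^a}`. -/
def energyWeight (a τ : ℝ) (m : ℕ) (x : ℝ) : ℝ := x ^ (2 * m) * Real.exp (2 * τ * x ^ a)

/-- The weight `x² e^{τ x^a}` measuring the advecting field in `ℓ¹`. -/
def driftWeight (a τ : ℝ) (x : ℝ) : ℝ := x ^ 2 * Real.exp (τ * x ^ a)

/-- The square root `x^{a/2} x^m e^{τ x^a}` of the dissipation weight. -/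
def dissWeight (a τ : ℝ) (m : ℕ) (x : ℝ) : ℝ := x ^ (a / 2) * (x ^ m * Real.exp (τ * x ^ a))

section Weights

variable {a τ x y z : ℝ} {m : ℕ}

lemma energyWeight_nonneg (hx : 0 ≤ x) : 0 ≤ energyWeight a τ m x := by
  unfold energyWeight; positivity

lemma driftWeight_nonneg : 0 ≤ driftWeight a τ x := by unfold driftWeight; positivity

lemma dissWeight_nonneg (hx : 0 ≤ x) : 0 ≤ dissWeight a τ m x := by
  unfold dissWeight; positivity

lemma dissWeight_sq (hx : 0 ≤ x) : dissWeight a τ m x ^ 2 = x ^ a * energyWeight a τ m x := by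
  have h1 : (x ^ (a / 2)) ^ 2 = x ^ a := by
    rw [← Real.rpow_mul_natCast hx]
    congr 1
    push_cast
    ring
  have h2 : Real.exp (τ * x ^ a) ^ 2 = Real.exp (2 * τ * x ^ a) := by
    rw [← Real.exp_nat_mul]
    congr 1
    push_cast
    ring
  rw [dissWeight, energyWeight, mul_pow, mul_pow, h1, h2, ← pow_mul, mul_comm m]

lemma energyWeight_mono (ha : 0 < a) (hτ : 0 ≤ τ) (hy : 0 ≤ y) (hyx : y ≤ x) :
    energyWeight a τ m y ≤ energyWeight a τ m x := by
  unfold energyWeight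
  have hx : 0 ≤ x := hy.trans hyx
  gcongr

lemma exp_two_mul_le (ha : 0 < a) (ha1 : a ≤ 1) (hτ : 0 ≤ τ) (hx : 0 ≤ x) (hy : 0 ≤ y)
    (hz : 0 ≤ z) (hxz : x ≤ z + y) : Real.exp (2 * τ * x ^ a) ≤
      Real.exp (τ * x ^ a) * Real.exp (τ * y ^ a) * Real.exp (τ * z ^ a) := by
  rw [← Real.exp_add, ← Real.exp_add, Real.exp_le_exp]
  have h : x ^ a ≤ z ^ a + y ^ a :=
    (Real.rpow_le_rpow hx hxz ha.le).trans (Real.rpow_add_le_add_rpow hz hy ha.le ha1)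
  nlinarith

/-- The increment of the product weight is split into a polynomial and an exponential increment. In
both, `y` times the increment costs at most `y^a z`; for the polynomial part this even wastes `y^a ≥
1`. -/
lemma mul_energyWeight_sub_le (ha : 0 < a) (ha1 : a ≤ 1) (hτ : 0 ≤ τ) (hy : 1 ≤ y) (hyx : y ≤ x)
    (hxz : x ≤ z + y) : y * (energyWeight a τ m x - energyWeight a τ m y) ≤
      (2 * m + 2 * τ) * z * y ^ a * (x ^ (2 * m) * Real.exp (2 * τ * x ^ a)) := by
  have hy0 : 0 < y := by linarith
  have hx0 : 0 ≤ x := by linarith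
  have hz : x - y ≤ z := by linarith
  have hya : 1 ≤ y ^ a := Real.one_le_rpow hy ha.le
  have hxy0 : 0 ≤ x - y := by linarith
  set P := Real.exp (2 * τ * x ^ a) with hP
  set Q := Real.exp (2 * τ * y ^ a) with hQ
  -- The tangent-line bound for the exponential, so the difference of exponents is available for
  -- `mul_rpow_sub_rpow_le`.
  have hPQ : P - Q ≤ (2 * τ * x ^ a - 2 * τ * y ^ a) * P := by
    have h := Real.add_one_le_exp (2 * τ * y ^ a - 2 * τ * x ^ a)
    rw [Real.exp_sub, le_div_iff₀ (Real.exp_pos _)] at h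
    nlinarith
  have hP0 : 0 < P := Real.exp_pos _
  have h1 : y * (x ^ (2 * m) - y ^ (2 * m)) ≤ 2 * m * x ^ (2 * m) * (z * y ^ a) := by
    have := pow_sub_pow_le_mul hy0.le hyx (2 * m)
    push_cast at this
    refine this.trans ?_
    gcongr
    nlinarith
  have h2 : y * (P - Q) ≤ 2 * τ * (y ^ a * z) * P := by
    have h3 := mul_rpow_sub_rpow_le ha1 hy0 hyx
    calc y * (P - Q) ≤ y * ((2 * τ * x ^ a - 2 * τ * y ^ a) * P) := by gcongr
      _ = 2 * τ * (y * (x ^ a - y ^ a)) * P := by ring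
      _ ≤ 2 * τ * (y ^ a * (x - y)) * P := by gcongr
      _ ≤ _ := by gcongr
  have hyx2 : y ^ (2 * m) ≤ x ^ (2 * m) := by gcongr
  have hz0 : 0 ≤ z := by linarith
  calc y * (energyWeight a τ m x - energyWeight a τ m y)
      = y * (x ^ (2 * m) - y ^ (2 * m)) * P + y ^ (2 * m) * (y * (P - Q)) := by
        simp only [energyWeight, ← hP, ← hQ]
        ring
    _ ≤ 2 * m * x ^ (2 * m) * (z * y ^ a) * P + x ^ (2 * m) * (2 * τ * (y ^ a * z) * P) := by
        refine add_le_add (by gcongr) ?_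
        calc y ^ (2 * m) * (y * (P - Q)) ≤ y ^ (2 * m) * (2 * τ * (y ^ a * z) * P) := by gcongr
          _ ≤ _ := by gcongr
    _ = _ := by ring

lemma rpow_le_mul_rpow_half (ha : 0 < a) (hy : 0 ≤ y) (hyx : y ≤ x) :
    y ^ a ≤ y ^ (a / 2) * x ^ (a / 2) := by
  have h : y ^ a = y ^ (a / 2) * y ^ (a / 2) := by
    rw [← Real.rpow_add_of_nonneg hy (by positivity) (by positivity)]
    congr 1
    ring
  rw [h]
  gcongr

/-- Without a polynomial weight there is nothing to distribute between high and low frequencies, so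
the drift can always sit at `z`. Its square power collects `z^a ≤ z` from the symbol and `z` from
the commutator. -/
lemma weight_commutator_zero_le (ha : 0 < a) (ha1 : a ≤ 1) (hτ : 0 ≤ τ) (hy : 1 ≤ y)
    (hyx : y ≤ x) (hz : 1 ≤ z) (hxz : x ≤ z + y) :
    z ^ a * (y * (energyWeight a τ 0 x - energyWeight a τ 0 y)) ≤
      2 * τ * (driftWeight a τ z * dissWeight a τ 0 y * dissWeight a τ 0 x) := by
  have h := mul_energyWeight_sub_le (m := 0) ha ha1 hτ hy hyx hxz
  have hx0 : 0 ≤ x := by linarith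
  have hy0 : 0 ≤ y := by linarith
  have hz0 : 0 ≤ z := by linarith
  have hza : z ^ a ≤ z := by simpa using Real.rpow_le_rpow_of_exponent_le hz ha1
  calc z ^ a * (y * (energyWeight a τ 0 x - energyWeight a τ 0 y))
      ≤ z * ((2 * (0 : ℕ) + 2 * τ) * z * y ^ a * (x ^ (2 * 0) * Real.exp (2 * τ * x ^ a))) := by
        refine mul_le_mul hza h (mul_nonneg hy0 (sub_nonneg.2 (energyWeight_mono ha hτ hy0 hyx))) hz0
    _ ≤ z * ((2 * (0 : ℕ) + 2 * τ) * z * (y ^ (a / 2) * x ^ (a / 2)) * (x ^ (2 * 0) *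
        (Real.exp (τ * x ^ a) * Real.exp (τ * y ^ a) * Real.exp (τ * z ^ a)))) := by
        gcongr
        · exact rpow_le_mul_rpow_half ha hy0 hyx
        · exact exp_two_mul_le ha ha1 hτ hx0 hy0 hz0 hxz
    _ = _ := by
        simp only [driftWeight, dissWeight]
        push_cast
        ring

/-- Here `x = |k|`, `y = |l|`, `z = |k-l|`. The smaller of `y` and `z` plays the drift, measured in
`ℓ¹`; the other two frequencies share the dissipation weight, each taking a power `a/2`. -/
lemma weight_commutator_le (ha : 0 < a) (ha1 : a ≤ 1) (hτ : 0 ≤ τ) (hy : 1 ≤ y)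
    (hyx : y ≤ x) (hz : 1 ≤ z) (hxz : x ≤ z + y) (hzx : z ≤ x + y) :
    z ^ a * (y * (energyWeight a τ m x - energyWeight a τ m y)) ≤
      2 ^ (m + 1) * (m + τ + 1) * (driftWeight a τ z * dissWeight a τ m y * dissWeight a τ m x
        + driftWeight a τ y * dissWeight a τ m z * dissWeight a τ m x) := by
  have hx0 : 0 ≤ x := by linarith
  have hy0 : 0 ≤ y := by linarith
  have hz0 : 0 ≤ z := by linarith
  have hza : z ^ a ≤ z := by simpa using Real.rpow_le_rpow_of_exponent_le hz ha1
  have hexp := exp_two_mul_le ha ha1 hτ hx0 hy0 hz0 hxz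
  have hm0 : (0 : ℝ) ≤ m := Nat.cast_nonneg m
  have hdz : 0 ≤ driftWeight a τ z * dissWeight a τ m y * dissWeight a τ m x :=
    mul_nonneg (mul_nonneg driftWeight_nonneg (dissWeight_nonneg hy0)) (dissWeight_nonneg hx0)
  have hdy : 0 ≤ driftWeight a τ y * dissWeight a τ m z * dissWeight a τ m x :=
    mul_nonneg (mul_nonneg driftWeight_nonneg (dissWeight_nonneg hz0)) (dissWeight_nonneg hx0)
  rw [mul_add]
  rcases le_total z y with hzy | hzy
  -- Low-frequency drift: `x ≤ 2y`, and the commutator gain is needed because the derivative falls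
  -- on the high frequency `y`.
  · refine le_trans ?_ (le_add_of_nonneg_right (by positivity))
    have hpow : x ^ (2 * m) ≤ x ^ m * (2 ^ m * y ^ m) := by
      rw [two_mul, pow_add, ← mul_pow 2 y]
      gcongr
      linarith
    calc z ^ a * (y * (energyWeight a τ m x - energyWeight a τ m y))
        ≤ z * ((2 * m + 2 * τ) * z * y ^ a * (x ^ (2 * m) * Real.exp (2 * τ * x ^ a))) :=
          mul_le_mul hza (mul_energyWeight_sub_le ha ha1 hτ hy hyx hxz)
            (mul_nonneg hy0 (sub_nonneg.2 (energyWeight_mono ha hτ hy0 hyx))) hz0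
      _ ≤ z * ((2 * m + 2 * τ) * z * (y ^ (a / 2) * x ^ (a / 2)) * ((x ^ m * (2 ^ m * y ^ m)) *
          (Real.exp (τ * x ^ a) * Real.exp (τ * y ^ a) * Real.exp (τ * z ^ a)))) := by
          gcongr
          exact rpow_le_mul_rpow_half ha hy0 hyx
      _ = 2 ^ (m + 1) * (m + τ) * (driftWeight a τ z * dissWeight a τ m y * dissWeight a τ m x) := by
          simp only [driftWeight, dissWeight]
          ring
      _ ≤ _ := mul_le_mul_of_nonneg_right
          (mul_le_mul_of_nonneg_left (by linarith) (by positivity)) hdz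
  -- High-frequency velocity: the derivative falls on the low frequency `y`, so the weight at `y` is
  -- simply dropped. The loss `z^a` is split between `z` and `x` using `z ≤ x + y ≤ 2x`.
  · refine le_trans ?_ (le_add_of_nonneg_left (by positivity))
    have hpow : x ^ (2 * m) ≤ x ^ m * (2 ^ m * z ^ m) := by
      rw [two_mul, pow_add, ← mul_pow 2 z]
      gcongr
      linarith
    have hz2 : z ^ a ≤ z ^ (a / 2) * (2 * x ^ (a / 2)) := by
      refine (rpow_le_mul_rpow_half ha hz0 (by linarith : z ≤ 2 * x)).trans ?_
      rw [Real.mul_rpow zero_le_two hx0]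
      gcongr
      simpa using Real.rpow_le_rpow_of_exponent_le one_le_two (by linarith : a / 2 ≤ 1)
    calc z ^ a * (y * (energyWeight a τ m x - energyWeight a τ m y))
        ≤ z ^ a * (y * (x ^ (2 * m) * Real.exp (2 * τ * x ^ a))) := by
          gcongr
          have := energyWeight_nonneg (a := a) (τ := τ) (m := m) hy0
          change energyWeight a τ m x - energyWeight a τ m y ≤ energyWeight a τ m x
          linarith
      _ ≤ (z ^ (a / 2) * (2 * x ^ (a / 2))) * (y ^ 2 * ((x ^ m * (2 ^ m * z ^ m)) *
          (Real.exp (τ * x ^ a) * Real.exp (τ * y ^ a) * Real.exp (τ * z ^ a)))) := by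
          gcongr
          nlinarith
      _ = 2 ^ (m + 1) * 1 * (driftWeight a τ y * dissWeight a τ m z * dissWeight a τ m x) := by
          simp only [driftWeight, dissWeight]
          ring
      _ ≤ _ := mul_le_mul_of_nonneg_right
          (mul_le_mul_of_nonneg_left (by linarith) (by positivity)) hdy

/-- For the term with no cancellation: `z ≤ x + y ≤ 2xy` when `x, y ≥ 1`, so half of `z^a` moves to
`x` at the price of one more factor `y`, which the regular function at frequency `y` can afford. -/
lemma weight_product_zero_le (ha : 0 < a) (ha1 : a ≤ 1) (hτ : 0 ≤ τ) (hx : 1 ≤ x) (hy : 1 ≤ y)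
    (hz : 1 ≤ z) (hxz : x ≤ z + y) (hzx : z ≤ x + y) :
    z ^ a * y * energyWeight a τ 0 x ≤
      2 * (driftWeight a τ y * dissWeight a τ 0 z * dissWeight a τ 0 x) := by
  have hx0 : 0 ≤ x := by linarith
  have hy0 : 0 ≤ y := by linarith
  have hz0 : 0 ≤ z := by linarith
  have hz2 : z ^ a ≤ z ^ (a / 2) * (2 * (x ^ (a / 2) * y)) := by
    refine (rpow_le_mul_rpow_half ha hz0 (by nlinarith : z ≤ 2 * (x * y))).trans ?_
    rw [Real.mul_rpow zero_le_two (by positivity), Real.mul_rpow hx0 hy0]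
    gcongr
    · simpa using Real.rpow_le_rpow_of_exponent_le one_le_two (by linarith : a / 2 ≤ 1)
    · simpa using Real.rpow_le_rpow_of_exponent_le hy (by linarith : a / 2 ≤ 1)
  calc z ^ a * y * energyWeight a τ 0 x ≤ (z ^ (a / 2) * (2 * (x ^ (a / 2) * y))) * y * (x ^ (2 * 0)
        * (Real.exp (τ * x ^ a) * Real.exp (τ * y ^ a) * Real.exp (τ * z ^ a))) := by
        unfold energyWeight
        gcongr
        exact exp_two_mul_le ha ha1 hτ hx0 hy0 hz0 hxz
    _ = _ := by
        simp only [driftWeight, dissWeight]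
        ring

end Weights

/-! ### Static energy estimates -/

/-- The change of variables `(k, l) ↦ (k - l, k)`. -/
def freqShearLeft : ((Fin d → ℤ) × (Fin d → ℤ)) ≃ ((Fin d → ℤ) × (Fin d → ℤ)) where
  toFun p := (p.1 - p.2, p.1)
  invFun p := (p.2, p.2 - p.1)
  left_inv p := by simp
  right_inv p := by simp

lemma hasSum_mul_comp_equiv {β υ : (Fin d → ℤ) → ℝ} {B D : ℝ} (hβ : HasSum β B) (hυ : HasSum υ D)
    (hβ0 : ∀ k, 0 ≤ β k) (hυ0 : ∀ k, 0 ≤ υ k)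
    (e : ((Fin d → ℤ) × (Fin d → ℤ)) ≃ ((Fin d → ℤ) × (Fin d → ℤ))) :
    HasSum (fun p => β (e p).1 * υ (e p).2) (B * D) :=
  e.hasSum_iff.2 (hβ.mul hυ (hβ.summable.mul_of_nonneg hυ.summable hβ0 hυ0))

/-- The trilinear summand `(T(k - l)·l) f(k - l) g(l) conj(g(k))`. -/
def trilinear (T : (Fin d → ℤ) → EuclideanSpace ℂ (Fin d)) (f g h : (Fin d → ℤ) → ℂ)
    (p : (Fin d → ℤ) × (Fin d → ℤ)) : ℂ :=
  symbolPairing T p.1 p.2 * f (p.1 - p.2) * g p.2 * starRingEnd ℂ (h p.1)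

section Energy

variable {C a : ℝ} {T : (Fin d → ℤ) → EuclideanSpace ℂ (Fin d)} {f g h : (Fin d → ℤ) → ℂ}

lemma norm_trilinear (p : (Fin d → ℤ) × (Fin d → ℤ)) : ‖trilinear T f g h p‖ =
    ‖symbolPairing T p.1 p.2‖ * ‖f (p.1 - p.2)‖ * ‖g p.2‖ * ‖h p.1‖ := by
  simp [trilinear]

lemma re_conj_mul_transport (hs : Summable fun p => ‖trilinear T f g h p‖) (k : Fin d → ℤ) :
    (starRingEnd ℂ (h k) * transport T f g k).re = ∑' l, (trilinear T f g h (k, l)).im := by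
  have hs' : Summable fun l => trilinear T f g h (k, l) := Summable.of_norm (hs.prod_factor k)
  rw [← Complex.im_tsum hs']
  have : starRingEnd ℂ (h k) * transport T f g k
      = -Complex.I * ∑' l, trilinear T f g h (k, l) := by
    simp only [transport, trilinear]
    rw [tsum_mul_right]
    ring
  rw [this]
  simp

lemma tsum_mul_re_conj_mul_transport {W : (Fin d → ℤ) → ℝ} (hW : ∀ k, 0 ≤ W k)
    (hs : Summable fun p => ‖trilinear T f g h p‖)
    (hsW : Summable fun p => W p.1 * ‖trilinear T f g h p‖) :
    ∑' k, W k * (2 * (starRingEnd ℂ (h k) * transport T f g k).re) =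
      2 * ∑' p : (Fin d → ℤ) × (Fin d → ℤ), W p.1 * (trilinear T f g h p).im := by
  have h1 : Summable fun p => W p.1 * (trilinear T f g h p).im := by
    refine Summable.of_norm_bounded hsW fun p => ?_
    rw [norm_mul, Real.norm_of_nonneg (hW _)]
    exact mul_le_mul_of_nonneg_left (Complex.abs_im_le_norm _) (hW _)
  rw [h1.tsum_prod, ← tsum_mul_left]
  refine tsum_congr fun k => ?_
  rw [re_conj_mul_transport hs, ← tsum_mul_left, ← tsum_mul_left, ← tsum_mul_left]
  exact tsum_congr fun l => by ring

/-- The Fourier form of the skew-symmetry of `u·∇` for a real divergence-free `u`: the imaginary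
part, which drives the energy, is odd under exchange of `k` and `l`. -/
lemma trilinear_swap (hT : IsTransportSymbol C a T) (hf : HermitianSymm f)
    (p : (Fin d → ℤ) × (Fin d → ℤ)) :
    trilinear T f g g p.swap = starRingEnd ℂ (trilinear T f g g p) := by
  simp only [trilinear, Prod.fst_swap, Prod.snd_swap, map_mul, Complex.conj_conj,
    symbolPairing_swap hT p.1 p.2]
  rw [← neg_sub p.1 p.2, hf]
  ring

/-- Antisymmetrization of the transport term in a weighted `ℓ²` energy. -/
lemma tsum_mul_re_transport_le (hT : IsTransportSymbol C a T) (hf : HermitianSymm f)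
    {W : (Fin d → ℤ) → ℝ} (hW : ∀ k, 0 ≤ W k) (hs : Summable fun p => ‖trilinear T f g g p‖)
    (hsW : Summable fun p => W p.1 * ‖trilinear T f g g p‖) {β : ℝ}
    {Q : (Fin d → ℤ) × (Fin d → ℤ) → ℝ} (hQ : HasSum Q β)
    (hle : ∀ p, |W p.1 - W p.2| * ‖trilinear T f g g p‖ ≤ Q p) :
    ∑' k, W k * (2 * (starRingEnd ℂ (g k) * transport T f g k).re) ≤ β := by
  rw [tsum_mul_re_conj_mul_transport hW hs hsW]
  have h1 : Summable fun p => W p.1 * (trilinear T f g g p).im := by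
    refine Summable.of_norm_bounded hsW fun p => ?_
    rw [norm_mul, Real.norm_of_nonneg (hW _)]
    exact mul_le_mul_of_nonneg_left (Complex.abs_im_le_norm _) (hW _)
  have h3 : ∀ p : (Fin d → ℤ) × (Fin d → ℤ), W p.swap.1 * (trilinear T f g g p.swap).im
      = -(W p.2 * (trilinear T f g g p).im) := by
    intro p
    rw [trilinear_swap hT hf]
    simp
  have h2 : Summable fun p : (Fin d → ℤ) × (Fin d → ℤ) =>
      -(W p.2 * (trilinear T f g g p).im) := by
    simp_rw [← h3]
    exact (Equiv.prodComm _ _).summable_iff.2 h1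
  have h4 : ∑' p : (Fin d → ℤ) × (Fin d → ℤ), W p.1 * (trilinear T f g g p).im
      = ∑' p : (Fin d → ℤ) × (Fin d → ℤ), -(W p.2 * (trilinear T f g g p).im) := by
    simp_rw [← h3]
    exact ((Equiv.prodComm _ _).tsum_eq fun p => W p.1 * (trilinear T f g g p).im).symm
  -- One of the two copies of the sum is replaced by its reflection, leaving the weight difference
  -- `W(k) - W(l)`.
  rw [two_mul]
  nth_rewrite 2 [h4]
  rw [← h1.tsum_add h2, ← hQ.tsum_eq]
  refine (h1.add h2).tsum_le_tsum (fun p => ?_) hQ.summable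
  refine le_trans ?_ (hle p)
  calc W p.1 * (trilinear T f g g p).im + -(W p.2 * (trilinear T f g g p).im)
      = (W p.1 - W p.2) * (trilinear T f g g p).im := by ring
    _ ≤ |(W p.1 - W p.2) * (trilinear T f g g p).im| := le_abs_self _
    _ = |W p.1 - W p.2| * |(trilinear T f g g p).im| := abs_mul _ _
    _ ≤ _ := by
      gcongr
      exact Complex.abs_im_le_norm _

lemma mul_mul_le_half_sq (b u v : ℝ) (hb : 0 ≤ b) :
    b * u * v ≤ b * (u ^ 2) / 2 + b * (v ^ 2) / 2 := by
  nlinarith [mul_nonneg hb (sq_nonneg (u - v))]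

lemma trilinear_eq_zero (hf0 : f 0 = 0) (hg0 : g 0 = 0) (hh0 : h 0 = 0)
    {p : (Fin d → ℤ) × (Fin d → ℤ)} (hp : ¬ (p.1 ≠ 0 ∧ p.2 ≠ 0 ∧ p.1 ≠ p.2)) :
    trilinear T f g h p = 0 := by
  have : p.1 = 0 ∨ p.2 = 0 ∨ p.1 = p.2 := by tauto
  rcases this with h | h | h <;> simp [trilinear, h, hf0, hg0, hh0]

variable {τ : ℝ} {m : ℕ} {B D : ℝ}

/-- Energy estimate for the transport term, with all factors measured in the same space. -/
lemma energy_transport_self_le (hC : 0 ≤ C) (ha : 0 < a) (ha1 : a ≤ 1) (hτ : 0 ≤ τ)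
    (hT : IsTransportSymbol C a T) (hf : HermitianSymm f) (hf0 : f 0 = 0)
    (hs : Summable fun p => ‖trilinear T f f f p‖)
    (hsW : Summable fun p => energyWeight a τ m (freqNorm p.1) * ‖trilinear T f f f p‖)
    (hB : HasSum (fun k => driftWeight a τ (freqNorm k) * ‖f k‖) B)
    (hD : HasSum (fun k => (dissWeight a τ m (freqNorm k) * ‖f k‖) ^ 2) D) :
    ∑' k, energyWeight a τ m (freqNorm k) * (2 * (starRingEnd ℂ (f k) * transport T f f k).re)
      ≤ 3 * C * (2 ^ (m + 1) * (m + τ + 1)) * (B * D) := by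
  set K : ℝ := 2 ^ (m + 1) * (m + τ + 1) with hK
  have hK0 : 0 ≤ K := by positivity
  set β := fun k : Fin d → ℤ => driftWeight a τ (freqNorm k) * ‖f k‖ with hβ
  set y := fun k : Fin d → ℤ => dissWeight a τ m (freqNorm k) * ‖f k‖ with hy
  have hβ0 : ∀ k, 0 ≤ β k := fun k => mul_nonneg driftWeight_nonneg (norm_nonneg _)
  have hy0 : ∀ k, 0 ≤ y k ^ 2 := fun k => sq_nonneg _
  -- Young's inequality splits each of three products `β y y` into two halves `β y²/2`. Each half
  -- depends on two of the frequencies `k`, `l`, `k-l`, and any such ordered pair is a bijective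
  -- change of variables, so each double sum equals `B D / 2`. Six of them give the factor `3`.
  have hsum := fun e => (hasSum_mul_comp_equiv hB hD hβ0 hy0 e).div_const 2
  have hQ := ((((((hsum freqShear).add (hsum freqShearLeft)).add
    (hsum (freqShear.trans (Equiv.prodComm _ _)))).add (hsum (Equiv.prodComm _ _))).add
    (hsum (freqShearLeft.trans (Equiv.prodComm _ _)))).add (hsum (Equiv.refl _))).mul_left (C * K)
  refine (tsum_mul_re_transport_le hT hf (fun k => energyWeight_nonneg (freqNorm_nonneg k)) hs hsW
    hQ fun p => ?_).trans (le_of_eq (by ring))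
  by_cases hp : p.1 ≠ 0 ∧ p.2 ≠ 0 ∧ p.1 ≠ p.2
  swap
  · rw [trilinear_eq_zero hf0 hf0 hf0 hp, norm_zero, mul_zero]
    refine mul_nonneg (mul_nonneg hC hK0) ?_
    have := fun e : ((Fin d → ℤ) × (Fin d → ℤ)) ≃ ((Fin d → ℤ) × (Fin d → ℤ)) =>
      div_nonneg (mul_nonneg (hβ0 (e p).1) (hy0 (e p).2)) zero_le_two
    refine add_nonneg (add_nonneg (add_nonneg (add_nonneg (add_nonneg ?_ ?_) ?_) ?_) ?_) ?_ <;>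
      apply this
  obtain ⟨hk, hl, hkl⟩ := hp
  obtain ⟨k, l⟩ := p
  simp only [freqShear, freqShearLeft, Equiv.trans_apply, Equiv.coe_fn_mk, Equiv.prodComm_apply,
    Prod.swap_prod_mk, Equiv.refl_apply] at hk hl hkl ⊢
  have hk1 := one_le_freqNorm hk
  have hl1 := one_le_freqNorm hl
  have hj1 := one_le_freqNorm (sub_ne_zero.2 hkl)
  have t1 := freqNorm_le_sub_add k l
  have t2 := freqNorm_le_sub_add l k
  have t3 : freqNorm (k - l) ≤ freqNorm k + freqNorm l := by
    simpa [sub_eq_add_neg] using freqNorm_add_le k (-l)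
  rw [freqNorm_sub_comm] at t2
  have key : |energyWeight a τ m (freqNorm k) - energyWeight a τ m (freqNorm l)| *
      ‖trilinear T f f f (k, l)‖ ≤
      C * K * (β (k - l) * y l * y k + β l * y (k - l) * y k + β k * y (k - l) * y l) := by
    rw [norm_trilinear]
    have hn : 0 ≤ ‖f (k - l)‖ * ‖f l‖ * ‖f k‖ := by positivity
    rcases le_total (freqNorm l) (freqNorm k) with hlk | hlk
    · have hw := weight_commutator_le (m := m) ha ha1 hτ hl1 hlk hj1 t1 t3
      rw [abs_of_nonneg (sub_nonneg.2 (energyWeight_mono ha hτ (freqNorm_nonneg l) hlk))]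
      have h3 : 0 ≤ C * K * (β k * y (k - l) * y l) := by
        have h1 := dissWeight_nonneg (a := a) (τ := τ) (m := m) (freqNorm_nonneg (k - l))
        have h2 := dissWeight_nonneg (a := a) (τ := τ) (m := m) (freqNorm_nonneg l)
        have := hβ0 k
        positivity
      calc _ ≤ (energyWeight a τ m (freqNorm k) - energyWeight a τ m (freqNorm l)) *
            ((C * freqNorm (k - l) ^ a * freqNorm l) * ‖f (k - l)‖ * ‖f l‖ * ‖f k‖) := by
            have := sub_nonneg.2 (energyWeight_mono (m := m) ha hτ (freqNorm_nonneg l) hlk)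
            gcongr
            exact norm_symbolPairing_le hT hkl
        _ = C * (freqNorm (k - l) ^ a * (freqNorm l *
            (energyWeight a τ m (freqNorm k) - energyWeight a τ m (freqNorm l)))) *
            (‖f (k - l)‖ * ‖f l‖ * ‖f k‖) := by ring
        _ ≤ C * (K * (_ + _)) * (‖f (k - l)‖ * ‖f l‖ * ‖f k‖) := by gcongr
        _ = C * K * (β (k - l) * y l * y k + β l * y (k - l) * y k) := by
            simp only [hβ, hy]
            ring
        _ ≤ _ := by linarith
    · have hw := weight_commutator_le (m := m) ha ha1 hτ hk1 hlk hj1 t2 (by linarith)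
      rw [abs_sub_comm,
        abs_of_nonneg (sub_nonneg.2 (energyWeight_mono ha hτ (freqNorm_nonneg k) hlk))]
      have h3 : 0 ≤ C * K * (β l * y (k - l) * y k) := by
        have h1 := dissWeight_nonneg (a := a) (τ := τ) (m := m) (freqNorm_nonneg (k - l))
        have h2 := dissWeight_nonneg (a := a) (τ := τ) (m := m) (freqNorm_nonneg k)
        have := hβ0 l
        positivity
      calc _ ≤ (energyWeight a τ m (freqNorm l) - energyWeight a τ m (freqNorm k)) *
            ((C * freqNorm (k - l) ^ a * freqNorm k) * ‖f (k - l)‖ * ‖f l‖ * ‖f k‖) := by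
            have := sub_nonneg.2 (energyWeight_mono (m := m) ha hτ (freqNorm_nonneg k) hlk)
            gcongr
            exact norm_symbolPairing_le' hT hkl
        _ = C * (freqNorm (k - l) ^ a * (freqNorm k *
            (energyWeight a τ m (freqNorm l) - energyWeight a τ m (freqNorm k)))) *
            (‖f (k - l)‖ * ‖f l‖ * ‖f k‖) := by ring
        _ ≤ C * (K * (_ + _)) * (‖f (k - l)‖ * ‖f l‖ * ‖f k‖) := by gcongr
        _ = C * K * (β (k - l) * y l * y k + β k * y (k - l) * y l) := by
            simp only [hβ, hy]
            ring
        _ ≤ _ := by linarith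
  refine key.trans (mul_le_mul_of_nonneg_left ?_ (mul_nonneg hC hK0))
  have e1 := mul_mul_le_half_sq (β (k - l)) (y l) (y k) (hβ0 _)
  have e2 := mul_mul_le_half_sq (β l) (y (k - l)) (y k) (hβ0 _)
  have e3 := mul_mul_le_half_sq (β k) (y (k - l)) (y l) (hβ0 _)
  linarith

/-- Energy estimate for a quantity transported by a field of higher regularity. -/
lemma energy_transport_le (hC : 0 ≤ C) (ha : 0 < a) (ha1 : a ≤ 1) (hτ : 0 ≤ τ)
    (hT : IsTransportSymbol C a T) (hf : HermitianSymm f) (hf0 : f 0 = 0) (hg0 : g 0 = 0)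
    (hs : Summable fun p => ‖trilinear T f g g p‖)
    (hsW : Summable fun p => energyWeight a τ 0 (freqNorm p.1) * ‖trilinear T f g g p‖)
    (hB : HasSum (fun k => driftWeight a τ (freqNorm k) * ‖f k‖) B)
    (hD : HasSum (fun k => (dissWeight a τ 0 (freqNorm k) * ‖g k‖) ^ 2) D) :
    ∑' k, energyWeight a τ 0 (freqNorm k) * (2 * (starRingEnd ℂ (g k) * transport T f g k).re)
      ≤ 2 * C * τ * (B * D) := by
  set β := fun k : Fin d → ℤ => driftWeight a τ (freqNorm k) * ‖f k‖ with hβ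
  set y := fun k : Fin d → ℤ => dissWeight a τ 0 (freqNorm k) * ‖g k‖ with hy
  have hβ0 : ∀ k, 0 ≤ β k := fun k => mul_nonneg driftWeight_nonneg (norm_nonneg _)
  have hy0 : ∀ k, 0 ≤ y k ^ 2 := fun k => sq_nonneg _
  have hsum := fun e => (hasSum_mul_comp_equiv hB hD hβ0 hy0 e).div_const 2
  have hQ := ((hsum freqShear).add (hsum freqShearLeft)).mul_left (C * (2 * τ))
  refine (tsum_mul_re_transport_le hT hf (fun k => energyWeight_nonneg (freqNorm_nonneg k)) hs hsW
    hQ fun p => ?_).trans (le_of_eq (by ring))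
  by_cases hp : p.1 ≠ 0 ∧ p.2 ≠ 0 ∧ p.1 ≠ p.2
  swap
  · rw [trilinear_eq_zero hf0 hg0 hg0 hp, norm_zero, mul_zero]
    refine mul_nonneg (mul_nonneg hC (by positivity)) ?_
    have := fun e : ((Fin d → ℤ) × (Fin d → ℤ)) ≃ ((Fin d → ℤ) × (Fin d → ℤ)) =>
      div_nonneg (mul_nonneg (hβ0 (e p).1) (hy0 (e p).2)) zero_le_two
    exact add_nonneg (this _) (this _)
  obtain ⟨hk, hl, hkl⟩ := hp
  obtain ⟨k, l⟩ := p
  simp only [freqShear, freqShearLeft, Equiv.coe_fn_mk] at hk hl hkl ⊢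
  have hk1 := one_le_freqNorm hk
  have hl1 := one_le_freqNorm hl
  have hj1 := one_le_freqNorm (sub_ne_zero.2 hkl)
  have t1 := freqNorm_le_sub_add k l
  have t2 := freqNorm_le_sub_add l k
  rw [freqNorm_sub_comm] at t2
  have key : |energyWeight a τ 0 (freqNorm k) - energyWeight a τ 0 (freqNorm l)| *
      ‖trilinear T f g g (k, l)‖ ≤ C * (2 * τ) * (β (k - l) * y l * y k) := by
    rw [norm_trilinear]
    have hn : 0 ≤ ‖f (k - l)‖ * ‖g l‖ * ‖g k‖ := by positivity
    rcases le_total (freqNorm l) (freqNorm k) with hlk | hlk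
    · have hw := weight_commutator_zero_le ha ha1 hτ hl1 hlk hj1 t1
      have hnn := sub_nonneg.2 (energyWeight_mono (m := 0) ha hτ (freqNorm_nonneg l) hlk)
      rw [abs_of_nonneg hnn]
      calc _ ≤ (energyWeight a τ 0 (freqNorm k) - energyWeight a τ 0 (freqNorm l)) *
            ((C * freqNorm (k - l) ^ a * freqNorm l) * ‖f (k - l)‖ * ‖g l‖ * ‖g k‖) := by
            gcongr
            exact norm_symbolPairing_le hT hkl
        _ = C * (freqNorm (k - l) ^ a * (freqNorm l *
            (energyWeight a τ 0 (freqNorm k) - energyWeight a τ 0 (freqNorm l)))) *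
            (‖f (k - l)‖ * ‖g l‖ * ‖g k‖) := by ring
        _ ≤ C * (2 * τ * _) * (‖f (k - l)‖ * ‖g l‖ * ‖g k‖) := by gcongr
        _ = _ := by
            simp only [hβ, hy]
            ring
    · have hw := weight_commutator_zero_le ha ha1 hτ hk1 hlk hj1 t2
      have hnn := sub_nonneg.2 (energyWeight_mono (m := 0) ha hτ (freqNorm_nonneg k) hlk)
      rw [abs_sub_comm, abs_of_nonneg hnn]
      calc _ ≤ (energyWeight a τ 0 (freqNorm l) - energyWeight a τ 0 (freqNorm k)) *
            ((C * freqNorm (k - l) ^ a * freqNorm k) * ‖f (k - l)‖ * ‖g l‖ * ‖g k‖) := by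
            gcongr
            exact norm_symbolPairing_le' hT hkl
        _ = C * (freqNorm (k - l) ^ a * (freqNorm k *
            (energyWeight a τ 0 (freqNorm l) - energyWeight a τ 0 (freqNorm k)))) *
            (‖f (k - l)‖ * ‖g l‖ * ‖g k‖) := by ring
        _ ≤ C * (2 * τ * _) * (‖f (k - l)‖ * ‖g l‖ * ‖g k‖) := by gcongr
        _ = _ := by
            simp only [hβ, hy]
            ring
  refine key.trans (mul_le_mul_of_nonneg_left ?_ (by positivity))
  have e1 := mul_mul_le_half_sq (β (k - l)) (y l) (y k) (hβ0 _)
  linarith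

/-- Energy estimate for the transport of a regular quantity by an irregular field. -/
lemma energy_transport_drift_le (hC : 0 ≤ C) (ha : 0 < a) (ha1 : a ≤ 1) (hτ : 0 ≤ τ)
    (hT : IsTransportSymbol C a T) (hf0 : f 0 = 0) (hg0 : g 0 = 0)
    (hs : Summable fun p => ‖trilinear T f g f p‖)
    (hsW : Summable fun p => energyWeight a τ 0 (freqNorm p.1) * ‖trilinear T f g f p‖)
    (hB : HasSum (fun k => driftWeight a τ (freqNorm k) * ‖g k‖) B)
    (hD : HasSum (fun k => (dissWeight a τ 0 (freqNorm k) * ‖f k‖) ^ 2) D) :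
    ∑' k, energyWeight a τ 0 (freqNorm k) * (2 * (starRingEnd ℂ (f k) * transport T f g k).re)
      ≤ 4 * C * (B * D) := by
  have hW : ∀ k : Fin d → ℤ, 0 ≤ energyWeight a τ 0 (freqNorm k) :=
    fun k => energyWeight_nonneg (freqNorm_nonneg k)
  rw [tsum_mul_re_conj_mul_transport hW hs hsW]
  set β := fun k : Fin d → ℤ => driftWeight a τ (freqNorm k) * ‖g k‖ with hβ
  set y := fun k : Fin d → ℤ => dissWeight a τ 0 (freqNorm k) * ‖f k‖ with hy
  have hβ0 : ∀ k, 0 ≤ β k := fun k => mul_nonneg driftWeight_nonneg (norm_nonneg _)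
  have hy0 : ∀ k, 0 ≤ y k ^ 2 := fun k => sq_nonneg _
  have hsum := fun e => (hasSum_mul_comp_equiv hB hD hβ0 hy0 e).div_const 2
  have hQ := ((hsum (freqShear.trans (Equiv.prodComm _ _))).add
    (hsum (Equiv.prodComm _ _))).mul_left (C * 2)
  have hle : ∑' p : (Fin d → ℤ) × (Fin d → ℤ), energyWeight a τ 0 (freqNorm p.1) *
      (trilinear T f g f p).im ≤ C * 2 * (B * D / 2 + B * D / 2) := by
    rw [← hQ.tsum_eq]
    refine Summable.tsum_le_tsum (fun p => ?_) ?_ hQ.summable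
    swap
    · refine Summable.of_norm_bounded hsW fun p => ?_
      rw [norm_mul, Real.norm_of_nonneg (hW _)]
      exact mul_le_mul_of_nonneg_left (Complex.abs_im_le_norm _) (hW _)
    by_cases hp : p.1 ≠ 0 ∧ p.2 ≠ 0 ∧ p.1 ≠ p.2
    swap
    · rw [trilinear_eq_zero hf0 hg0 hf0 hp, Complex.zero_im, mul_zero]
      refine mul_nonneg (by positivity) ?_
      have := fun e : ((Fin d → ℤ) × (Fin d → ℤ)) ≃ ((Fin d → ℤ) × (Fin d → ℤ)) =>
        div_nonneg (mul_nonneg (hβ0 (e p).1) (hy0 (e p).2)) zero_le_two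
      exact add_nonneg (this _) (this _)
    obtain ⟨hk, hl, hkl⟩ := hp
    obtain ⟨k, l⟩ := p
    simp only [freqShear, Equiv.trans_apply, Equiv.coe_fn_mk, Equiv.prodComm_apply,
      Prod.swap_prod_mk] at hk hl hkl ⊢
    have t3 : freqNorm (k - l) ≤ freqNorm k + freqNorm l := by
      simpa [sub_eq_add_neg] using freqNorm_add_le k (-l)
    have hw := weight_product_zero_le ha ha1 hτ (one_le_freqNorm hk) (one_le_freqNorm hl)
      (one_le_freqNorm (sub_ne_zero.2 hkl)) (freqNorm_le_sub_add k l) t3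
    have e1 := mul_mul_le_half_sq (β l) (y (k - l)) (y k) (hβ0 _)
    have hWk := hW k
    calc energyWeight a τ 0 (freqNorm k) * (trilinear T f g f (k, l)).im
        ≤ energyWeight a τ 0 (freqNorm k) * ‖trilinear T f g f (k, l)‖ := by
          gcongr
          exact (le_abs_self _).trans (Complex.abs_im_le_norm _)
      _ ≤ energyWeight a τ 0 (freqNorm k) *
          ((C * freqNorm (k - l) ^ a * freqNorm l) * ‖f (k - l)‖ * ‖g l‖ * ‖f k‖) := by
          rw [norm_trilinear]
          gcongr
          exact norm_symbolPairing_le hT hkl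
      _ = C * (freqNorm (k - l) ^ a * freqNorm l * energyWeight a τ 0 (freqNorm k)) *
          (‖f (k - l)‖ * ‖g l‖ * ‖f k‖) := by ring
      _ ≤ C * (2 * _) * (‖f (k - l)‖ * ‖g l‖ * ‖f k‖) := by gcongr
      _ = C * 2 * (β l * y (k - l) * y k) := by
          simp only [hβ, hy]
          ring
      _ ≤ _ := by gcongr
  linarith

end Energy

/-! ### The Galerkin system -/

section Galerkin

variable {C a : ℝ} {T : (Fin d → ℤ) → EuclideanSpace ℂ (Fin d)} {F : Finset (Fin d → ℤ)}

/-- Extension by zero of coefficients supported in `F`. -/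
def extendZero (x : F → ℂ) (k : Fin d → ℤ) : ℂ := if h : k ∈ F then x ⟨k, h⟩ else 0

/-- The Hermitian part of the extension by zero. -/
def hermitianPart (x : F → ℂ) (k : Fin d → ℤ) : ℂ :=
  (extendZero x k + starRingEnd ℂ (extendZero x (-k))) / 2

lemma extendZero_of_notMem (x : F → ℂ) {k : Fin d → ℤ} (hk : k ∉ F) : extendZero x k = 0 :=
  dif_neg hk

lemma extendZero_of_mem (x : F → ℂ) {k : Fin d → ℤ} (hk : k ∈ F) : extendZero x k = x ⟨k, hk⟩ :=
  dif_pos hk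

lemma hermitianPart_of_notMem (hF : ∀ k ∈ F, -k ∈ F) (x : F → ℂ) {k : Fin d → ℤ} (hk : k ∉ F) :
    hermitianPart x k = 0 := by
  have : -k ∉ F := fun h => hk (by simpa using hF _ h)
  simp [hermitianPart, extendZero_of_notMem x hk, extendZero_of_notMem x this]

lemma hermitianSymm_hermitianPart (x : F → ℂ) : HermitianSymm (hermitianPart x) := fun k => by
  rw [hermitianPart, hermitianPart, map_div₀, map_add, Complex.conj_conj, neg_neg, map_ofNat,
    add_comm]

lemma contDiff_extendZero (k : Fin d → ℤ) : ContDiff ℝ ∞ fun x : F → ℂ => extendZero x k := by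
  by_cases h : k ∈ F
  · simp only [extendZero_of_mem _ h]
    exact contDiff_apply ℝ ℂ _
  · simp only [extendZero_of_notMem _ h]
    exact contDiff_const

lemma contDiff_hermitianPart (k : Fin d → ℤ) :
    ContDiff ℝ ∞ fun x : F → ℂ => hermitianPart x k :=
  ((contDiff_extendZero k).add (Complex.conjCLE.contDiff.comp (contDiff_extendZero (-k)))).div_const _

/-- The support lies in `F`, so the series is a finite sum, quadratic in the coordinates and their
conjugates; hence smoothness over `ℝ`. -/
lemma contDiff_transport_hermitianPart (hF : ∀ k ∈ F, -k ∈ F) (k : Fin d → ℤ) :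
    ContDiff ℝ ∞ fun x : F → ℂ => transport T (hermitianPart x) (hermitianPart x) k := by
  have h : ∀ x : F → ℂ, transport T (hermitianPart x) (hermitianPart x) k = -Complex.I *
      ∑ l ∈ F, symbolPairing T k l * hermitianPart x (k - l) * hermitianPart x l := by
    intro x
    rw [transport, tsum_eq_sum fun l hl => by rw [hermitianPart_of_notMem hF x hl, mul_zero]]
  simp only [h]
  refine contDiff_const.mul (ContDiff.sum fun l _ => ?_)
  exact (contDiff_const.mul (contDiff_hermitianPart _)).mul (contDiff_hermitianPart _)

/-- Solvability of the truncated system with a cut-off at amplitude `R`. -/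
lemma exists_cutoff_galerkin (hT : IsTransportSymbol C a T) (hF : ∀ k ∈ F, -k ∈ F)
    {c₀ : (Fin d → ℤ) → ℂ} (hc₀ : HermitianSymm c₀) {R t₁ : ℝ} (hR : 0 < R) (ht₁ : 0 < t₁) :
    ∃ (θ : ℝ → (Fin d → ℤ) → ℂ) (χ : ℝ → ℝ), (∀ k ∈ F, θ 0 k = c₀ k) ∧
      (∀ t, 0 ≤ χ t ∧ χ t ≤ 1) ∧ (∀ t, (∀ k ∈ F, ‖θ t k‖ ≤ R) → χ t = 1) ∧
      (∀ t, ∀ k ∉ F, θ t k = 0) ∧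
      ∀ t ∈ Set.Icc 0 t₁, HermitianSymm (θ t) ∧ ∀ k ∈ F,
        HasDerivWithinAt (fun t => θ t k) (χ t * transport T (θ t) (θ t) k) (Set.Icc 0 t₁) t := by
  -- The quadratic field is multiplied by a bump equal to `1` on the ball of radius `R`. It becomes
  -- bounded and globally Lipschitz, so one application of Picard–Lindelöf covers all of `[0, t₁]`
  -- without a continuation argument.
  let φ : ContDiffBump (0 : F → ℂ) := ⟨R, R + 1, hR, by linarith⟩
  let w : (F → ℂ) → F → ℂ := fun x k => transport T (hermitianPart x) (hermitianPart x) k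
  have hw : ContDiff ℝ ∞ w := contDiff_pi.2 fun k => contDiff_transport_hermitianPart hF _
  let v : (F → ℂ) → F → ℂ := (φ : (F → ℂ) → ℝ) • w
  have hv : ContDiff ℝ ∞ v := φ.contDiff.smul hw
  have hsupp : HasCompactSupport v := φ.hasCompactSupport.smul_right
  obtain ⟨Lip, hLip⟩ := hv.lipschitzWith_of_hasCompactSupport hsupp (by simp)
  obtain ⟨M, hM⟩ := hsupp.exists_bound_of_continuous hv.continuous
  have hM0 : 0 ≤ M := (norm_nonneg _).trans (hM 0)
  let x₀ : F → ℂ := fun k => c₀ k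
  -- A solution with speed at most `M` cannot leave the ball of radius `M t₁` about `x₀`.
  have hPL : IsPicardLindelof (fun _ => v) (⟨0, le_rfl, ht₁.le⟩ : Set.Icc (0 : ℝ) t₁) x₀
      ⟨M * t₁, by positivity⟩ 0 ⟨M, hM0⟩ Lip :=
    { lipschitzOnWith := fun t _ => hLip.lipschitzOnWith
      continuousOn := fun x _ => continuousOn_const
      norm_le := fun t _ x _ => hM x
      mul_max_le := by
        simp only [sub_zero, sub_self, max_eq_left ht₁.le, NNReal.coe_zero]
        exact le_rfl }
  obtain ⟨α, hα0, hα⟩ := hPL.exists_eq_forall_mem_Icc_hasDerivWithinAt₀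
  have hα' : ∀ t ∈ Set.Icc 0 t₁, ∀ k : F, HasDerivWithinAt (fun t => α t k)
      (φ (α t) * transport T (hermitianPart (α t)) (hermitianPart (α t)) k) (Set.Icc 0 t₁) t := by
    intro t ht k
    have := hasDerivWithinAt_pi.1 (hα t ht) k
    simpa [v, w] using this
  have hext : ∀ t ∈ Set.Icc 0 t₁, ∀ k : Fin d → ℤ, HasDerivWithinAt (fun t => extendZero (α t) k)
      (φ (α t) * if k ∈ F then transport T (hermitianPart (α t)) (hermitianPart (α t)) k else 0)
      (Set.Icc 0 t₁) t := by
    intro t ht k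
    by_cases hk : k ∈ F
    · simp only [extendZero_of_mem _ hk, if_pos hk]
      exact hα' t ht ⟨k, hk⟩
    · simp only [extendZero_of_notMem _ hk, if_neg hk, mul_zero]
      exact hasDerivWithinAt_const _ _ _
  have hneg : ∀ k, -k ∈ F ↔ k ∈ F := fun k => ⟨fun h => by simpa using hF _ h, hF k⟩
  have hsymm : ∀ t ∈ Set.Icc 0 t₁, HermitianSymm (extendZero (α t)) := by
    intro t ht k
    -- The field was built from Hermitian parts, so its value is Hermitian whatever the state is.
    -- The defect of symmetry therefore has zero derivative and stays zero.
    have hd : ∀ t ∈ Set.Icc 0 t₁, HasDerivWithinAt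
        (fun t => extendZero (α t) (-k) - starRingEnd ℂ (extendZero (α t) k)) 0
        (Set.Icc 0 t₁) t := by
      intro t ht
      have h1 := (hext t ht (-k)).sub (hext t ht k).star
      refine h1.congr_deriv ?_
      by_cases hk : k ∈ F
      · rw [if_pos hk, if_pos (hF k hk), hermitianSymm_transport hT
          (hermitianSymm_hermitianPart _) (hermitianSymm_hermitianPart _)]
        simp
      · rw [if_neg hk, if_neg (by rwa [hneg])]
        simp
    have h0 : extendZero (α 0) (-k) - starRingEnd ℂ (extendZero (α 0) k) = 0 := by
      have : α 0 = x₀ := hα0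
      rw [this]
      by_cases hk : k ∈ F
      · rw [extendZero_of_mem _ hk, extendZero_of_mem _ (hF k hk)]
        simp [x₀, hc₀ k]
      · rw [extendZero_of_notMem _ hk, extendZero_of_notMem _ (by rwa [hneg])]
        simp
    have := Convex.norm_image_sub_le_of_norm_hasDerivWithin_le (C := 0) hd (by simp)
      (convex_Icc 0 t₁) (Set.left_mem_Icc.2 ht₁.le) ht
    rw [h0, zero_mul, sub_zero, norm_le_zero_iff, sub_eq_zero] at this
    exact this
  have hpart : ∀ t ∈ Set.Icc 0 t₁, hermitianPart (α t) = extendZero (α t) := by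
    intro t ht
    funext k
    rw [hermitianPart, hsymm t ht k, Complex.conj_conj]
    ring
  refine ⟨fun t => extendZero (α t), fun t => φ (α t), fun k hk => ?_,
    fun t => ⟨φ.nonneg, φ.le_one⟩, fun t ht => ?_, fun t k hk => extendZero_of_notMem _ hk,
    fun t ht => ⟨hsymm t ht, fun k hk => ?_⟩⟩
  · have : α 0 = x₀ := hα0
    simp only [this, extendZero_of_mem _ hk, x₀]
  · refine φ.one_of_mem_closedBall ?_
    rw [mem_closedBall_zero_iff, pi_norm_le_iff_of_nonneg hR.le]
    intro k
    have : ‖extendZero (α t) k‖ ≤ R := ht k k.2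
    rwa [extendZero_of_mem _ k.2] at this
  · have := hext t ht k
    rwa [if_pos hk, hpart t ht] at this

end Galerkin

/-! ### Uniform bounds for the Galerkin system -/

lemma hasDerivAt_energyWeight (a τ₁ lam x t : ℝ) (m : ℕ) :
    HasDerivAt (fun t => energyWeight a (τ₁ - lam * t) m x)
      (-2 * lam * (x ^ a * energyWeight a (τ₁ - lam * t) m x)) t := by
  have h1 : HasDerivAt (fun t => 2 * (τ₁ - lam * t) * x ^ a) (-2 * lam * x ^ a) t := by
    have := ((((hasDerivAt_id t).const_mul lam).const_sub τ₁).const_mul 2).mul_const (x ^ a)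
    refine this.congr_deriv ?_
    ring
  refine (h1.exp.const_mul (x ^ (2 * m))).congr_deriv ?_
  simp only [energyWeight]
  ring


/-- The shrinking radius creates the first, dissipative term, with the square of `dissWeight` in
front of `|y|²`. -/
lemma hasDerivWithinAt_energyWeight_mul {a τ₁ lam x t : ℝ} (hx : 0 ≤ x) {m : ℕ} {y : ℝ → ℂ}
    {y' : ℂ} {S : Set ℝ} (hy : HasDerivWithinAt y y' S t) :
    HasDerivWithinAt (fun t => energyWeight a (τ₁ - lam * t) m x * ‖y t‖ ^ 2)
      (-2 * lam * (dissWeight a (τ₁ - lam * t) m x * ‖y t‖) ^ 2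
        + energyWeight a (τ₁ - lam * t) m x * (2 * (starRingEnd ℂ (y t) * y').re)) S t := by
  refine ((hasDerivAt_energyWeight a τ₁ lam x t m).hasDerivWithinAt.mul hy.norm_sq).congr_deriv ?_
  rw [Complex.inner, mul_comm y', mul_pow, dissWeight_sq hx]
  ring

/-- The constant in the embedding of the energy space into the `ℓ¹` space of drifts. -/
def latticeConst (d : ℕ) : ℝ := ∑' k : Fin d → ℤ, 4 ^ d * ((1 + freqNorm k) ^ (2 * d))⁻¹

lemma latticeConst_nonneg (d : ℕ) : 0 ≤ latticeConst d := tsum_nonneg fun k => by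
  have := freqNorm_nonneg k
  positivity

/-- Young's inequality applied to `|k|^{-d} · (|k|^{d+2} e^{τ|k|^a} |f(k)|)`, with `|k|^{-2d}`
summable over nonzero frequencies. This is the reason for the exponent `m = d + 2`; `4^d` comes from
`1 + |k| ≤ 2|k|`. -/
lemma sum_driftWeight_le (a τ : ℝ) {F : Finset (Fin d → ℤ)} (hF0 : 0 ∉ F) (f : (Fin d → ℤ) → ℂ) :
    ∑ k ∈ F, driftWeight a τ (freqNorm k) * ‖f k‖ ≤
      (latticeConst d + ∑ k ∈ F, energyWeight a τ (d + 2) (freqNorm k) * ‖f k‖ ^ 2) / 2 := by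
  have hs := (summable_one_add_freqNorm_inv_pow (d := d)).mul_left (4 ^ d)
  have h1 : ∑ k ∈ F, 4 ^ d * ((1 + freqNorm k) ^ (2 * d))⁻¹ ≤ latticeConst d :=
    hs.sum_le_tsum F fun k _ => by
      have := freqNorm_nonneg k
      positivity
  refine le_trans ?_ (div_le_div_of_nonneg_right (add_le_add_left h1 _) zero_le_two)
  rw [← Finset.sum_add_distrib, Finset.sum_div]
  refine Finset.sum_le_sum fun k hk => ?_
  have hk1 := one_le_freqNorm (fun h => hF0 (h ▸ hk) : k ≠ 0)
  set x := freqNorm k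
  have hx0 : 0 < x := by linarith
  have h2 : ((x ^ d)⁻¹) ^ 2 ≤ 4 ^ d * ((1 + x) ^ (2 * d))⁻¹ := by
    rw [inv_pow, ← pow_mul, mul_comm d 2, ← div_eq_mul_inv, inv_eq_one_div,
      div_le_div_iff₀ (by positivity) (by positivity), one_mul, pow_mul, pow_mul, ← mul_pow]
    gcongr
    nlinarith
  have h3 : energyWeight a τ (d + 2) x * ‖f k‖ ^ 2
      = (x ^ (d + 2) * Real.exp (τ * x ^ a) * ‖f k‖) ^ 2 := by
    rw [energyWeight, mul_pow, mul_pow, ← pow_mul, ← Real.exp_nat_mul]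
    congr 2
    · ring
    · congr 1
      push_cast
      ring
  have h4 : driftWeight a τ x * ‖f k‖
      = (x ^ d)⁻¹ * (x ^ (d + 2) * Real.exp (τ * x ^ a) * ‖f k‖) := by
    rw [driftWeight, pow_add]
    field_simp
  rw [h4, h3]
  nlinarith [sq_nonneg ((x ^ d)⁻¹ - x ^ (d + 2) * Real.exp (τ * x ^ a) * ‖f k‖)]

section Galerkin

variable {C a : ℝ} {T : (Fin d → ℤ) → EuclideanSpace ℂ (Fin d)} {F : Finset (Fin d → ℤ)}

lemma summable_mul_norm_trilinear_of_finset {f : (Fin d → ℤ) → ℂ} (hf : ∀ k ∉ F, f k = 0)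
    (W : (Fin d → ℤ) → ℝ) : Summable fun p => W p.1 * ‖trilinear T f f f p‖ := by
  refine summable_of_ne_finset_zero (s := F ×ˢ F) fun p hp => ?_
  rw [norm_trilinear]
  rw [Finset.mem_product, not_and_or] at hp
  rcases hp with h | h <;> simp [hf _ h]

lemma sum_energy_transport_le (hC : 0 ≤ C) (ha : 0 < a) (ha1 : a ≤ 1) {τ : ℝ} (hτ : 0 ≤ τ)
    (hT : IsTransportSymbol C a T) (hF0 : 0 ∉ F) {f : (Fin d → ℤ) → ℂ} (hf : HermitianSymm f)
    (hfF : ∀ k ∉ F, f k = 0) {m : ℕ} (hm : m = d + 2) :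
    ∑ k ∈ F, energyWeight a τ m (freqNorm k) *
        (2 * (starRingEnd ℂ (f k) * transport T f f k).re) ≤
      3 * C * (2 ^ (m + 1) * (m + τ + 1)) * ((latticeConst d +
        ∑ k ∈ F, energyWeight a τ m (freqNorm k) * ‖f k‖ ^ 2) / 2 *
        ∑ k ∈ F, (dissWeight a τ m (freqNorm k) * ‖f k‖) ^ 2) := by
  have hB := hasSum_sum_of_ne_finset_zero (L := .unconditional _)
    (f := fun k => driftWeight a τ (freqNorm k) * ‖f k‖) (s := F)
    fun k hk => by simp [hfF k hk]
  have hD := hasSum_sum_of_ne_finset_zero (L := .unconditional _)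
    (f := fun k => (dissWeight a τ m (freqNorm k) * ‖f k‖) ^ 2) (s := F)
    fun k hk => by simp [hfF k hk]
  have hs := summable_mul_norm_trilinear_of_finset (T := T) hfF fun _ => 1
  simp only [one_mul] at hs
  have hsW := summable_mul_norm_trilinear_of_finset (T := T) hfF
    fun k => energyWeight a τ m (freqNorm k)
  have h := energy_transport_self_le hC ha ha1 hτ hT hf (hfF 0 hF0) hs hsW hB hD
  have hsum : ∑' k, energyWeight a τ m (freqNorm k) *
      (2 * (starRingEnd ℂ (f k) * transport T f f k).re) = ∑ k ∈ F, energyWeight a τ m (freqNorm k) *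
      (2 * (starRingEnd ℂ (f k) * transport T f f k).re) :=
    tsum_eq_sum fun k hk => by rw [hfF k hk, map_zero, zero_mul, Complex.zero_re, mul_zero, mul_zero]
  rw [hsum] at h
  refine h.trans (mul_le_mul_of_nonneg_left (mul_le_mul_of_nonneg_right ?_
    (Finset.sum_nonneg fun k _ => sq_nonneg _)) (by positivity))
  rw [hm]
  exact sum_driftWeight_le a τ hF0 f

/-- The initial energy for data with `|c(k)| ≤ K₀ e^{-τ₀|k|^a}`. -/
def initialEnergy (d : ℕ) (a τ₀ K₀ : ℝ) : ℝ :=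
  ∑' k : Fin d → ℤ, K₀ ^ 2 * ((1 + freqNorm k) ^ (2 * (d + 2)) * Real.exp (-τ₀ * freqNorm k ^ a))

lemma initialEnergy_nonneg (d : ℕ) (a τ₀ K₀ : ℝ) : 0 ≤ initialEnergy d a τ₀ K₀ :=
  tsum_nonneg fun k => by
    have := freqNorm_nonneg k
    positivity

/-- Starting with radius `τ₀/2` leaves a factor `e^{-τ₀|k|^a}` to sum the polynomial weight. -/
lemma sum_energy_le_initialEnergy {τ₀ K₀ : ℝ} (ha : 0 < a) (hτ₀ : 0 < τ₀)
    {c : (Fin d → ℤ) → ℂ} (hc : GevreyDecay a τ₀ K₀ c) (F : Finset (Fin d → ℤ)) :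
    ∑ k ∈ F, energyWeight a (τ₀ / 2) (d + 2) (freqNorm k) * ‖c k‖ ^ 2 ≤
      initialEnergy d a τ₀ K₀ := by
  have hs := (summable_pow_mul_exp_neg_rpow (d := d) ha hτ₀ (2 * (d + 2))).mul_left (K₀ ^ 2)
  refine le_trans (Finset.sum_le_sum fun k _ => ?_) (hs.sum_le_tsum F fun k _ => by
    have := freqNorm_nonneg k
    positivity)
  have h0 := freqNorm_nonneg k
  calc energyWeight a (τ₀ / 2) (d + 2) (freqNorm k) * ‖c k‖ ^ 2
      ≤ ((1 + freqNorm k) ^ (2 * (d + 2)) * Real.exp (2 * (τ₀ / 2) * freqNorm k ^ a)) *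
        (K₀ * Real.exp (-τ₀ * freqNorm k ^ a)) ^ 2 := by
        unfold energyWeight
        gcongr
        · linarith
        · exact hc k
    _ = K₀ ^ 2 * ((1 + freqNorm k) ^ (2 * (d + 2)) * (Real.exp (2 * (τ₀ / 2) * freqNorm k ^ a) *
        Real.exp (-τ₀ * freqNorm k ^ a) ^ 2)) := by ring
    _ = _ := by
        rw [← Real.exp_nat_mul, ← Real.exp_add]
        congr 4
        push_cast
        ring

/-- Galerkin approximations exist on a time interval, and with Gevrey bounds, that do not depend on
the truncation. -/
lemma exists_galerkin (d : ℕ) {C a τ₀ K₀ : ℝ} (hC : 0 < C) (ha : 0 < a) (ha1 : a ≤ 1)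
    (hτ₀ : 0 < τ₀) : ∃ t₁ σ A : ℝ, 0 < t₁ ∧ 0 < σ ∧ 0 ≤ A ∧
      ∀ T : (Fin d → ℤ) → EuclideanSpace ℂ (Fin d), IsTransportSymbol C a T →
      ∀ c₀ : (Fin d → ℤ) → ℂ, HermitianSymm c₀ → GevreyDecay a τ₀ K₀ c₀ →
      ∀ F : Finset (Fin d → ℤ), (∀ k ∈ F, -k ∈ F) → 0 ∉ F →
      ∃ θ : ℝ → (Fin d → ℤ) → ℂ, (∀ k ∈ F, θ 0 k = c₀ k) ∧ (∀ t, ∀ k ∉ F, θ t k = 0) ∧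
        ∀ t ∈ Set.Icc 0 t₁, HermitianSymm (θ t) ∧ GevreyDecay a σ A (θ t) ∧ ∀ k ∈ F,
          HasDerivWithinAt (fun t => θ t k) (transport T (θ t) (θ t) k) (Set.Icc 0 t₁) t := by
  set E₀ := initialEnergy d a τ₀ K₀ with hE₀
  have hE₀0 : 0 ≤ E₀ := initialEnergy_nonneg d a τ₀ K₀
  have hZ := latticeConst_nonneg d
  set K : ℝ := 2 ^ (d + 2 + 1) * ((d + 2 : ℕ) + τ₀ / 2 + 1) with hK
  have hK0 : 0 < K := by positivity
  -- As long as the energy is at most `E₀ + 1`, the nonlinear term is at most `(3/2) λ D`, below the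
  -- dissipation `2λD`.
  set lam : ℝ := C * K * (latticeConst d + E₀ + 1) with hlam
  have hlam0 : 0 < lam := by positivity
  -- The time in which the radius falls from `τ₀/2` to `τ₀/4`.
  set t₁ : ℝ := τ₀ / 4 / lam with ht₁
  have ht₁0 : 0 < t₁ := by positivity
  set R : ℝ := Real.sqrt (E₀ + 1) with hR
  have hR0 : 0 < R := Real.sqrt_pos.2 (by linarith)
  refine ⟨t₁, τ₀ / 4, R, ht₁0, by positivity, hR0.le, fun T hT c₀ hc₀ hdec F hF hF0 => ?_⟩
  obtain ⟨θ, χ, hinit, hχ, hχ1, hsupp, hsol⟩ := exists_cutoff_galerkin hT hF hc₀ hR0 ht₁0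
  have hτ : ∀ t ∈ Set.Icc 0 t₁, τ₀ / 4 ≤ τ₀ / 2 - lam * t := by
    intro t ht
    have : lam * t ≤ lam * t₁ := mul_le_mul_of_nonneg_left ht.2 hlam0.le
    rw [ht₁, mul_div_cancel₀ _ hlam0.ne'] at this
    linarith
  set E : ℝ → ℝ := fun t => ∑ k ∈ F,
    energyWeight a (τ₀ / 2 - lam * t) (d + 2) (freqNorm k) * ‖θ t k‖ ^ 2 with hE
  set E' : ℝ → ℝ := fun t => ∑ k ∈ F,
    (-2 * lam * (dissWeight a (τ₀ / 2 - lam * t) (d + 2) (freqNorm k) * ‖θ t k‖) ^ 2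
      + energyWeight a (τ₀ / 2 - lam * t) (d + 2) (freqNorm k) *
        (2 * (starRingEnd ℂ (θ t k) * (χ t * transport T (θ t) (θ t) k)).re)) with hE'
  have hderiv : ∀ t ∈ Set.Icc 0 t₁, HasDerivWithinAt E (E' t) (Set.Icc 0 t₁) t := by
    intro t ht
    exact HasDerivWithinAt.fun_sum fun k hk =>
      hasDerivWithinAt_energyWeight_mul (freqNorm_nonneg k) ((hsol t ht).2 k hk)
  have hEle : ∀ ⦃t⦄, t ∈ Set.Icc 0 t₁ → E t ≤ E₀ + t₁⁻¹ * t := by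
    -- The comparison only needs a strict inequality of derivatives at times of contact. The barrier
    -- rises with slope `1/t₁ > 0`, from `E₀` to `E₀ + 1`, and at contact the energy is at most `E₀
    -- + 1`, so its derivative is nonpositive.
    refine image_le_of_deriv_right_lt_deriv_boundary (B' := fun _ => t₁⁻¹)
      (fun t ht => (hderiv t ht).continuousWithinAt)
      (fun t ht => (hderiv t (Set.Ico_subset_Icc_self ht)).mono_of_mem_nhdsWithin
        (Filter.mem_of_superset (Icc_mem_nhdsGE ht.2) (Set.Icc_subset_Icc_left ht.1)))
      ?_ (fun t => by simpa using ((hasDerivAt_id t).const_mul t₁⁻¹).const_add E₀) ?_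
    · rw [mul_zero, add_zero]
      refine le_trans (le_of_eq ?_) (sum_energy_le_initialEnergy ha hτ₀ hdec F)
      refine Finset.sum_congr rfl fun k hk => ?_
      rw [hinit k hk, mul_zero, sub_zero]
    · intro t ht hEt
      have ht' := Set.Ico_subset_Icc_self ht
      have hτt := hτ t ht'
      have h1 := sum_energy_transport_le hC.le ha ha1 (by linarith : 0 ≤ τ₀ / 2 - lam * t) hT hF0
        (hsol t ht').1 (hsupp t) rfl
      change _ ≤ _ * ((latticeConst d + E t) / 2 * _) at h1
      set D := ∑ k ∈ F, (dissWeight a (τ₀ / 2 - lam * t) (d + 2) (freqNorm k) * ‖θ t k‖) ^ 2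
        with hD
      set S := ∑ k ∈ F, energyWeight a (τ₀ / 2 - lam * t) (d + 2) (freqNorm k) *
        (2 * (starRingEnd ℂ (θ t k) * transport T (θ t) (θ t) k).re) with hS
      have hD0 : 0 ≤ D := Finset.sum_nonneg fun k _ => sq_nonneg _
      have h2 : E' t = -2 * lam * D + χ t * S := by
        simp only [hE', hD, hS, Finset.mul_sum, ← Finset.sum_add_distrib]
        refine Finset.sum_congr rfl fun k _ => ?_
        rw [mul_left_comm (starRingEnd ℂ (θ t k)), Complex.re_ofReal_mul]
        ring
      have hE1 : E t ≤ E₀ + 1 := by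
        rw [hEt]
        have : t₁⁻¹ * t ≤ t₁⁻¹ * t₁ := by
          have := ht'.2
          gcongr
        rw [inv_mul_cancel₀ ht₁0.ne'] at this
        linarith
      have hE0 : 0 ≤ E t := Finset.sum_nonneg fun k _ =>
        mul_nonneg (energyWeight_nonneg (freqNorm_nonneg k)) (sq_nonneg _)
      have h3 : S ≤ 2 * lam * D := by
        refine h1.trans ?_
        have hlt : 0 ≤ lam * t := mul_nonneg hlam0.le ht'.1
        calc 3 * C * (2 ^ (d + 2 + 1) * ((d + 2 : ℕ) + (τ₀ / 2 - lam * t) + 1)) *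
              ((latticeConst d + E t) / 2 * D)
            ≤ 3 * C * K * ((latticeConst d + (E₀ + 1)) / 2 * D) := by
              rw [hK]
              have h5 : (0 : ℝ) ≤ ((d + 2 : ℕ) : ℝ) := Nat.cast_nonneg _
              gcongr
              linarith
          _ = 3 / 2 * lam * D := by rw [hlam]; ring
          _ ≤ _ := by
              gcongr
              norm_num
      -- The cut-off multiplies only the nonlinear term, not the dissipation, so a factor in `[0,1]`
      -- does no harm for either sign of `S`.
      have h4 : χ t * S ≤ 2 * lam * D := by
        have hnn : 0 ≤ 2 * lam * D := by positivity
        rcases le_total 0 S with hS0 | hS0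
        · exact (mul_le_of_le_one_left hS0 (hχ t).2).trans h3
        · exact (mul_nonpos_of_nonneg_of_nonpos (hχ t).1 hS0).trans hnn
      have : 0 < t₁⁻¹ := by positivity
      linarith
  have hbound : ∀ t ∈ Set.Icc 0 t₁, GevreyDecay a (τ₀ / 4) R (θ t) := by
    intro t ht k
    by_cases hk : k ∈ F
    swap
    · rw [hsupp t k hk, norm_zero]
      positivity
    have hk1 := one_le_freqNorm (fun h => hF0 (h ▸ hk) : k ≠ 0)
    have h1 : energyWeight a (τ₀ / 2 - lam * t) (d + 2) (freqNorm k) * ‖θ t k‖ ^ 2 ≤ E₀ + 1 := by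
      have h2 := Finset.single_le_sum (f := fun k =>
        energyWeight a (τ₀ / 2 - lam * t) (d + 2) (freqNorm k) * ‖θ t k‖ ^ 2)
        (fun k _ => mul_nonneg (energyWeight_nonneg (freqNorm_nonneg k)) (sq_nonneg _)) hk
      have h3 := hEle ht
      have : t₁⁻¹ * t ≤ t₁⁻¹ * t₁ := by
        have := ht.2
        gcongr
      rw [inv_mul_cancel₀ ht₁0.ne'] at this
      exact h2.trans (h3.trans (by linarith))
    have hx := Real.rpow_nonneg (freqNorm_nonneg k) a
    have h4 : (Real.exp (τ₀ / 4 * freqNorm k ^ a) * ‖θ t k‖) ^ 2 ≤ R ^ 2 := by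
      rw [hR, Real.sq_sqrt (by linarith), mul_pow]
      refine le_trans (mul_le_mul_of_nonneg_right ?_ (sq_nonneg _)) h1
      rw [energyWeight, ← Real.exp_nat_mul]
      refine le_trans ?_ (le_mul_of_one_le_left (Real.exp_pos _).le (one_le_pow₀ hk1))
      rw [Real.exp_le_exp]
      have := hτ t ht
      push_cast
      nlinarith
    have h5 := abs_le_of_sq_le_sq h4 hR0.le
    rw [abs_of_nonneg (by positivity)] at h5
    rw [neg_mul, Real.exp_neg, ← div_eq_mul_inv, le_div_iff₀ (Real.exp_pos _)]
    linarith
  refine ⟨θ, hinit, hsupp, fun t ht => ⟨(hsol t ht).1, hbound t ht, fun k hk => ?_⟩⟩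
  -- The a priori bound keeps every coefficient within the amplitude `R`, so the cut-off was never
  -- active.
  have h1 : χ t = 1 := by
    refine hχ1 t fun k _ => (hbound t ht k).trans ?_
    refine mul_le_of_le_one_right hR0.le (Real.exp_le_one_iff.2 ?_)
    have := Real.rpow_nonneg (freqNorm_nonneg k) a
    nlinarith
  have := (hsol t ht).2 k hk
  rwa [h1, Complex.ofReal_one, one_mul] at this

end Galerkin

/-! ### Passage to the limit -/

section Limit

variable {C a : ℝ} {T : (Fin d → ℤ) → EuclideanSpace ℂ (Fin d)}

/-- The constant in the second order Taylor bound for Gevrey bounded solutions. -/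
def taylorConst (d : ℕ) (C a σ A : ℝ) : ℝ :=
  2 * (transportConst d C a (σ / 2) * A * (transportConst d C a σ * A * A))

/-- Second order Taylor bound in time, uniform in the truncation set `F`. -/
lemma norm_taylor_remainder_le (hC : 0 ≤ C) (ha : 0 < a) (ha1 : a ≤ 1) {σ A t₁ : ℝ} (hσ : 0 < σ)
    (hA : 0 ≤ A) (hT : IsTransportSymbol C a T) {F : Finset (Fin d → ℤ)} (hF0 : 0 ∉ F)
    {θ : ℝ → (Fin d → ℤ) → ℂ} (hsupp : ∀ t, ∀ k ∉ F, θ t k = 0)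
    (hdec : ∀ t ∈ Set.Icc 0 t₁, GevreyDecay a σ A (θ t))
    (hder : ∀ t ∈ Set.Icc 0 t₁, ∀ k ∈ F,
      HasDerivWithinAt (fun t => θ t k) (transport T (θ t) (θ t) k) (Set.Icc 0 t₁) t)
    {s t : ℝ} (hs : s ∈ Set.Icc 0 t₁) (ht : t ∈ Set.Icc 0 t₁) {k : Fin d → ℤ} (hk : k ∈ F) :
    ‖θ t k - θ s k - (t - s) * transport T (θ s) (θ s) k‖ ≤
      taylorConst d C a σ A * Real.exp (-(σ / 4) * freqNorm k ^ a) * |t - s| ^ 2 := by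
  have hκ := transportConst_nonneg (d := d) (a := a) hC hσ
  have hκ' := transportConst_nonneg (d := d) (a := a) hC (half_pos hσ)
  have hz : ∀ t, θ t 0 = 0 := fun t => hsupp t 0 hF0
  -- The velocity has decay rate `σ/2`, hence so do the time increments. A second application of the
  -- transport bound to these increments brings the rate to `σ/4`.
  have hlip : ∀ u ∈ Set.Icc 0 t₁, GevreyDecay a (σ / 2)
      (transportConst d C a σ * A * A * |u - s|) fun k => θ u k - θ s k := by
    intro u hu k
    by_cases hk : k ∈ F
    · refine (Convex.norm_image_sub_le_of_norm_hasDerivWithin_le (fun v hv => hder v hv k hk)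
        (fun v hv => gevreyDecay_transport hC ha ha1 hσ hT hA hA (hz v) (hdec v hv) (hdec v hv) k)
        (convex_Icc 0 t₁) hs hu).trans (le_of_eq ?_)
      rw [Real.norm_eq_abs]
      ring
    · simp only [hsupp _ k hk, sub_self, norm_zero]
      positivity
  have hdiff : ∀ u ∈ Set.Icc 0 t₁,
      ‖transport T (θ u) (θ u) k - transport T (θ s) (θ s) k‖ ≤
        taylorConst d C a σ A * Real.exp (-(σ / 4) * freqNorm k ^ a) * |u - s| := by
    intro u hu
    have hu' := (hdec u hu).mono (by linarith : σ / 2 ≤ σ) le_rfl hA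
    have hs' := (hdec s hs).mono (by linarith : σ / 2 ≤ σ) le_rfl hA
    rw [transport_self_sub hC ha ha1 hσ hT hA hA (hz u) (hz s) (hdec u hu) (hdec s hs)]
    have hnn : 0 ≤ transportConst d C a σ * A * A * |u - s| := by positivity
    have h1 := gevreyDecay_transport hC ha ha1 (half_pos hσ) hT hA hnn (hz u) hu' (hlip u hu) k
    have h2 := gevreyDecay_transport hC ha ha1 (half_pos hσ) hT hnn hA (by simp [hz])
      (hlip u hu) hs' k
    refine (norm_add_le _ _).trans ((add_le_add h1 h2).trans (le_of_eq ?_))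
    rw [taylorConst, show σ / 2 / 2 = σ / 4 by ring]
    ring
  have hsub : Set.uIcc s t ⊆ Set.Icc 0 t₁ := Set.uIcc_subset_Icc hs ht
  have hg : ∀ u ∈ Set.uIcc s t, HasDerivWithinAt
      (fun u => θ u k - (u : ℂ) * transport T (θ s) (θ s) k)
      (transport T (θ u) (θ u) k - transport T (θ s) (θ s) k) (Set.uIcc s t) u := by
    intro u hu
    have h1 := (hder u (hsub hu) k hk).mono hsub
    have h2 := ((Complex.ofRealCLM.hasDerivAt (x := u)).mul_const
      (transport T (θ s) (θ s) k)).hasDerivWithinAt (s := Set.uIcc s t)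
    refine (h1.sub h2).congr_deriv ?_
    simp
  have hM : 0 ≤ taylorConst d C a σ A * Real.exp (-(σ / 4) * freqNorm k ^ a) := by
    rw [taylorConst]
    positivity
  -- Mean value inequality after subtracting the linear part; on the segment `|u - s| ≤ |t - s|`,
  -- which supplies the second power.
  have h := Convex.norm_image_sub_le_of_norm_hasDerivWithin_le hg
    (fun u hu => (hdiff u (hsub hu)).trans
      (mul_le_mul_of_nonneg_left (Set.abs_sub_left_of_mem_uIcc hu) hM))
    (convex_uIcc s t) Set.left_mem_uIcc Set.right_mem_uIcc
  refine le_trans (le_of_eq ?_) (h.trans (le_of_eq ?_))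
  · congr 1
    ring
  · rw [Real.norm_eq_abs]
    ring

/-- Dominated convergence: the termwise bound depends only on `σ` and `A`, so convergence of each
coefficient suffices. -/
lemma tendsto_transport (hC : 0 ≤ C) (ha : 0 < a) (ha1 : a ≤ 1) {σ A : ℝ} (hσ : 0 < σ)
    (hA : 0 ≤ A) (hT : IsTransportSymbol C a T) {ι : Type*} {𝓕 : Filter ι}
    {f : ι → (Fin d → ℤ) → ℂ} {g : (Fin d → ℤ) → ℂ} (hf0 : ∀ n, f n 0 = 0)
    (hf : ∀ n, GevreyDecay a σ A (f n))
    (hfg : ∀ k, Filter.Tendsto (fun n => f n k) 𝓕 (nhds (g k))) (k : Fin d → ℤ) :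
    Filter.Tendsto (fun n => transport T (f n) (f n) k) 𝓕 (nhds (transport T g g k)) := by
  refine Filter.Tendsto.const_mul _ (tendsto_tsum_of_dominated_convergence
    ((summable_pow_mul_exp_neg_rpow ha (half_pos hσ) 1).mul_left
      (C * (2 / σ) * A * A * Real.exp (-(σ / 2) * freqNorm k ^ a)))
    (fun l => ((hfg (k - l)).const_mul _).mul (hfg l)) (Filter.Eventually.of_forall fun n l => ?_))
  exact norm_transport_term_le hC ha ha1 hσ hT hA hA (hf0 n) (hf n) (hf n) k l

/-- Solvability of the equation in Fourier variables, with a quantitative form of the time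
derivative. -/
lemma exists_fourier_solution (d : ℕ) {C a τ₀ K₀ : ℝ} (hC : 0 < C) (ha : 0 < a) (ha1 : a ≤ 1)
    (hτ₀ : 0 < τ₀) : ∃ t₁ σ A : ℝ, 0 < t₁ ∧ 0 < σ ∧ 0 ≤ A ∧
      ∀ T : (Fin d → ℤ) → EuclideanSpace ℂ (Fin d), IsTransportSymbol C a T →
      ∀ c₀ : (Fin d → ℤ) → ℂ, HermitianSymm c₀ → c₀ 0 = 0 → GevreyDecay a τ₀ K₀ c₀ →
      ∃ c : ℝ → (Fin d → ℤ) → ℂ, c 0 = c₀ ∧ (∀ t ∈ Set.Icc 0 t₁, HermitianSymm (c t) ∧ c t 0 = 0 ∧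
        GevreyDecay a σ A (c t)) ∧ ∀ s ∈ Set.Icc 0 t₁, ∀ t ∈ Set.Icc 0 t₁, ∀ k,
          ‖c t k - c s k - (t - s) * transport T (c s) (c s) k‖ ≤
            taylorConst d C a σ A * Real.exp (-(σ / 4) * freqNorm k ^ a) * |t - s| ^ 2 := by
  obtain ⟨t₁, σ, A, ht₁, hσ, hA, hgal⟩ := exists_galerkin d (K₀ := K₀) hC ha ha1 hτ₀
  refine ⟨t₁, σ, A, ht₁, hσ, hA, fun T hT c₀ hc₀ hc₀0 hdec₀ => ?_⟩
  -- Symmetric cubes, for the reality condition, without the zero frequency, for the mean-free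
  -- condition.
  let F : ℕ → Finset (Fin d → ℤ) := fun N =>
    (Finset.Icc (fun _ => -(N : ℤ)) (fun _ => (N : ℤ))).erase 0
  have hF0 : ∀ N, 0 ∉ F N := fun N => Finset.notMem_erase _ _
  have hFneg : ∀ N, ∀ k ∈ F N, -k ∈ F N := by
    intro N k hk
    simp only [F, Finset.mem_erase, Finset.mem_Icc, Pi.le_def, Pi.neg_apply, ne_eq,
      neg_eq_zero] at hk ⊢
    exact ⟨hk.1, fun i => by linarith [hk.2.2 i], fun i => by linarith [hk.2.1 i]⟩
  have hFev : ∀ k : Fin d → ℤ, k ≠ 0 → ∀ᶠ N in Filter.atTop, k ∈ F N := by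
    intro k hk
    have h1 : ∀ i, ∀ᶠ N : ℕ in Filter.atTop, |k i| ≤ N := fun i => by
      filter_upwards [Filter.eventually_ge_atTop (k i).natAbs] with N hN
      rw [Int.abs_eq_natAbs]
      exact_mod_cast hN
    filter_upwards [Filter.eventually_all.2 h1] with N hN
    simp only [F, Finset.mem_erase, Finset.mem_Icc, Pi.le_def]
    exact ⟨hk, fun i => (abs_le.1 (hN i)).1, fun i => (abs_le.1 (hN i)).2⟩
  choose θ hinit hsupp hsol using fun N => hgal T hT c₀ hc₀ hdec₀ (F N) (hFneg N) (hF0 N)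
  -- Along an ultrafilter every bounded sequence converges, so all `t` and `k` are treated at once,
  -- with no diagonal subsequence and no equicontinuity in time.
  let U : Ultrafilter ℕ := Ultrafilter.of Filter.atTop
  have hU : (U : Filter ℕ) ≤ Filter.atTop := Ultrafilter.of_le _
  have hlim : ∀ t k, ∃ z, t ∈ Set.Icc 0 t₁ → Filter.Tendsto (fun N => θ N t k) U (nhds z) := by
    intro t k
    by_cases ht : t ∈ Set.Icc 0 t₁
    swap
    · exact ⟨0, fun h => absurd h ht⟩
    obtain ⟨z, -, hz⟩ := (isCompact_closedBall (0 : ℂ)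
      (A * Real.exp (-σ * freqNorm k ^ a))).ultrafilter_le_nhds (U.map fun N => θ N t k) (by
        rw [Filter.le_principal_iff]
        refine Filter.Eventually.of_forall (f := (U : Filter ℕ)) fun N => ?_
        rw [mem_closedBall_zero_iff]
        exact (hsol N t ht).2.1 k)
    exact ⟨z, fun _ => hz⟩
  choose c hc using hlim
  have hmem0 : (0 : ℝ) ∈ Set.Icc 0 t₁ := Set.left_mem_Icc.2 ht₁.le
  refine ⟨c, ?_, fun t ht => ⟨fun k => ?_, ?_, fun k => ?_⟩, fun s hs t ht k => ?_⟩
  · funext k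
    refine tendsto_nhds_unique (hc 0 k hmem0) (tendsto_const_nhds.congr' ?_)
    by_cases hk : k = 0
    · exact Filter.Eventually.of_forall fun N => by
        simp only [hk, hc₀0, hsupp N 0 0 (hF0 N)]
    · filter_upwards [hU (hFev k hk)] with N hN
      rw [hinit N k hN]
  · refine tendsto_nhds_unique (hc t (-k) ht) ?_
    have h := (Complex.continuous_conj.tendsto _).comp (hc t k ht)
    exact h.congr fun N => ((hsol N t ht).1 k).symm
  · refine tendsto_nhds_unique (hc t 0 ht) (tendsto_const_nhds.congr fun N => ?_)
    rw [hsupp N t 0 (hF0 N)]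
  · exact le_of_tendsto (hc t k ht).norm (Filter.Eventually.of_forall fun N => (hsol N t ht).2.1 k)
  -- The Taylor bound is a closed condition on the values at `s` and `t`, so the equation passes to
  -- a merely pointwise limit.
  · have htr := tendsto_transport hC.le ha ha1 hσ hA hT (fun N => hsupp N s 0 (hF0 N))
      (fun N => (hsol N s hs).2.1) (fun k => hc s k hs) k
    refine le_of_tendsto (((hc t k ht).sub (hc s k hs)).sub (htr.const_mul _)).norm ?_
    by_cases hk : k = 0
    · refine Filter.Eventually.of_forall fun N => ?_
      rw [hk, hsupp N t 0 (hF0 N), hsupp N s 0 (hF0 N), transport_zero hT]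
      have h1 := transportConst_nonneg (d := d) (a := a) hC.le hσ
      have h2 := transportConst_nonneg (d := d) (a := a) hC.le (half_pos hσ)
      simp only [sub_self, mul_zero, norm_zero, taylorConst]
      positivity
    · filter_upwards [hU (hFev k hk)] with N hN
      exact norm_taylor_remainder_le hC.le ha ha1 hσ hA hT (hF0 N) (hsupp N)
        (fun t ht => (hsol N t ht).2.1) (fun t ht => (hsol N t ht).2.2) hs ht hN

end Limit

/-! ### Existence in physical variables -/

/-- The exponent may be raised since `|k| ≥ 1` off zero. At `k = 0` this would fail when `r₀ = 0`,
as `0^0 = 1` while `0^a = 0`; `IsTransportSymbol` omits that frequency, which mean-free functions do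
not see. -/
lemma IsAdmissibleSymbol.isTransportSymbol {C r₀ a : ℝ} (hC : 0 ≤ C) (hr₀ : r₀ ≤ a)
    {T : (Fin d → ℤ) → EuclideanSpace ℂ (Fin d)} (hT : IsAdmissibleSymbol C r₀ T) :
    IsTransportSymbol C a T where
  bound k hk := (hT.bound k).trans (mul_le_mul_of_nonneg_left
    (Real.rpow_le_rpow_of_exponent_le (one_le_freqNorm hk) hr₀) hC)
  divFree := hT.divFree
  real := hT.real

lemma setIntegral_eq_zero_of_torusCoeff {f : (Fin d → ℝ) → ℝ} (h : torusCoeff f 0 = 0) :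
    ∫ x in Set.Icc (0 : Fin d → ℝ) (fun _ => 2 * Real.pi), f x = 0 := by
  simp only [torusCoeff_eq, neg_zero, torusChar_zero, mul_one, integral_complex_ofReal] at h
  simpa [Real.pi_ne_zero] using h

lemma memGevrey_re_fourierSum {s r σ A : ℝ} (hs : 0 < s) (hσ : 0 < σ) {c : (Fin d → ℤ) → ℂ}
    (hc : HermitianSymm c) (hc0 : c 0 = 0) (hdec : GevreyDecay (1 / s) σ A c) :
    MemGevrey s r fun x => (fourierSum c x).re := by
  have hrd := hdec.rapidDecay (by positivity) hσ
  have hco : torusCoeff (fun x => (fourierSum c x).re) = c :=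
    funext (torusCoeff_re_fourierSum hc hrd.summable_norm)
  refine ⟨isSmoothPeriodic_re_fourierSum hrd, setIntegral_eq_zero_of_torusCoeff (by rw [hco, hc0]),
    σ / 2, by positivity, ?_⟩
  obtain ⟨M, hM⟩ := exists_gevreyNorm_le (d := d) hs r A (half_lt_self hσ)
  exact (hM _ (by rwa [hco])).trans_lt ENNReal.ofReal_lt_top

/-- A quadratic remainder has zero derivative. Working within `S` covers the one-sided derivative at
the initial time. -/
lemma hasDerivWithinAt_of_abs_sub_le_sq {f : ℝ → ℝ} {f' M t : ℝ} {S : Set ℝ} (ht : t ∈ S)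
    (h : ∀ u ∈ S, |f u - f t - (u - t) * f'| ≤ M * |u - t| ^ 2) : HasDerivWithinAt f f' S t := by
  have hO : (fun u => f u - f t - (u - t) * f') =O[nhdsWithin t S] fun u => ‖u - t‖ ^ 2 := by
    refine Asymptotics.IsBigO.of_bound M ?_
    filter_upwards [self_mem_nhdsWithin] with u hu
    simpa using h u hu
  have h0 : HasDerivWithinAt (fun u => f u - f t - (u - t) * f') 0 S t := by
    have := (hO.hasFDerivWithinAt (𝕜 := ℝ) ht (by norm_num)).hasDerivWithinAt
    simpa using this
  have h1 : HasDerivWithinAt (fun u => f t + (u - t) * f') f' S t := by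
    have := (((hasDerivAt_id t).sub_const t).mul_const f').const_add (f t)
    simpa using this.hasDerivWithinAt (s := S)
  have h2 := h0.add h1
  rw [zero_add] at h2
  refine h2.congr_of_mem (fun u _ => ?_) ht
  simp

lemma isGevreySolution_re_fourierSum {C s r σ A M σ' t₁ : ℝ} (hC : 0 ≤ C) (hs : 1 ≤ s)
    (hσ : 0 < σ) (hσ' : 0 < σ') {T : (Fin d → ℤ) → EuclideanSpace ℂ (Fin d)}
    (hT : IsTransportSymbol C (1 / s) T) {θ₀ : (Fin d → ℝ) → ℝ} (hθ₀ : IsSmoothPeriodic θ₀)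
    (hsum₀ : Summable fun k => ‖torusCoeff θ₀ k‖) {c : ℝ → (Fin d → ℤ) → ℂ}
    (hc0 : c 0 = torusCoeff θ₀)
    (hc : ∀ t ∈ Set.Icc 0 t₁, HermitianSymm (c t) ∧ c t 0 = 0 ∧ GevreyDecay (1 / s) σ A (c t))
    (htay : ∀ u ∈ Set.Icc 0 t₁, ∀ t ∈ Set.Icc 0 t₁, ∀ k,
      ‖c t k - c u k - (t - u) * transport T (c u) (c u) k‖ ≤
        M * Real.exp (-σ' * freqNorm k ^ (1 / s)) * |t - u| ^ 2) :
    IsGevreySolution T s r t₁ θ₀ fun t x => (fourierSum (c t) x).re := by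
  have hs0 : 0 < s := by linarith
  have ha : 0 < 1 / s := by positivity
  have ha1 : 1 / s ≤ 1 := by rw [div_le_one hs0]; exact hs
  have hrd : ∀ t ∈ Set.Icc 0 t₁, RapidDecay (c t) := fun t ht => (hc t ht).2.2.rapidDecay ha hσ
  have hco : ∀ t ∈ Set.Icc 0 t₁, torusCoeff (fun x => (fourierSum (c t) x).re) = c t :=
    fun t ht => funext (torusCoeff_re_fourierSum (hc t ht).1 (hrd t ht).summable_norm)
  have hsub : Set.Ico 0 t₁ ⊆ Set.Icc 0 t₁ := Set.Ico_subset_Icc_self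
  refine ⟨?_, fun t ht => memGevrey_re_fourierSum hs0 hσ (hc t (hsub ht)).1 (hc t (hsub ht)).2.1
    (hc t (hsub ht)).2.2, fun T' hT' => ?_, fun t x j => (fourierSum (fun k => T k j * c t k) x).re,
    fun t ht => ?_⟩
  · funext x
    simp only [hc0, fourierSum_torusCoeff hθ₀ hsum₀, Complex.ofReal_re]
  · obtain ⟨M', hM'⟩ := exists_gevreyNorm_le (d := d) hs0 r A (half_lt_self hσ)
    refine ⟨σ / 2, by positivity, M', fun t ht => hM' _ ?_⟩
    have ht' : t ∈ Set.Icc 0 t₁ := ⟨ht.1, ht.2.trans hT'.2.le⟩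
    rw [hco t ht']
    exact (hc t ht').2.2
  have ht' := hsub ht
  have hrt := hrd t ht'
  have hct := hc t ht'
  have hu : ∀ j, RapidDecay fun k => T k j * c t k :=
    fun j => rapidDecay_symbol_mul hC ha1 hT hct.2.1 hrt j
  have hus : ∀ j, HermitianSymm fun k => T k j * c t k :=
    fun j => hermitianSymm_symbol_mul hT hct.1 j
  refine ⟨⟨fun j => isSmoothPeriodic_re_fourierSum (hu j), fun j k => ?_⟩, fun x => ?_, fun x => ?_⟩
  · rw [torusCoeff_re_fourierSum (hus j) (hu j).summable_norm, hco t ht']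
  · simp only [partialDeriv_re_fourierSum (hu _)]
    rw [← Complex.re_sum]
    simp only [fourierSum]
    rw [← Summable.tsum_finsetSum fun j _ => ((hu j).deriv j).summable_fourierSum x]
    have : ∀ k : Fin d → ℤ, ∑ j, Complex.I * (k j : ℂ) * (T k j * c t k) * torusChar k x = 0 := by
      intro k
      have h := hT.divFree k
      calc ∑ j, Complex.I * (k j : ℂ) * (T k j * c t k) * torusChar k x
          = (∑ j, (k j : ℂ) * T k j) * (Complex.I * c t k * torusChar k x) := by
            rw [Finset.sum_mul]
            exact Finset.sum_congr rfl fun j _ => by ring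
        _ = 0 := by rw [h, zero_mul]
    simp [this]
  · have hV : RapidDecay (transport T (c t) (c t)) :=
      rapidDecay_transport hC ha1 hT hct.2.1 hrt hrt
    have hval : -∑ j, (fourierSum (fun k => T k j * c t k) x).re *
        partialDeriv j (fun x => (fourierSum (c t) x).re) x
        = (fourierSum (transport T (c t) (c t)) x).re := by
      rw [fourierSum_transport hC ha1 hT hct.2.1 hrt hrt, Complex.neg_re, Complex.re_sum]
      congr 1
      refine Finset.sum_congr rfl fun j _ => ?_
      rw [partialDeriv_re_fourierSum hrt, ← ofReal_re_fourierSum (hus j) x, Complex.re_ofReal_mul,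
        Complex.ofReal_re]
    rw [hval]
    -- The Taylor remainders are summable over `k`, so the remainder at each point `x` is quadratic
    -- in time as well.
    have hse := (summable_pow_mul_exp_neg_rpow (d := d) ha hσ' 0)
    simp only [pow_zero, one_mul] at hse
    refine hasDerivWithinAt_of_abs_sub_le_sq
      (M := M * ∑' k : Fin d → ℤ, Real.exp (-σ' * freqNorm k ^ (1 / s))) ht fun v hv => ?_
    have hv' := hsub hv
    have h1 := (hrd v hv').summable_fourierSum x
    have h2 := hrt.summable_fourierSum x
    have h3 := (hV.summable_fourierSum x).mul_left ((v : ℂ) - t)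
    have heq : fourierSum (c v) x - fourierSum (c t) x
        - ((v : ℂ) - t) * fourierSum (transport T (c t) (c t)) x
        = ∑' k, (c v k - c t k - ((v : ℂ) - t) * transport T (c t) (c t) k) * torusChar k x := by
      simp only [fourierSum]
      rw [← tsum_mul_left, ← h1.tsum_sub h2, ← (h1.sub h2).tsum_sub h3]
      exact tsum_congr fun k => by ring
    have hre : (fourierSum (c v) x).re - (fourierSum (c t) x).re
        - (v - t) * (fourierSum (transport T (c t) (c t)) x).re
        = (fourierSum (c v) x - fourierSum (c t) x
          - ((v : ℂ) - t) * fourierSum (transport T (c t) (c t)) x).re := by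
      rw [← Complex.ofReal_sub, Complex.sub_re, Complex.sub_re, Complex.re_ofReal_mul]
    rw [hre]
    refine (Complex.abs_re_le_norm _).trans ?_
    rw [heq]
    refine (tsum_of_norm_bounded ((hse.mul_left M).mul_right (|v - t| ^ 2)).hasSum
      fun k => ?_).trans (le_of_eq ?_)
    · rw [norm_mul, norm_torusChar, mul_one]
      exact htay t ht' v hv' k
    · rw [tsum_mul_right, tsum_mul_left]

/-! ### Uniqueness in Fourier variables -/

/-- Solutions of the equation in Fourier variables on `[0, t₁]` with uniform Gevrey bounds. -/
structure IsFourierSolution (T : (Fin d → ℤ) → EuclideanSpace ℂ (Fin d)) (a σ A t₁ : ℝ)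
    (c : ℝ → (Fin d → ℤ) → ℂ) : Prop where
  hermitian : ∀ t ∈ Set.Icc 0 t₁, HermitianSymm (c t)
  zero : ∀ t ∈ Set.Icc 0 t₁, c t 0 = 0
  decay : ∀ t ∈ Set.Icc 0 t₁, GevreyDecay a σ A (c t)
  continuousOn : ∀ k, ContinuousOn (fun t => c t k) (Set.Icc 0 t₁)
  hasDerivAt : ∀ t ∈ Set.Ioo 0 t₁, ∀ k,
    HasDerivAt (fun t => c t k) (transport T (c t) (c t) k) t

section Uniqueness

variable {C a σ A : ℝ} {T : (Fin d → ℤ) → EuclideanSpace ℂ (Fin d)}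

/-- The weight consumes half of the decay of `h`, leaving `e^{-(σ/2)|k|^a}` for the sum over `k`;
the transport bound provides the sum over `l`. -/
lemma summable_mul_norm_trilinear (hC : 0 ≤ C) (ha : 0 < a) (ha1 : a ≤ 1) (hσ : 0 < σ)
    (hT : IsTransportSymbol C a T) {f g h : (Fin d → ℤ) → ℂ} {A₁ A₂ A₃ : ℝ} (hA₁ : 0 ≤ A₁)
    (hA₂ : 0 ≤ A₂) (hf0 : f 0 = 0) (hf : GevreyDecay a σ A₁ f) (hg : GevreyDecay a σ A₂ g)
    (hh : GevreyDecay a σ A₃ h) {W : (Fin d → ℤ) → ℝ} (hW0 : ∀ k, 0 ≤ W k)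
    (hW : ∀ k, W k ≤ Real.exp (σ / 2 * freqNorm k ^ a)) :
    Summable fun p => W p.1 * ‖trilinear T f g h p‖ := by
  have h0 : ∀ k : Fin d → ℤ, 0 ≤ freqNorm k := freqNorm_nonneg
  have hA₃ : 0 ≤ A₃ := by
    have := (norm_nonneg _).trans (hh 0)
    exact nonneg_of_mul_nonneg_left this (Real.exp_pos _)
  have h1 := (summable_pow_mul_exp_neg_rpow (d := d) ha (half_pos hσ) 0).mul_left A₃
  have h2 := (summable_pow_mul_exp_neg_rpow (d := d) ha (half_pos hσ) 1).mul_left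
    (C * (2 / σ) * A₁ * A₂)
  refine Summable.of_nonneg_of_le (fun p => mul_nonneg (hW0 _) (norm_nonneg _)) (fun p => ?_)
    (h1.mul_of_nonneg h2 (fun k => by have := h0 k; positivity)
      fun k => by have := h0 k; positivity)
  have h3 := norm_transport_term_le hC ha ha1 hσ hT hA₁ hA₂ hf0 hf hg p.1 p.2
  have h4 : Real.exp (-(σ / 2) * freqNorm p.1 ^ a) ≤ 1 := by
    rw [Real.exp_le_one_iff]
    have := Real.rpow_nonneg (h0 p.1) a
    nlinarith
  have h5 : ‖symbolPairing T p.1 p.2 * f (p.1 - p.2) * g p.2‖ ≤ C * (2 / σ) * A₁ * A₂ *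
      ((1 + freqNorm p.2) ^ 1 * Real.exp (-(σ / 2) * freqNorm p.2 ^ a)) := by
    refine h3.trans ?_
    have := h0 p.2
    exact mul_le_mul_of_nonneg_right (mul_le_of_le_one_right (by positivity) h4) (by positivity)
  have h6 : W p.1 * ‖h p.1‖ ≤
      A₃ * ((1 + freqNorm p.1) ^ 0 * Real.exp (-(σ / 2) * freqNorm p.1 ^ a)) := by
    calc W p.1 * ‖h p.1‖ ≤ Real.exp (σ / 2 * freqNorm p.1 ^ a) *
          (A₃ * Real.exp (-σ * freqNorm p.1 ^ a)) :=
          mul_le_mul (hW _) (hh _) (norm_nonneg _) (Real.exp_pos _).le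
      _ = A₃ * (Real.exp (σ / 2 * freqNorm p.1 ^ a) * Real.exp (-σ * freqNorm p.1 ^ a)) := by ring
      _ = _ := by
          rw [← Real.exp_add, pow_zero, one_mul]
          congr 2
          ring
  have hW1 := hW0 p.1
  calc W p.1 * ‖trilinear T f g h p‖
      = W p.1 * ‖h p.1‖ * ‖symbolPairing T p.1 p.2 * f (p.1 - p.2) * g p.2‖ := by
        rw [norm_trilinear, norm_mul, norm_mul]
        ring
    _ ≤ _ := mul_le_mul h6 h5 (norm_nonneg _) (by have := h0 p.1; positivity)

/-- A bound for the `ℓ¹` size of the drift of a Gevrey bounded family. -/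
def driftConst (d : ℕ) (a σ A : ℝ) : ℝ :=
  ∑' k : Fin d → ℤ, A * ((1 + freqNorm k) ^ 2 * Real.exp (-(σ / 2) * freqNorm k ^ a))

lemma driftWeight_mul_le {τ : ℝ} (hτ : τ ≤ σ / 2) {c : (Fin d → ℤ) → ℂ}
    (hc : GevreyDecay a σ A c) (k : Fin d → ℤ) : driftWeight a τ (freqNorm k) * ‖c k‖ ≤
      A * ((1 + freqNorm k) ^ 2 * Real.exp (-(σ / 2) * freqNorm k ^ a)) := by
  have h0 := freqNorm_nonneg k
  have hx := Real.rpow_nonneg h0 a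
  calc driftWeight a τ (freqNorm k) * ‖c k‖
      ≤ ((1 + freqNorm k) ^ 2 * Real.exp (σ / 2 * freqNorm k ^ a)) *
        (A * Real.exp (-σ * freqNorm k ^ a)) := by
        unfold driftWeight
        gcongr
        · linarith
        · exact hc k
    _ = A * ((1 + freqNorm k) ^ 2 * (Real.exp (σ / 2 * freqNorm k ^ a) *
        Real.exp (-σ * freqNorm k ^ a))) := by ring
    _ = _ := by
        rw [← Real.exp_add]
        congr 3
        ring

lemma exists_hasSum_driftWeight (ha : 0 < a) (hσ : 0 < σ) {τ : ℝ} (hτ : τ ≤ σ / 2)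
    {c : (Fin d → ℤ) → ℂ} (hc : GevreyDecay a σ A c) :
    ∃ B, HasSum (fun k => driftWeight a τ (freqNorm k) * ‖c k‖) B ∧ B ≤ driftConst d a σ A := by
  have hs := (summable_pow_mul_exp_neg_rpow (d := d) ha (half_pos hσ) 2).mul_left A
  have h1 : Summable fun k => driftWeight a τ (freqNorm k) * ‖c k‖ :=
    Summable.of_nonneg_of_le (fun k => mul_nonneg driftWeight_nonneg (norm_nonneg _))
      (driftWeight_mul_le hτ hc) hs
  exact ⟨_, h1.hasSum, h1.tsum_le_tsum (driftWeight_mul_le hτ hc) hs⟩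

lemma energyWeight_zero_le {τ : ℝ} (hτ : τ ≤ σ / 4) (k : Fin d → ℤ) :
    energyWeight a τ 0 (freqNorm k) ≤ Real.exp (σ / 2 * freqNorm k ^ a) := by
  have hx := Real.rpow_nonneg (freqNorm_nonneg k) a
  rw [energyWeight, mul_zero, pow_zero, one_mul, Real.exp_le_exp]
  nlinarith

/-- The dissipation rate that makes the energy of a difference decrease. -/
def uniquenessRate (d : ℕ) (C a σ A : ℝ) : ℝ :=
  C * (σ / 4) * driftConst d a σ A + 2 * C * driftConst d a σ A + 1

lemma driftConst_nonneg (hA : 0 ≤ A) : 0 ≤ driftConst d a σ A := tsum_nonneg fun k => by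
  have := freqNorm_nonneg k
  positivity

lemma uniquenessRate_pos (hC : 0 ≤ C) (hσ : 0 < σ) (hA : 0 ≤ A) :
    0 < uniquenessRate d C a σ A := by
  have := driftConst_nonneg (d := d) (a := a) (σ := σ) hA
  unfold uniquenessRate
  positivity

/-- The energy of a difference `c₁ - c₂` is dissipated. -/
lemma energy_difference_le (hC : 0 ≤ C) (ha : 0 < a) (ha1 : a ≤ 1) (hσ : 0 < σ) (hA : 0 ≤ A)
    (hT : IsTransportSymbol C a T) {c₁ c₂ : (Fin d → ℤ) → ℂ} (hh : HermitianSymm c₁)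
    (h₁0 : c₁ 0 = 0) (h₂0 : c₂ 0 = 0) (h₁ : GevreyDecay a σ A c₁) (h₂ : GevreyDecay a σ A c₂)
    {τ : ℝ} (hτ0 : 0 ≤ τ) (hτ : τ ≤ σ / 4) :
    ∑' k, (-2 * uniquenessRate d C a σ A *
        (dissWeight a τ 0 (freqNorm k) * ‖c₁ k - c₂ k‖) ^ 2
      + energyWeight a τ 0 (freqNorm k) * (2 * (starRingEnd ℂ (c₁ k - c₂ k) *
        (transport T c₁ c₁ k - transport T c₂ c₂ k)).re)) ≤ 0 := by
  set δ : (Fin d → ℤ) → ℂ := fun k => c₁ k - c₂ k with hδdef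
  have hδ : GevreyDecay a σ (A + A) δ := h₁.sub h₂
  have hδ0 : δ 0 = 0 := by simp [hδdef, h₁0, h₂0]
  have hAA : 0 ≤ A + A := by linarith
  have hW0 : ∀ k : Fin d → ℤ, 0 ≤ energyWeight a τ 0 (freqNorm k) :=
    fun k => energyWeight_nonneg (freqNorm_nonneg k)
  have hW1 : ∀ k : Fin d → ℤ, (1 : ℝ) ≤ Real.exp (σ / 2 * freqNorm k ^ a) := fun k => by
    have := Real.rpow_nonneg (freqNorm_nonneg k) a
    exact Real.one_le_exp (by positivity)
  obtain ⟨B₁, hB₁, hB₁le⟩ := exists_hasSum_driftWeight ha hσ (by linarith : τ ≤ σ / 2) h₁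
  obtain ⟨B₂, hB₂, hB₂le⟩ := exists_hasSum_driftWeight ha hσ (by linarith : τ ≤ σ / 2) h₂
  have hDs : Summable fun k => (dissWeight a τ 0 (freqNorm k) * ‖δ k‖) ^ 2 := by
    have hs := (summable_pow_mul_exp_neg_rpow (d := d) ha hσ 1).mul_left ((A + A) ^ 2)
    refine Summable.of_nonneg_of_le (fun k => sq_nonneg _) (fun k => ?_) hs
    have h0 := freqNorm_nonneg k
    have hx1 : freqNorm k ^ a ≤ (1 + freqNorm k) ^ 1 := by
      rw [pow_one]
      calc freqNorm k ^ a ≤ (1 + freqNorm k) ^ a := by gcongr; linarith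
        _ ≤ (1 + freqNorm k) ^ (1 : ℝ) :=
          Real.rpow_le_rpow_of_exponent_le (by linarith) ha1
        _ = _ := Real.rpow_one _
    rw [mul_pow, dissWeight_sq h0]
    calc freqNorm k ^ a * energyWeight a τ 0 (freqNorm k) * ‖δ k‖ ^ 2
        ≤ (1 + freqNorm k) ^ 1 * Real.exp (σ / 2 * freqNorm k ^ a) *
          ((A + A) * Real.exp (-σ * freqNorm k ^ a)) ^ 2 := by
          have := hW0 k
          gcongr
          · exact energyWeight_zero_le hτ k
          · exact hδ k
      _ = (A + A) ^ 2 * ((1 + freqNorm k) ^ 1 * (Real.exp (σ / 2 * freqNorm k ^ a) *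
          Real.exp (-σ * freqNorm k ^ a) ^ 2)) := by ring
      _ ≤ _ := by
          refine mul_le_mul_of_nonneg_left (mul_le_mul_of_nonneg_left ?_ (by positivity))
            (by positivity)
          rw [← Real.exp_nat_mul, ← Real.exp_add, Real.exp_le_exp]
          have hx := Real.rpow_nonneg h0 a
          push_cast
          nlinarith
  set D := ∑' k, (dissWeight a τ 0 (freqNorm k) * ‖δ k‖) ^ 2 with hD
  have hD0 : 0 ≤ D := tsum_nonneg fun k => sq_nonneg _
  have htri : ∀ {f g : (Fin d → ℤ) → ℂ} {A₁ A₂ : ℝ}, 0 ≤ A₁ → 0 ≤ A₂ → f 0 = 0 →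
      GevreyDecay a σ A₁ f → GevreyDecay a σ A₂ g →
      (Summable fun p => ‖trilinear T f g δ p‖) ∧
      Summable fun p => energyWeight a τ 0 (freqNorm p.1) * ‖trilinear T f g δ p‖ := by
    intro f g A₁ A₂ hA₁ hA₂ hf0 hf hg
    refine ⟨?_, summable_mul_norm_trilinear hC ha ha1 hσ hT hA₁ hA₂ hf0 hf hg hδ hW0
      (energyWeight_zero_le hτ)⟩
    have := summable_mul_norm_trilinear hC ha ha1 hσ hT hA₁ hA₂ hf0 hf hg hδ
      (W := fun _ => 1) (fun _ => zero_le_one) hW1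
    simpa only [one_mul] using this
  obtain ⟨s1, s1W⟩ := htri hA hAA h₁0 h₁ hδ
  obtain ⟨s2, s2W⟩ := htri hAA hA hδ0 hδ h₂
  -- Transport of `δ` by `c₁` uses the cancellation; transport of `c₂` by `δ` has none, but there
  -- the gradient acts on `c₂`.
  have e1 := energy_transport_le hC ha ha1 hτ0 hT hh h₁0 hδ0 s1 s1W hB₁ hDs.hasSum
  have e2 := energy_transport_drift_le hC ha ha1 hτ0 hT hδ0 h₂0 s2 s2W hB₂ hDs.hasSum
  have hsumm : ∀ {f g : (Fin d → ℤ) → ℂ}, (Summable fun p => ‖trilinear T f g δ p‖) →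
      (Summable fun p => energyWeight a τ 0 (freqNorm p.1) * ‖trilinear T f g δ p‖) →
      Summable fun k => energyWeight a τ 0 (freqNorm k) *
        (2 * (starRingEnd ℂ (δ k) * transport T f g k).re) := by
    intro f g hs hsW
    have h1 : Summable fun p : (Fin d → ℤ) × (Fin d → ℤ) =>
        energyWeight a τ 0 (freqNorm p.1) * (trilinear T f g δ p).im := by
      refine Summable.of_norm_bounded hsW fun p => ?_
      rw [norm_mul, Real.norm_of_nonneg (hW0 _)]
      exact mul_le_mul_of_nonneg_left (Complex.abs_im_le_norm _) (hW0 _)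
    refine (h1.prod.mul_left 2).congr fun k => ?_
    rw [re_conj_mul_transport hs, ← tsum_mul_left, ← tsum_mul_left, ← tsum_mul_left]
    exact tsum_congr fun l => by ring
  have q1 := hsumm s1 s1W
  have q2 := hsumm s2 s2W
  have hsplit : ∀ k, (-2 * uniquenessRate d C a σ A *
        (dissWeight a τ 0 (freqNorm k) * ‖c₁ k - c₂ k‖) ^ 2
      + energyWeight a τ 0 (freqNorm k) * (2 * (starRingEnd ℂ (c₁ k - c₂ k) *
        (transport T c₁ c₁ k - transport T c₂ c₂ k)).re))
      = -2 * uniquenessRate d C a σ A * (dissWeight a τ 0 (freqNorm k) * ‖δ k‖) ^ 2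
      + (energyWeight a τ 0 (freqNorm k) * (2 * (starRingEnd ℂ (δ k) * transport T c₁ δ k).re)
      + energyWeight a τ 0 (freqNorm k) * (2 * (starRingEnd ℂ (δ k) * transport T δ c₂ k).re)) := by
    intro k
    rw [transport_self_sub hC ha ha1 hσ hT hA hA h₁0 h₂0 h₁ h₂, mul_add, Complex.add_re]
    simp only [hδdef]
    ring
  simp_rw [hsplit]
  rw [(hDs.mul_left _).tsum_add (q1.add q2), q1.tsum_add q2, tsum_mul_left, ← hD]
  have hBD1 : 2 * C * τ * (B₁ * D) ≤ 2 * C * (σ / 4) * (driftConst d a σ A * D) := by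
    have := driftConst_nonneg (d := d) (a := a) (σ := σ) hA
    calc 2 * C * τ * (B₁ * D) ≤ 2 * C * τ * (driftConst d a σ A * D) := by gcongr
      _ ≤ _ := by gcongr
  have hBD2 : 4 * C * (B₂ * D) ≤ 4 * C * (driftConst d a σ A * D) := by gcongr
  -- The rate is chosen to cancel both estimates exactly, its summand `1` leaving `-2D`.
  have : -2 * uniquenessRate d C a σ A * D + (2 * C * (σ / 4) * (driftConst d a σ A * D)
      + 4 * C * (driftConst d a σ A * D)) = -2 * D := by
    rw [uniquenessRate]
    ring
  linarith

/-- With radius `σ/4 - λ(t - u)`, which stays nonnegative on an interval of length `σ/(4λ)`, the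
energy of the difference is nonincreasing. It starts at zero and its weights are positive. -/
lemma IsFourierSolution.eq_of_eq_of_sub_le (hC : 0 ≤ C) (ha : 0 < a) (ha1 : a ≤ 1) (hσ : 0 < σ)
    (hA : 0 ≤ A) (hT : IsTransportSymbol C a T) {t₁ : ℝ} {c₁ c₂ : ℝ → (Fin d → ℤ) → ℂ}
    (h₁ : IsFourierSolution T a σ A t₁ c₁) (h₂ : IsFourierSolution T a σ A t₁ c₂) {u v : ℝ}
    (hu : 0 ≤ u) (huv : u ≤ v) (hv : v ≤ t₁) (huv' : uniquenessRate d C a σ A * (v - u) ≤ σ / 4)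
    (heq : c₁ u = c₂ u) : c₁ v = c₂ v := by
  rcases huv.eq_or_lt with rfl | hlt
  · exact heq
  set lam := uniquenessRate d C a σ A with hlam
  have hlam0 : 0 < lam := uniquenessRate_pos hC hσ hA
  have hsub : Set.Icc u v ⊆ Set.Icc 0 t₁ := Set.Icc_subset_Icc hu hv
  have hsub' : Set.Ioo u v ⊆ Set.Ioo 0 t₁ := Set.Ioo_subset_Ioo hu hv
  set τ₁ := σ / 4 + lam * u with hτ₁
  have hτ : ∀ t ∈ Set.Icc u v, 0 ≤ τ₁ - lam * t ∧ τ₁ - lam * t ≤ σ / 4 := by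
    intro t ht
    constructor <;> nlinarith [ht.1, ht.2]
  have h0 : ∀ k : Fin d → ℤ, 0 ≤ freqNorm k := freqNorm_nonneg
  set e : (Fin d → ℤ) → ℝ → ℝ := fun k t =>
    energyWeight a (τ₁ - lam * t) 0 (freqNorm k) * ‖c₁ t k - c₂ t k‖ ^ 2 with he
  set e' : (Fin d → ℤ) → ℝ → ℝ := fun k t =>
    -2 * lam * (dissWeight a (τ₁ - lam * t) 0 (freqNorm k) * ‖c₁ t k - c₂ t k‖) ^ 2
      + energyWeight a (τ₁ - lam * t) 0 (freqNorm k) * (2 * (starRingEnd ℂ (c₁ t k - c₂ t k) *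
        (transport T (c₁ t) (c₁ t) k - transport T (c₂ t) (c₂ t) k)).re) with he'
  have hδ : ∀ t ∈ Set.Icc u v, ∀ k, ‖c₁ t k - c₂ t k‖ ≤ (A + A) * Real.exp (-σ * freqNorm k ^ a) :=
    fun t ht => (h₁.decay t (hsub ht)).sub (h₂.decay t (hsub ht))
  have hexp : ∀ k : Fin d → ℤ, Real.exp (σ / 2 * freqNorm k ^ a) * Real.exp (-σ * freqNorm k ^ a)
      = Real.exp (-(σ / 2) * freqNorm k ^ a) := fun k => by
    rw [← Real.exp_add]
    congr 1
    ring
  have hexp1 : ∀ (k : Fin d → ℤ) {ρ : ℝ}, 0 ≤ ρ → Real.exp (-ρ * freqNorm k ^ a) ≤ 1 :=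
    fun k ρ hρ => by
      rw [Real.exp_le_one_iff]
      have := Real.rpow_nonneg (h0 k) a
      nlinarith
  have hW : ∀ t ∈ Set.Icc u v, ∀ k, energyWeight a (τ₁ - lam * t) 0 (freqNorm k) * ‖c₁ t k - c₂ t k‖
      ≤ (A + A) * Real.exp (-(σ / 2) * freqNorm k ^ a) := by
    intro t ht k
    have h1 := energyWeight_zero_le (a := a) (hτ t ht).2 k
    calc _ ≤ Real.exp (σ / 2 * freqNorm k ^ a) * ((A + A) * Real.exp (-σ * freqNorm k ^ a)) :=
          mul_le_mul h1 (hδ t ht k) (norm_nonneg _) (Real.exp_pos _).le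
      _ = _ := by rw [← hexp k]; ring
  set κ := transportConst d C a σ with hκ
  have hκ0 : 0 ≤ κ := transportConst_nonneg hC hσ
  have hs1 := (summable_pow_mul_exp_neg_rpow (d := d) ha (half_pos hσ) 1)
  have hone : ∀ k : Fin d → ℤ, 1 ≤ (1 + freqNorm k) ^ 1 := fun k => by
    rw [pow_one]
    linarith [h0 k]
  have he_le : ∀ k, ∀ t ∈ Set.Icc u v, ‖e k t‖ ≤ (A + A) * (A + A) *
      ((1 + freqNorm k) ^ 1 * Real.exp (-(σ / 2) * freqNorm k ^ a)) := by
    intro k t ht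
    have hWn := energyWeight_nonneg (a := a) (τ := τ₁ - lam * t) (m := 0) (h0 k)
    have h2 : ‖c₁ t k - c₂ t k‖ ≤ A + A :=
      (hδ t ht k).trans (mul_le_of_le_one_right (by positivity) (hexp1 k hσ.le))
    have h3 := hW t ht k
    have h4 := hone k
    rw [Real.norm_of_nonneg (by positivity)]
    calc e k t = (energyWeight a (τ₁ - lam * t) 0 (freqNorm k) * ‖c₁ t k - c₂ t k‖) *
          ‖c₁ t k - c₂ t k‖ := by simp only [he]; ring
      _ ≤ ((A + A) * Real.exp (-(σ / 2) * freqNorm k ^ a)) * (A + A) := by gcongr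
      _ = (A + A) * (A + A) * (1 * Real.exp (-(σ / 2) * freqNorm k ^ a)) := by ring
      _ ≤ _ := by gcongr
  have hesum : ∀ t ∈ Set.Icc u v, Summable fun k => e k t := fun t ht =>
    Summable.of_norm_bounded (hs1.mul_left _) fun k => he_le k t ht
  -- A summable bound uniform in time, which permits differentiating the energy term by term.
  have he'_le : ∀ k, ∀ t ∈ Set.Ioo u v, ‖e' k t‖ ≤
      (2 * lam * ((A + A) * (A + A)) + (A + A) * (2 * (κ * A * A + κ * A * A))) *
      ((1 + freqNorm k) ^ 1 * Real.exp (-(σ / 2) * freqNorm k ^ a)) := by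
    intro k t ht
    have ht' := Set.Ioo_subset_Icc_self ht
    have hWn := energyWeight_nonneg (a := a) (τ := τ₁ - lam * t) (m := 0) (h0 k)
    have h2 : ‖c₁ t k - c₂ t k‖ ≤ A + A :=
      (hδ t ht' k).trans (mul_le_of_le_one_right (by positivity) (hexp1 k hσ.le))
    have h3 := hW t ht' k
    have h4 := hone k
    have hx1 : freqNorm k ^ a ≤ (1 + freqNorm k) ^ 1 := by
      have := h0 k
      rw [pow_one]
      calc freqNorm k ^ a ≤ (1 + freqNorm k) ^ a := by gcongr; linarith
        _ ≤ (1 + freqNorm k) ^ (1 : ℝ) :=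
          Real.rpow_le_rpow_of_exponent_le (by linarith) ha1
        _ = _ := Real.rpow_one _
    have hV : ‖transport T (c₁ t) (c₁ t) k - transport T (c₂ t) (c₂ t) k‖
        ≤ κ * A * A + κ * A * A := by
      refine (norm_sub_le _ _).trans (add_le_add ?_ ?_)
      · exact (gevreyDecay_transport hC ha ha1 hσ hT hA hA (h₁.zero t (hsub ht'))
          (h₁.decay t (hsub ht')) (h₁.decay t (hsub ht')) k).trans
          (mul_le_of_le_one_right (by positivity) (hexp1 k (by positivity)))
      · exact (gevreyDecay_transport hC ha ha1 hσ hT hA hA (h₂.zero t (hsub ht'))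
          (h₂.decay t (hsub ht')) (h₂.decay t (hsub ht')) k).trans
          (mul_le_of_le_one_right (by positivity) (hexp1 k (by positivity)))
    have hp1 : ‖-2 * lam * (dissWeight a (τ₁ - lam * t) 0 (freqNorm k) * ‖c₁ t k - c₂ t k‖) ^ 2‖
        ≤ 2 * lam * ((A + A) * (A + A)) *
          ((1 + freqNorm k) ^ 1 * Real.exp (-(σ / 2) * freqNorm k ^ a)) := by
      rw [norm_mul, norm_mul, norm_neg, Real.norm_of_nonneg zero_le_two,
        Real.norm_of_nonneg hlam0.le, Real.norm_of_nonneg (sq_nonneg _), mul_pow,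
        dissWeight_sq (h0 k)]
      calc 2 * lam * (freqNorm k ^ a * energyWeight a (τ₁ - lam * t) 0 (freqNorm k) *
            ‖c₁ t k - c₂ t k‖ ^ 2)
          = 2 * lam * (freqNorm k ^ a * (energyWeight a (τ₁ - lam * t) 0 (freqNorm k) *
            ‖c₁ t k - c₂ t k‖) * ‖c₁ t k - c₂ t k‖) := by ring
        _ ≤ 2 * lam * ((1 + freqNorm k) ^ 1 *
            ((A + A) * Real.exp (-(σ / 2) * freqNorm k ^ a)) * (A + A)) := by gcongr
        _ = _ := by ring
    have hp2 : ‖energyWeight a (τ₁ - lam * t) 0 (freqNorm k) *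
        (2 * (starRingEnd ℂ (c₁ t k - c₂ t k) *
        (transport T (c₁ t) (c₁ t) k - transport T (c₂ t) (c₂ t) k)).re)‖ ≤
        (A + A) * (2 * (κ * A * A + κ * A * A)) *
          ((1 + freqNorm k) ^ 1 * Real.exp (-(σ / 2) * freqNorm k ^ a)) := by
      rw [norm_mul, norm_mul, Real.norm_of_nonneg hWn, Real.norm_of_nonneg zero_le_two]
      have hre : ‖(starRingEnd ℂ (c₁ t k - c₂ t k) *
          (transport T (c₁ t) (c₁ t) k - transport T (c₂ t) (c₂ t) k)).re‖
          ≤ ‖c₁ t k - c₂ t k‖ * (κ * A * A + κ * A * A) := by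
        refine (Complex.abs_re_le_norm _).trans ?_
        rw [norm_mul, RCLike.norm_conj]
        gcongr
      calc _ ≤ energyWeight a (τ₁ - lam * t) 0 (freqNorm k) *
            (2 * (‖c₁ t k - c₂ t k‖ * (κ * A * A + κ * A * A))) := by gcongr
        _ = (energyWeight a (τ₁ - lam * t) 0 (freqNorm k) * ‖c₁ t k - c₂ t k‖) *
            (2 * (κ * A * A + κ * A * A)) := by ring
        _ ≤ ((A + A) * Real.exp (-(σ / 2) * freqNorm k ^ a)) * (2 * (κ * A * A + κ * A * A)) := by
            gcongr
        _ = (A + A) * (2 * (κ * A * A + κ * A * A)) *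
            (1 * Real.exp (-(σ / 2) * freqNorm k ^ a)) := by ring
        _ ≤ _ := by gcongr
    refine (norm_add_le _ _).trans ((add_le_add hp1 hp2).trans (le_of_eq ?_))
    ring
  have hder : ∀ t ∈ Set.Ioo u v, HasDerivAt (fun t => ∑' k, e k t) (∑' k, e' k t) t := by
    intro t ht
    refine hasDerivAt_tsum_of_isPreconnected (hs1.mul_left _) isOpen_Ioo isPreconnected_Ioo
      (fun k y hy => ?_) he'_le ht (hesum t (Set.Ioo_subset_Icc_self ht)) ht
    have := hasDerivWithinAt_energyWeight_mul (a := a) (τ₁ := τ₁) (lam := lam) (m := 0) (h0 k)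
      (((h₁.hasDerivAt y (hsub' hy) k).sub (h₂.hasDerivAt y (hsub' hy) k)).hasDerivWithinAt
        (s := Set.univ))
    exact this.hasDerivAt Filter.univ_mem
  have hcont : ContinuousOn (fun t => ∑' k, e k t) (Set.Icc u v) := by
    refine continuousOn_tsum (fun k => ?_) (hs1.mul_left _) he_le
    have hw : Continuous fun t => energyWeight a (τ₁ - lam * t) 0 (freqNorm k) :=
      continuous_iff_continuousAt.2 fun t => (hasDerivAt_energyWeight a τ₁ lam _ t 0).continuousAt
    exact hw.continuousOn.mul
      ((((h₁.continuousOn k).mono hsub).sub ((h₂.continuousOn k).mono hsub)).norm.pow 2)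
  have hanti : AntitoneOn (fun t => ∑' k, e k t) (Set.Icc u v) := by
    refine antitoneOn_of_deriv_nonpos (convex_Icc u v) hcont ?_ ?_
    · rw [interior_Icc]
      exact fun t ht => (hder t ht).differentiableAt.differentiableWithinAt
    · rw [interior_Icc]
      intro t ht
      have ht' := Set.Ioo_subset_Icc_self ht
      rw [(hder t ht).deriv]
      exact energy_difference_le hC ha ha1 hσ hA hT (h₁.hermitian t (hsub ht'))
        (h₁.zero t (hsub ht')) (h₂.zero t (hsub ht')) (h₁.decay t (hsub ht'))
        (h₂.decay t (hsub ht')) (hτ t ht').1 (hτ t ht').2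
  have hle := hanti (Set.left_mem_Icc.2 huv) (Set.right_mem_Icc.2 huv) huv
  have hzero : ∑' k, e k u = 0 := by simp [he, heq]
  funext k
  have hnn : ∀ l, 0 ≤ e l v := fun l => mul_nonneg (energyWeight_nonneg (h0 l)) (sq_nonneg _)
  have hk : e k v ≤ 0 := by
    refine ((hesum v (Set.right_mem_Icc.2 huv)).le_tsum k fun l _ => hnn l).trans ?_
    exact hle.trans hzero.le
  have hWpos : 0 < energyWeight a (τ₁ - lam * v) 0 (freqNorm k) := by
    rw [energyWeight, mul_zero, pow_zero, one_mul]
    exact Real.exp_pos _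
  have hsq : ‖c₁ v k - c₂ v k‖ ^ 2 ≤ 0 := by
    by_contra hcon
    exact absurd hk (not_le.2 (mul_pos hWpos (not_le.1 hcon)))
  have := pow_eq_zero_iff (two_ne_zero) |>.1 (le_antisymm hsq (sq_nonneg _))
  rwa [norm_eq_zero, sub_eq_zero] at this

/-- The admissible step `σ/(4λ)` depends only on bounds valid on all of `[0, t₁]`, so the radius can
be reset to `σ/4` after each step and finitely many steps reach `t`. -/
lemma IsFourierSolution.eq_of_initial_eq (hC : 0 ≤ C) (ha : 0 < a) (ha1 : a ≤ 1) (hσ : 0 < σ)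
    (hA : 0 ≤ A) (hT : IsTransportSymbol C a T) {t₁ : ℝ} {c₁ c₂ : ℝ → (Fin d → ℤ) → ℂ}
    (h₁ : IsFourierSolution T a σ A t₁ c₁) (h₂ : IsFourierSolution T a σ A t₁ c₂)
    (heq : c₁ 0 = c₂ 0) {t : ℝ} (ht : t ∈ Set.Icc 0 t₁) : c₁ t = c₂ t := by
  have hlam0 : 0 < uniquenessRate d C a σ A := uniquenessRate_pos hC hσ hA
  set h := σ / 4 / uniquenessRate d C a σ A with hh
  have hh0 : 0 < h := by positivity
  have key : ∀ n : ℕ, ∀ t ∈ Set.Icc 0 t₁, t ≤ n * h → c₁ t = c₂ t := by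
    intro n
    induction n with
    | zero =>
      intro t ht htn
      have : t = 0 := le_antisymm (by simpa using htn) ht.1
      rw [this, heq]
    | succ n ih =>
      intro t ht htn
      push_cast at htn
      rcases le_total t (n * h) with hle | hle
      · exact ih t ht hle
      · have hn0 : 0 ≤ n * h := by positivity
        refine h₁.eq_of_eq_of_sub_le hC ha ha1 hσ hA hT h₂ hn0 hle ht.2 ?_
          (ih _ ⟨hn0, hle.trans ht.2⟩ le_rfl)
        have : t - n * h ≤ h := by linarith
        calc _ ≤ uniquenessRate d C a σ A * h := by gcongr
          _ = σ / 4 := by rw [hh]; field_simp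
  obtain ⟨n, hn⟩ := exists_nat_ge (t / h)
  exact key n t ht ((div_le_iff₀ hh0).1 hn)

end Uniqueness

/-! ### Uniqueness in physical variables -/

lemma norm_fourierSum_le {σ A a : ℝ} (ha : 0 < a) (hσ : 0 < σ) {c : (Fin d → ℤ) → ℂ}
    (hc : GevreyDecay a σ A c) (x : Fin d → ℝ) :
    ‖fourierSum c x‖ ≤ ∑' k : Fin d → ℤ, A * Real.exp (-σ * freqNorm k ^ a) := by
  have hs := (summable_pow_mul_exp_neg_rpow (d := d) ha hσ 0).mul_left A
  simp only [pow_zero, one_mul] at hs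
  refine tsum_of_norm_bounded hs.hasSum fun k => ?_
  rw [norm_mul, norm_torusChar, mul_one]
  exact hc k

lemma continuous_re_fourierSum {c : (Fin d → ℤ) → ℂ} (hc : RapidDecay c) :
    Continuous fun x => (fourierSum c x).re :=
  (isSmoothPeriodic_re_fourierSum hc).smooth.continuous

lemma eq_re_fourierSum {f : (Fin d → ℝ) → ℝ} (hf : IsSmoothPeriodic f)
    (hs : Summable fun k => ‖torusCoeff f k‖) : f = fun x => (fourierSum (torusCoeff f) x).re := by
  funext x
  rw [fourierSum_torusCoeff hf hs, Complex.ofReal_re]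

section Physical

variable {C s r σ A Tmax : ℝ} {T : (Fin d → ℤ) → EuclideanSpace ℂ (Fin d)}
  {θ₀ : (Fin d → ℝ) → ℝ} {θ : ℝ → (Fin d → ℝ) → ℝ}

/-- The time derivative of a solution, as a Fourier series. -/
lemma IsGevreySolution.hasDerivWithinAt (hC : 0 ≤ C) (hs : 1 ≤ s) (hσ : 0 < σ)
    (hT : IsTransportSymbol C (1 / s) T) (hθ : IsGevreySolution T s r Tmax θ₀ θ) {t : ℝ}
    (ht : t ∈ Set.Ico 0 Tmax) (hdec : GevreyDecay (1 / s) σ A (torusCoeff (θ t)))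
    (x : Fin d → ℝ) : HasDerivWithinAt (fun t => θ t x)
      (fourierSum (transport T (torusCoeff (θ t)) (torusCoeff (θ t))) x).re (Set.Ico 0 Tmax) t := by
  have hs0 : 0 < s := by linarith
  have ha : 0 < 1 / s := by positivity
  have ha1 : 1 / s ≤ 1 := by rw [div_le_one hs0]; exact hs
  obtain ⟨u, hu⟩ := hθ.equation
  obtain ⟨hmul, -, hd⟩ := hu t ht
  have hmem := hθ.memGevrey t ht
  have hrd := hdec.rapidDecay ha hσ
  have hc0 : torusCoeff (θ t) 0 = 0 := torusCoeff_zero_eq_zero hmem.meanZero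
  have hherm := hermitianSymm_torusCoeff (θ t)
  have hθt := eq_re_fourierSum hmem.smoothPeriodic hrd.summable_norm
  have hur : ∀ j, RapidDecay fun k => T k j * torusCoeff (θ t) k :=
    fun j => rapidDecay_symbol_mul hC ha1 hT hc0 hrd j
  have huj : ∀ j, (u t x j : ℂ) = fourierSum (fun k => T k j * torusCoeff (θ t) k) x := by
    intro j
    have hco : torusCoeff (fun x => u t x j) = fun k => T k j * torusCoeff (θ t) k :=
      funext (hmul.coeff j)
    rw [← hco]
    exact (fourierSum_torusCoeff (hmul.smoothPeriodic j)
      (by rw [hco]; exact (hur j).summable_norm) x).symm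
  refine (hd x).congr_deriv ?_
  rw [fourierSum_transport hC ha1 hT hc0 hrd hrd, Complex.neg_re, Complex.re_sum]
  congr 1
  refine Finset.sum_congr rfl fun j _ => ?_
  rw [← huj j, Complex.re_ofReal_mul, ← partialDeriv_re_fourierSum hrd, ← hθt]

/-- The pointwise equation is integrated against characters. Uniform Gevrey decay bounds `θ` and its
time derivative by constants, which dominate on the bounded cube and justify differentiation under
the integral. -/
lemma IsGevreySolution.isFourierSolution (hC : 0 ≤ C) (hs : 1 ≤ s) (hσ : 0 < σ) (hA : 0 ≤ A)
    (hT : IsTransportSymbol C (1 / s) T) (hθ : IsGevreySolution T s r Tmax θ₀ θ) {t₁ : ℝ}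
    (ht₁ : t₁ < Tmax) (hdec : ∀ t ∈ Set.Icc 0 t₁, GevreyDecay (1 / s) σ A (torusCoeff (θ t))) :
    IsFourierSolution T (1 / s) σ A t₁ fun t => torusCoeff (θ t) := by
  have hs0 : 0 < s := by linarith
  have ha : 0 < 1 / s := by positivity
  have ha1 : 1 / s ≤ 1 := by rw [div_le_one hs0]; exact hs
  have hsub : Set.Icc 0 t₁ ⊆ Set.Ico 0 Tmax := fun t ht => ⟨ht.1, ht.2.trans_lt ht₁⟩
  have hmem := fun t (ht : t ∈ Set.Icc 0 t₁) => hθ.memGevrey t (hsub ht)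
  have hrd := fun t (ht : t ∈ Set.Icc 0 t₁) => (hdec t ht).rapidDecay ha hσ
  have hz := fun t (ht : t ∈ Set.Icc 0 t₁) => torusCoeff_zero_eq_zero (hmem t ht).meanZero
  have hder := fun t (ht : t ∈ Set.Icc 0 t₁) =>
    hθ.hasDerivWithinAt hC hs hσ hT (hsub ht) (hdec t ht)
  have hfin : MeasureTheory.IsFiniteMeasure (MeasureTheory.volume.restrict
      (Set.Icc (0 : Fin d → ℝ) (fun _ => 2 * Real.pi))) :=
    ⟨by simpa using isCompact_Icc.measure_lt_top⟩
  have hcontF : ∀ t ∈ Set.Icc 0 t₁, ∀ k, Continuous fun x => (θ t x : ℂ) * torusChar (-k) x :=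
    fun t ht k => (Complex.continuous_ofReal.comp (hmem t ht).smoothPeriodic.smooth.continuous).mul
      (continuous_torusChar _)
  refine ⟨fun t _ => hermitianSymm_torusCoeff _, hz, hdec, fun k => ?_, fun t ht k => ?_⟩
  · simp only [torusCoeff_eq]
    -- Continuity is proved separately since it is needed up to the endpoints, where no two-sided
    -- derivative is claimed.
    refine continuousOn_const.mul (MeasureTheory.continuousOn_of_dominated
      (bound := fun _ => ∑' k : Fin d → ℤ, A * Real.exp (-σ * freqNorm k ^ (1 / s)))
      (fun t ht => (hcontF t ht k).aestronglyMeasurable) (fun t ht => ?_)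
      (MeasureTheory.integrable_const _) ?_)
    · refine Filter.Eventually.of_forall fun x => ?_
      rw [norm_mul, norm_torusChar, mul_one,
        ← fourierSum_torusCoeff (hmem t ht).smoothPeriodic (hrd t ht).summable_norm]
      exact norm_fourierSum_le ha hσ (hdec t ht) x
    · refine Filter.Eventually.of_forall fun x t ht => ?_
      have h1 := ((hder t ht x).continuousWithinAt).mono hsub
      exact (Complex.continuous_ofReal.continuousAt.comp_continuousWithinAt h1).mul
        continuousWithinAt_const
  · have ht' := Set.Ioo_subset_Icc_self ht
    have hV := gevreyDecay_transport hC ha ha1 hσ hT hA hA (hz t ht') (hdec t ht') (hdec t ht')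
    have hVr := hV.rapidDecay ha (half_pos hσ)
    have hVs := hermitianSymm_transport hT (hermitianSymm_torusCoeff (θ t))
      (hermitianSymm_torusCoeff (θ t))
    have hcoV := torusCoeff_re_fourierSum hVs hVr.summable_norm k
    rw [torusCoeff_eq] at hcoV
    simp only [torusCoeff_eq (θ _)]
    rw [← hcoV]
    refine HasDerivAt.const_mul _ ?_
    refine (hasDerivAt_integral_of_dominated_loc_of_deriv_le (s := Set.Ioo 0 t₁)
      (bound := fun _ => ∑' l : Fin d → ℤ, transportConst d C (1 / s) σ * A * A *
        Real.exp (-(σ / 2) * freqNorm l ^ (1 / s)))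
      (F' := fun t x => ((fourierSum (transport T (torusCoeff (θ t)) (torusCoeff (θ t))) x).re : ℂ)
        * torusChar (-k) x)
      (Ioo_mem_nhds ht.1 ht.2) ?_ ?_ ?_ ?_ (MeasureTheory.integrable_const _) ?_).2
    · filter_upwards [Ioo_mem_nhds ht.1 ht.2] with v hv
      exact (hcontF v (Set.Ioo_subset_Icc_self hv) k).aestronglyMeasurable
    · exact (hcontF t ht' k).continuousOn.integrableOn_compact isCompact_Icc
    · exact ((Complex.continuous_ofReal.comp (continuous_re_fourierSum hVr)).mul
        (continuous_torusChar _)).aestronglyMeasurable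
    · refine Filter.Eventually.of_forall fun x v hv => ?_
      have hv' := Set.Ioo_subset_Icc_self hv
      rw [norm_mul, norm_torusChar, mul_one, Complex.norm_real]
      exact (Complex.abs_re_le_norm _).trans (norm_fourierSum_le ha (half_pos hσ)
        (gevreyDecay_transport hC ha ha1 hσ hT hA hA (hz v hv') (hdec v hv') (hdec v hv')) x)
    · refine Filter.Eventually.of_forall fun x v hv => ?_
      have hv' := Set.Ioo_subset_Icc_self hv
      have h1 := (hder v hv' x).hasDerivAt (Ico_mem_nhds hv.1 (hv.2.trans ht₁))
      exact h1.ofReal_comp.mul_const _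

/-- The locally uniform radius and norm in the definition of a solution are what make `σ` and `A`
independent of time. -/
lemma IsGevreySolution.exists_gevreyDecay (hr : 0 ≤ r) (hθ : IsGevreySolution T s r Tmax θ₀ θ)
    {t₁ : ℝ} (ht₁ : t₁ ∈ Set.Ico 0 Tmax) : ∃ σ A : ℝ, 0 < σ ∧ 0 ≤ A ∧
      ∀ t ∈ Set.Icc 0 t₁, GevreyDecay (1 / s) σ A (torusCoeff (θ t)) := by
  obtain ⟨τ, hτ, M, hM⟩ := hθ.locallyBounded t₁ ht₁
  refine ⟨τ, max M 0, hτ, le_max_right _ _, fun t ht => gevreyDecay_torusCoeff hr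
    (le_max_right _ _) (hθ.memGevrey t ⟨ht.1, ht.2.trans_lt ht₁.2⟩) ((hM t ht).trans ?_)⟩
  exact ENNReal.ofReal_le_ofReal (le_max_left _ _)

/-- On `[0, t]` both solutions share the smaller radius and the larger bound, and Fourier inversion
turns equality of coefficients into equality of functions. -/
lemma IsGevreySolution.unique (hC : 0 ≤ C) (hs : 1 ≤ s) (hr : 0 ≤ r)
    (hT : IsTransportSymbol C (1 / s) T) {θ₁ θ₂ : ℝ → (Fin d → ℝ) → ℝ}
    (h₁ : IsGevreySolution T s r Tmax θ₀ θ₁) (h₂ : IsGevreySolution T s r Tmax θ₀ θ₂) {t : ℝ}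
    (ht : t ∈ Set.Ico 0 Tmax) : θ₁ t = θ₂ t := by
  have hs0 : 0 < s := by linarith
  have ha : 0 < 1 / s := by positivity
  have ha1 : 1 / s ≤ 1 := by rw [div_le_one hs0]; exact hs
  obtain ⟨σ₁, A₁, hσ₁, hA₁, hd₁⟩ := h₁.exists_gevreyDecay hr ht
  obtain ⟨σ₂, A₂, hσ₂, hA₂, hd₂⟩ := h₂.exists_gevreyDecay hr ht
  have hσ : 0 < min σ₁ σ₂ := lt_min hσ₁ hσ₂
  have hA : 0 ≤ max A₁ A₂ := hA₁.trans (le_max_left _ _)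
  have hd₁' := fun u hu => (hd₁ u hu).mono (min_le_left σ₁ σ₂) (le_max_left A₁ A₂) hA₁
  have hd₂' := fun u hu => (hd₂ u hu).mono (min_le_right σ₁ σ₂) (le_max_right A₁ A₂) hA₂
  have hmem : t ∈ Set.Icc 0 t := ⟨ht.1, le_rfl⟩
  have heq := (h₁.isFourierSolution hC hs hσ hA hT ht.2 hd₁').eq_of_initial_eq hC ha ha1 hσ hA hT
    (h₂.isFourierSolution hC hs hσ hA hT ht.2 hd₂') (by simp only [h₁.initial, h₂.initial]) hmem
  rw [eq_re_fourierSum (h₁.memGevrey t ht).smoothPeriodic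
      ((hd₁ t hmem).rapidDecay ha hσ₁).summable_norm,
    eq_re_fourierSum (h₂.memGevrey t ht).smoothPeriodic
      ((hd₂ t hmem).rapidDecay ha hσ₂).summable_norm, heq]

end Physical

end ActiveScalar

end

theorem mainTheorem1 (d : ℕ) (hd : 2 ≤ d) (C : ℝ) (hC : 0 < C) (r₀ s : ℝ)
    (hs : (0 < r₀ ∧ r₀ ≤ 1 ∧ 1 ≤ s ∧ s ≤ 1 / r₀) ∨ (r₀ = 0 ∧ 1 ≤ s))
    (r : ℝ) (hr : 3 < r) (τ₀ K₀ : ℝ) (hτ₀ : 0 < τ₀) (hK₀ : 0 < K₀) :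
    ∃ Tstar : ℝ, 0 < Tstar ∧
      ∀ T : (Fin d → ℤ) → EuclideanSpace ℂ (Fin d), ActiveScalar.IsAdmissibleSymbol C r₀ T →
      ∀ θ₀ : (Fin d → ℝ) → ℝ, ActiveScalar.MemGevrey s r θ₀ →
        ActiveScalar.gevreyNorm s r τ₀ θ₀ ≤ ENNReal.ofReal K₀ →
        (∃ θ : ℝ → (Fin d → ℝ) → ℝ, ActiveScalar.IsGevreySolution T s r Tstar θ₀ θ) ∧
        ∀ θ₁ θ₂ : ℝ → (Fin d → ℝ) → ℝ,
          ActiveScalar.IsGevreySolution T s r Tstar θ₀ θ₁ →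
          ActiveScalar.IsGevreySolution T s r Tstar θ₀ θ₂ →
          ∀ t ∈ Set.Ico 0 Tstar, θ₁ t = θ₂ t := by
  have hs1 : 1 ≤ s := by rcases hs with h | h <;> tauto
  have hs0 : 0 < s := by linarith
  have ha : 0 < 1 / s := by positivity
  have ha1 : 1 / s ≤ 1 := by rw [div_le_one hs0]; exact hs1
  -- The point where the admissible range of `s` enters: the order of `𝐓` must not exceed the order
  -- `1/s` of the dissipation gained from the shrinking radius.
  have hr₀ : r₀ ≤ 1 / s := by
    rcases hs with ⟨h0, -, -, h⟩ | ⟨h0, -⟩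
    · rwa [le_div_comm₀ h0 hs0]
    · rw [h0]
      exact ha.le
  have hr0 : 0 ≤ r := by linarith
  -- The existence time is fixed here, before the symbol and the datum are introduced.
  obtain ⟨t₁, σ, A, ht₁, hσ, hA, hsol⟩ :=
    ActiveScalar.exists_fourier_solution d (K₀ := K₀) hC ha ha1 hτ₀
  refine ⟨t₁, ht₁, fun T hT θ₀ hθ₀ hnorm => ?_⟩
  have hT' := hT.isTransportSymbol hC.le hr₀
  have hdec := ActiveScalar.gevreyDecay_torusCoeff hr0 hK₀.le hθ₀ hnorm
  refine ⟨?_, fun θ₁ θ₂ h₁ h₂ t ht => h₁.unique hC.le hs1 hr0 hT' h₂ ht⟩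
  obtain ⟨c, hc0, hc, htay⟩ := hsol T hT' _ (ActiveScalar.hermitianSymm_torusCoeff θ₀)
    (ActiveScalar.torusCoeff_zero_eq_zero hθ₀.meanZero) hdec
  exact ⟨_, ActiveScalar.isGevreySolution_re_fourierSum hC.le hs1 hσ (by positivity : 0 < σ / 4) hT'
    hθ₀.smoothPeriodic (hdec.rapidDecay ha hτ₀).summable_norm hc0 hc htay⟩
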